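/- **Proposition (Getting rid of the atom at zero).** For a countable locally finite graph $G=(V,E)$, let $A$ be its adjacency operator on $\ell^2_{\mathbb C}(V)$, with domain the finitely supported vectors. If $A$ is essentially self-adjoint, the spectral measure of $G$ rooted at $o\in V$ is the unique probability measure $\mu_{(G,o)}$ on $\mathbb R$ such that $\langle \mathfrak e_o,(A-z)^{-1}\mathfrak e_o\rangle=\int_{\mathbb R}\frac{1}{\lambda-z}\,\mu_{(G,o)}(\mathrm d\lambda)$ for all $z\in\mathbb C\setminus\mathbb R$. For a finite measure $\mu$ on $\mathbb R$, put $$\alpha=\mu(\{0\}),\qquad \beta=\int_{\mathbb R}\frac{1}{\lambda^{2}}\,\mu(\mathrm d\lambda)\in[0,\infty],\qquad \beta^\star=\int_{\mathbb R\setminus\{0\}}\frac{1}{\lambda^{2}}\,\mu(\mathrm d\lambda)\in[0,\infty],$$ where $1/0=\infty$ (and $\infty\cdot 0=0$). For a tree $T$ with root $o$, let $\partial o$ be the set of neighbours of $o$ and, for $x\in\partial o$, let $T_{x\to o}$ be the connected component of $x$ in the forest obtained from $T$ by deleting $o$. Write $\alpha_o,\beta_o,\beta^\star_o$ for $\alpha,\beta,\beta^\star$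 when $\mu=\mu_{(T,o)}$, write $\alpha_{x\to o},\beta_{x\to o}$ for $\alpha,\beta$ when $\mu=\mu_{(T_{x\to o},x)}$, and let $\mathcal N_o^+=\#\{x\in\partial o:\alpha_{x\to o}>0\}$. Let $\mathcal G_\star$ (resp. $\mathcal G_{\star\star}$) be the space of connected locally finite rooted (resp. doubly rooted) graphs up to root-preserving isomorphism, with the Borel $\sigma$-algebra of the local topology. A random rooted graph $(G,o)$ is *unimodular* if $\mathbf E\big[\sum_{x\in V(G)}f(G,o,x)\big]=\mathbf E\big[\sum_{x\in V(G)}f(G,x,o)\big]$ for every Borel function $f:\mathcal G_{\star\star}\to[0,\infty]$. Let $(T,o)$ be a unimodular random rooted graph that is almost surely a tree. Then, almost surely, the adjacency operators of $T$ and of all $T_{x\to o}$, $x\in\partial o$, are essentially self-adjoint (so that the quantities above are well defined), and, as an identity in $[0,\infty]$, $$\mathbf E[\beta^\star_o]=\mathbf E\big[\mathbf 1_{(\alpha_o=0)}\beta_o\big]+\mathbf E\big[\mathbf 1_{(\mathcal N_o^+\ge 2)}\beta_o\big]+\mathbf E\left[\mathbf 1_{(\mathcal N_o^+\ge 2)}\,\frac{\sum_{x\in\partial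 o}\beta_{x\to o}\mathbf 1_{(\alpha_{x\to o}=0)}}{\sum_{x\in\partial o}\alpha_{x\to o}\mathbf 1_{(\alpha_{x\to o}>0)}}\right].$$ -/

import Mathlib

open MeasureTheory Set
open scoped ENNReal

noncomputable section

namespace AtomAtZero

/-! ### Rooted graphs, the local topology, unimodularity -/

/-- A connected, locally finite graph with `k` distinguished vertices (roots), in order. Such a
graph is countable, so that vertex sets in `Type` suffice. -/
structure RootedGraph (k : ℕ) where
  V : Type
  graph : SimpleGraph V
  connected : graph.Connected
  locFin : ∀ v, (graph.neighborSet v).Finite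
  root : Fin k → V

namespace RootedGraph

variable {k : ℕ}

/-- Root-preserving isomorphism. -/
def Iso (G H : RootedGraph k) : Prop :=
  ∃ φ : G.graph ≃g H.graph, ∀ i, φ (G.root i) = H.root i

instance setoid (k : ℕ) : Setoid (RootedGraph k) where
  r := Iso
  iseqv :=
    { refl := fun _ => ⟨SimpleGraph.Iso.refl, fun _ => rfl⟩
      symm := fun {_ _} ⟨φ, h⟩ => ⟨φ.symm, fun i => by rw [← h i]; exact φ.symm_apply_apply _⟩
      trans := fun {_ _ _} ⟨φ, h⟩ ⟨ψ, h'⟩ => ⟨φ.trans ψ, fun i => by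
        rw [← h' i, ← h i]; rfl⟩ }

/-- The vertices at graph distance at most `r` from the roots. -/
def ball (G : RootedGraph k) (r : ℕ) : Set G.V := {v | ∃ i, G.graph.dist (G.root i) v ≤ r}

lemma root_mem_ball (G : RootedGraph k) (r : ℕ) (i : Fin k) : G.root i ∈ G.ball r :=
  ⟨i, by simp⟩

/-- The balls of radius `r` around the roots are isomorphic, as rooted graphs. -/
def BallIso (r : ℕ) (G H : RootedGraph k) : Prop :=
  ∃ φ : G.graph.induce (G.ball r) ≃g H.graph.induce (H.ball r),
    ∀ i, φ ⟨G.root i, G.root_mem_ball r i⟩ = ⟨H.root i, H.root_mem_ball r i⟩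

end RootedGraph

/-- The space of `k`-rooted connected locally finite graphs up to root-preserving isomorphism:
`GStar 1` is the space of rooted graphs, `GStar 2` that of doubly rooted graphs. -/
def GStar (k : ℕ) : Type 1 := Quotient (RootedGraph.setoid k)

/-- The isomorphism class of a rooted graph. -/
def RootedGraph.toClass {k : ℕ} (G : RootedGraph k) : GStar k := Quotient.mk _ G

/-- The classes whose ball of radius `r` is isomorphic to that of `H`. For the distance
`1 / (1 + r)`, with `r` the largest integer such that the balls of radius `r` are isomorphic,
these sets are exactly the balls of the metric space. -/
def GStar.cylinder {k : ℕ} (r : ℕ) (H : RootedGraph k) : Set (GStar k) :=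
  {c | ∃ K : RootedGraph k, K.toClass = c ∧ RootedGraph.BallIso r H K}

/-- The local topology. -/
instance (k : ℕ) : TopologicalSpace (GStar k) :=
  TopologicalSpace.generateFrom {U | ∃ (r : ℕ) (H : RootedGraph k), U = GStar.cylinder r H}

instance (k : ℕ) : MeasurableSpace (GStar k) := borel (GStar k)

instance (k : ℕ) : BorelSpace (GStar k) := ⟨rfl⟩

/-- The same graph with other roots. -/
def RootedGraph.withRoots {k l : ℕ} (G : RootedGraph k) (root : Fin l → G.V) : RootedGraph l where
  V := G.V
  graph := G.graph
  connected := G.connected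
  locFin := G.locFin
  root := root

/-- The root of a singly rooted graph. -/
abbrev RootedGraph.o (G : RootedGraph 1) : G.V := G.root 0

/-- The Mass Transport Principle: `E ∑ₓ f(G, o, x) = E ∑ₓ f(G, x, o)` for all Borel `f ≥ 0` on
doubly rooted graphs. -/
def IsUnimodular {Ω : Type*} [MeasurableSpace Ω] (P : Measure Ω) (T : Ω → RootedGraph 1) : Prop :=
  ∀ f : GStar 2 → ℝ≥0∞, Measurable f →
    ∫⁻ ω, ∑' x : (T ω).V, f ((T ω).withRoots ![(T ω).o, x]).toClass ∂P =
      ∫⁻ ω, ∑' x : (T ω).V, f ((T ω).withRoots ![x, (T ω).o]).toClass ∂P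

/-! ### The adjacency operator and spectral measures -/

section Spectral

variable {V : Type*}

/-- The Hilbert space of square-summable complex functions on `V`. -/
abbrev ell2 (V : Type*) : Type _ := lp (fun _ : V => ℂ) 2

/-- The vector of the canonical basis at `o`. -/
def basisVec (o : V) : ell2 V := by
  classical exact lp.single 2 o (1 : ℂ)

/-- The finitely supported vectors. -/
def finSupp (V : Type*) : Submodule ℂ (ell2 V) where
  carrier := {ψ | (Function.support (ψ : V → ℂ)).Finite}
  zero_mem' := by
    show (Function.support ((0 : ell2 V) : V → ℂ)).Finite
    rw [lp.coeFn_zero, Function.support_zero]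
    exact Set.finite_empty
  add_mem' := by
    intro a b ha hb
    exact (Set.Finite.union ha hb).subset (Function.support_add _ _)
  smul_mem' := by
    intro c a ha
    exact Set.Finite.subset ha (Function.support_const_smul_subset c _)

lemma finite_support_adj (G : SimpleGraph V) (hG : ∀ v, (G.neighborSet v).Finite) {ψ : V → ℂ}
    (hψ : (Function.support ψ).Finite) :
    (Function.support fun x => ∑ y ∈ (hG x).toFinset, ψ y).Finite := by
  refine (hψ.biUnion fun y _ => hG y).subset ?_
  intro x hx
  obtain ⟨y, hy, hne⟩ := Finset.exists_ne_zero_of_sum_ne_zero hx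
  simp only [Set.Finite.mem_toFinset, SimpleGraph.mem_neighborSet] at hy
  exact Set.mem_biUnion (show y ∈ Function.support ψ from hne) hy.symm

lemma memℓp_adj (G : SimpleGraph V) (hG : ∀ v, (G.neighborSet v).Finite) {ψ : V → ℂ}
    (hψ : (Function.support ψ).Finite) :
    Memℓp (E := fun _ : V => ℂ) (fun x => ∑ y ∈ (hG x).toFinset, ψ y) 2 :=
  (memℓp_zero (finite_support_adj G hG hψ)).of_exponent_ge zero_le

/-- The adjacency operator of a locally finite graph, with domain the finitely supported vectors:
`(A ψ)(x) = ∑ ψ(y)`, the sum running over the neighbours `y` of `x`. -/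
def adjOp (G : SimpleGraph V) (hG : ∀ v, (G.neighborSet v).Finite) : ell2 V →ₗ.[ℂ] ell2 V where
  domain := finSupp V
  toFun :=
    { toFun := fun ψ => ⟨fun x => ∑ y ∈ (hG x).toFinset, (ψ : ell2 V) y, memℓp_adj G hG ψ.2⟩
      map_add' := by
        intro a b
        ext x
        exact Finset.sum_add_distrib
      map_smul' := by
        intro c a
        ext x
        simp [Finset.mul_sum] }

/-- The closure of the adjacency operator is self-adjoint. -/
def EssSelfAdj (G : SimpleGraph V) (hG : ∀ v, (G.neighborSet v).Finite) : Prop :=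
  IsSelfAdjoint (adjOp G hG).closure

/-- `⟨e_o, (A - z)⁻¹ e_o⟩ = ∫ μ(dx) / (x - z)` for all non-real `z`, where `A` stands for the
closure of the adjacency operator and `μ` is a probability measure. -/
def IsSpectralMeasure (G : SimpleGraph V) (hG : ∀ v, (G.neighborSet v).Finite) (o : V)
    (μ : Measure ℝ) : Prop :=
  IsProbabilityMeasure μ ∧ ∀ z : ℂ, z.im ≠ 0 →
    ∃ ψ : (adjOp G hG).closure.domain,
      (adjOp G hG).closure ψ - z • (ψ : ell2 V) = basisVec o ∧
      inner ℂ (basisVec o) (ψ : ell2 V) = ∫ x : ℝ, 1 / ((x : ℂ) - z) ∂μ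

open Classical in
/-- The spectral measure of the graph `G` rooted at `o`, when the adjacency operator is essentially
self-adjoint (in which case it exists and is unique); the zero measure otherwise. -/
def spectralMeasure (G : SimpleGraph V) (hG : ∀ v, (G.neighborSet v).Finite) (o : V) :
    Measure ℝ :=
  if h : EssSelfAdj G hG ∧ ∃ μ, IsSpectralMeasure G hG o μ then h.2.choose else 0

/-- The set of vertices that can be reached from `x` without visiting `o`. -/
def branchSet (G : SimpleGraph V) (x o : V) : Set V := {v | ∃ p : G.Walk x v, o ∉ p.support}

lemma mem_branchSet (G : SimpleGraph V) {x o : V} (h : G.Adj o x) : x ∈ branchSet G x o :=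
  ⟨SimpleGraph.Walk.nil, by simpa using h.ne⟩

/-- The connected component of `x` in the graph obtained by deleting the vertex `o`. -/
abbrev branch (G : SimpleGraph V) (x o : V) : SimpleGraph (branchSet G x o) :=
  G.induce (branchSet G x o)

lemma branch_locFin (G : SimpleGraph V) (hG : ∀ v, (G.neighborSet v).Finite) (x o : V)
    (v : branchSet G x o) : ((branch G x o).neighborSet v).Finite :=
  ((hG v).preimage Subtype.val_injective.injOn).subset fun _ hw => hw

end Spectral

/-! ### First-order and second-order quantities -/

/-- `α = μ({0})`. -/
def alpha (μ : Measure ℝ) : ℝ≥0∞ := μ {0}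

/-- `β = ∫ μ(dx) / x²`, where `1 / 0 = ∞`. -/
def beta (μ : Measure ℝ) : ℝ≥0∞ := ∫⁻ x, (ENNReal.ofReal (x ^ 2))⁻¹ ∂μ

/-- `β⋆ = ∫ μ(dx) / x²` over the nonzero reals. -/
def betaStar (μ : Measure ℝ) : ℝ≥0∞ := ∫⁻ x in {0}ᶜ, (ENNReal.ofReal (x ^ 2))⁻¹ ∂μ

namespace RootedGraph

/-- The spectral measure at the root. -/
def specRoot (T : RootedGraph 1) : Measure ℝ := spectralMeasure T.graph T.locFin T.o

/-- The set `∂o` of the neighbours of the root. -/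
abbrev nbrs (T : RootedGraph 1) : Set T.V := T.graph.neighborSet T.o

/-- The spectral measure at `x` of the subtree `T_{x → o}` which contains the neighbour `x` of `o`
when `o` is deleted. -/
def specBranch (T : RootedGraph 1) (x : T.nbrs) : Measure ℝ :=
  spectralMeasure (branch T.graph x T.o) (branch_locFin T.graph T.locFin x T.o)
    ⟨x, mem_branchSet T.graph x.2⟩

/-- The number `N_o⁺` of neighbours `x` of the root with `α_{x → o} > 0`. -/
def Nplus (T : RootedGraph 1) : ℕ := {x : T.nbrs | 0 < alpha (T.specBranch x)}.ncard

end RootedGraph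

end AtomAtZero

end

noncomputable section

namespace AtomAtZero

open RootedGraph

/-! ### The Borel structure of the space of rooted graphs -/

section LocalTopology

namespace RootedGraph

variable {k l : ℕ}

/-! On a tree the resolvent entries at `i t` are, up to powers of `-i`, products along paths of the
positive continued fractions `h(x → o) = 1 / (t + ∑ h(y → x))`. Their even truncations increase to
`msgLo` and their odd truncations decrease to `msgHi`. Both limits satisfy `t h + h ∑ h = 1` at the
root, with the two kinds of limit alternating, and the summand is a function of an oriented edge.
Mass transport therefore gives both limits the same expectation, so they agree almost surely
(`IsUnimodular.msgLo_root_eq_msgHi`). Once they agree, explicit finitely supported vectors show that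
the deficiency spaces are trivial (`essSelfAdj_of_msgLo_eq_msgHi`). The branches inherit this
(`EssSelfAdj.branch`), and `h` is the Poisson integral of the spectral measure at height `t`.

Let `t` tend to `0` along powers of two. Then `α = lim t h` and `β = lim h / t`, so the recursion
for `h` becomes `α = 1 / (1 + ∑ β)` and `β = 1 / ∑ α` over the neighbours (`GoodTree.aE_rec`,
`GoodTree.bE_rec`). To reach `β⋆`, the Poisson integrals at `t` and `2t` are combined so that an
atom at zero cancels (`two_mul_poisson`). The result `bInt` increases to `β⋆`. On a tree it equals
the sum, over the vertices `v` at odd distance from the root, of the product of the moduli of the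
Green function at the two heights (`ConvTree.bInt_spectralMeasure`).

Since `β⋆ = β` when `α = 0`, only the expectation of `β⋆` on `α > 0` has to be computed. Let a
vertex `w` with `α_w > 0` distribute its odd sum as follows. Follow the path from `w` to an odd
vertex `v` as long as the vertices at even distance from `w` have `α > 0`. If the path reaches `v`,
the term goes to `v`. Otherwise it goes to the predecessor of the first vertex that fails. The total
sent is the whole approximation of `β⋆` (`GoodTree.tsum_transport`).

What `o` receives vanishes unless two of its branches have positive mass. In that case `β_o` is
finite and the Green vectors at `o` converge in `ℓ²`. Their limit is carried, among odd vertices, by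
those that send mass to `o`, so the amount received tends to `β_o (1 + ∑ β_{x → o} 1_(α_{x → o} =
0))` (`GoodTree.tendsto_tsum_transport`). As `β_o` is the inverse of `∑ α_{x → o}`, this is the sum
of the last two terms of the identity. The limit also dominates the received mass at every scale.
Monotone convergence on the sending side, with this domination and Fatou's lemma on the receiving
side, passes to the limit in `[0, ∞]` with no integrability assumption. -/

lemma BallIso.dist_le {G H : RootedGraph k} {R : ℕ}
    (φ : G.graph.induce (G.ball R) ≃g H.graph.induce (H.ball R)) {u v : G.V}
    (p : G.graph.Walk u v) (hu : u ∈ G.ball R)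
    (h : ∃ i, G.graph.dist (G.root i) u + p.length ≤ R) :
    ∃ hv : v ∈ G.ball R, H.graph.dist (φ ⟨u, hu⟩ : H.V) (φ ⟨v, hv⟩ : H.V) ≤ p.length := by
  -- The bound on distance plus remaining length is preserved at each step, so the walk never leaves
  -- the ball on which the isomorphism is defined.
  induction p with
  | nil => exact ⟨hu, by simp⟩
  | @cons a b c hab q ih =>
    obtain ⟨i, hi⟩ := h
    have h1 : G.graph.dist (G.root i) b ≤ G.graph.dist (G.root i) a + 1 := by
      have := G.connected.dist_triangle (u := G.root i) (v := a) (w := b)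
      rwa [SimpleGraph.dist_eq_one_iff_adj.2 hab] at this
    rw [SimpleGraph.Walk.length_cons] at hi
    have hb : b ∈ G.ball R := ⟨i, by omega⟩
    obtain ⟨hc, h2⟩ := ih hb ⟨i, by omega⟩
    refine ⟨hc, ?_⟩
    have h3 : H.graph.Adj (φ ⟨a, hu⟩ : H.V) (φ ⟨b, hb⟩ : H.V) :=
      φ.map_adj_iff.2 (show (G.graph.induce (G.ball R)).Adj ⟨a, hu⟩ ⟨b, hb⟩ from hab)
    have h4 := H.connected.dist_triangle (u := (φ ⟨a, hu⟩ : H.V)) (v := (φ ⟨b, hb⟩ : H.V))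
      (w := (φ ⟨c, hc⟩ : H.V))
    rw [SimpleGraph.dist_eq_one_iff_adj.2 h3] at h4
    rw [SimpleGraph.Walk.length_cons]
    omega

lemma BallIso.mem_ball_of_near {G : RootedGraph k} {n r R : ℕ} (hR : n + r ≤ R) {u v : G.V}
    (hu : ∃ i, G.graph.dist (G.root i) u ≤ n) (hv : G.graph.dist u v ≤ r) : v ∈ G.ball R := by
  obtain ⟨i, hi⟩ := hu
  exact ⟨i, (G.connected.dist_triangle (v := u)).trans (by omega)⟩

lemma BallIso.dist_le_of_near {G H : RootedGraph k} {n r R : ℕ} (hR : n + r ≤ R)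
    (φ : G.graph.induce (G.ball R) ≃g H.graph.induce (H.ball R)) {u v : G.V}
    (hu : ∃ i, G.graph.dist (G.root i) u ≤ n) (hv : G.graph.dist u v ≤ r)
    (hu' : u ∈ G.ball R) (hv' : v ∈ G.ball R) :
    H.graph.dist (φ ⟨u, hu'⟩ : H.V) (φ ⟨v, hv'⟩ : H.V) ≤ r := by
  obtain ⟨p, hp⟩ := G.connected.exists_walk_length_eq_dist u v
  obtain ⟨i, hi⟩ := hu
  obtain ⟨_, h⟩ := BallIso.dist_le φ p hu' ⟨i, by omega⟩
  exact h.trans (by omega)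

/-- An isomorphism of balls around the roots restricts to smaller balls around other roots. -/
lemma BallIso.restrict {G H : RootedGraph k} {n r R : ℕ} (hR : n + r ≤ R)
    (φ : G.graph.induce (G.ball R) ≃g H.graph.induce (H.ball R))
    (hφ : ∀ i, φ ⟨G.root i, G.root_mem_ball R i⟩ = ⟨H.root i, H.root_mem_ball R i⟩)
    (τ : Fin l → G.V) (τ' : Fin l → H.V)
    (hτ : ∀ j, ∃ i, G.graph.dist (G.root i) (τ j) ≤ n)
    (hτR : ∀ j, τ j ∈ G.ball R)
    (hτ' : ∀ j, τ' j = φ ⟨τ j, hτR j⟩) :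
    BallIso r (G.withRoots τ) (H.withRoots τ') := by
  have hφs : ∀ i, φ.symm ⟨H.root i, H.root_mem_ball R i⟩ = ⟨G.root i, G.root_mem_ball R i⟩ :=
    fun i => by rw [← hφ i]; exact φ.symm_apply_apply _
  have hτ'n : ∀ j, ∃ i, H.graph.dist (H.root i) (τ' j) ≤ n := by
    intro j
    obtain ⟨i, hi⟩ := hτ j
    refine ⟨i, ?_⟩
    have := BallIso.dist_le_of_near (n := 0) (r := n) (by omega) φ ⟨i, by simp⟩ hi
      (G.root_mem_ball R i) (hτR j)
    rwa [hφ i, ← hτ' j] at this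
  have hτ'R : ∀ j, τ' j ∈ H.ball R := fun j => by rw [hτ' j]; exact Subtype.coe_prop _
  have hτs : ∀ j, τ j = φ.symm ⟨τ' j, hτ'R j⟩ := by
    intro j
    have : (⟨τ' j, hτ'R j⟩ : H.ball R) = φ ⟨τ j, hτR j⟩ := Subtype.ext (hτ' j)
    rw [this]
    simp
  have hG : ∀ v ∈ (G.withRoots τ).ball r, v ∈ G.ball R := by
    rintro v ⟨j, hj⟩
    exact BallIso.mem_ball_of_near hR (hτ j) hj
  have hH : ∀ v ∈ (H.withRoots τ').ball r, v ∈ H.ball R := by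
    rintro v ⟨j, hj⟩
    exact BallIso.mem_ball_of_near hR (hτ'n j) hj
  have hGH : ∀ v (hv : v ∈ (G.withRoots τ).ball r),
      (φ ⟨v, hG v hv⟩ : H.V) ∈ (H.withRoots τ').ball r := by
    rintro v ⟨j, hj⟩
    refine ⟨j, ?_⟩
    have := BallIso.dist_le_of_near hR φ (hτ j) hj (hτR j) (hG v ⟨j, hj⟩)
    rwa [← hτ' j] at this
  have hHG : ∀ v (hv : v ∈ (H.withRoots τ').ball r),
      (φ.symm ⟨v, hH v hv⟩ : G.V) ∈ (G.withRoots τ).ball r := by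
    rintro v ⟨j, hj⟩
    refine ⟨j, ?_⟩
    have := BallIso.dist_le_of_near hR φ.symm (hτ'n j) hj (hτ'R j) (hH v ⟨j, hj⟩)
    rwa [← hτs j] at this
  refine ⟨⟨⟨fun v => ⟨(φ ⟨v.1, hG v.1 v.2⟩).1, hGH v.1 v.2⟩,
    fun v => ⟨(φ.symm ⟨v.1, hH v.1 v.2⟩).1, hHG v.1 v.2⟩, ?_, ?_⟩, ?_⟩, ?_⟩
  · intro v
    apply Subtype.ext
    have h := congrArg Subtype.val (φ.symm_apply_apply ⟨v.1, hG v.1 v.2⟩)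
    exact h
  · intro v
    apply Subtype.ext
    have h := congrArg Subtype.val (φ.apply_symm_apply ⟨v.1, hH v.1 v.2⟩)
    exact h
  · intro v w
    exact φ.map_adj_iff (v := ⟨v.1, hG v.1 v.2⟩) (w := ⟨w.1, hG w.1 w.2⟩)
  · intro j
    apply Subtype.ext
    exact (hτ' j).symm

lemma BallIso.refl (r : ℕ) (G : RootedGraph k) : BallIso r G G :=
  ⟨SimpleGraph.Iso.refl, fun _ => rfl⟩

lemma BallIso.symm {r : ℕ} {G H : RootedGraph k} (h : BallIso r G H) : BallIso r H G := by
  obtain ⟨φ, hφ⟩ := h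
  exact ⟨φ.symm, fun i => by rw [← hφ i]; exact φ.symm_apply_apply _⟩

lemma BallIso.trans {r : ℕ} {G H K : RootedGraph k} (h : BallIso r G H) (h' : BallIso r H K) :
    BallIso r G K := by
  obtain ⟨φ, hφ⟩ := h
  obtain ⟨ψ, hψ⟩ := h'
  exact ⟨φ.trans ψ, fun i => by rw [← hψ i, ← hφ i]; rfl⟩

lemma BallIso.reroot {r : ℕ} {G H : RootedGraph k} (h : BallIso r G H) (σ : Fin l → Fin k) :
    BallIso r (G.withRoots (G.root ∘ σ)) (H.withRoots (H.root ∘ σ)) := by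
  obtain ⟨φ, hφ⟩ := h
  refine BallIso.restrict (n := 0) (by omega) φ hφ _ _ (fun j => ⟨σ j, by simp⟩)
    (fun j => G.root_mem_ball r (σ j)) fun j => ?_
  rw [show φ ⟨(G.root ∘ σ) j, _⟩ = _ from hφ (σ j)]
  rfl

lemma BallIso.mono {r R : ℕ} (hr : r ≤ R) {G H : RootedGraph k} (h : BallIso R G H) :
    BallIso r G H := by
  obtain ⟨φ, hφ⟩ := h
  exact BallIso.restrict (n := 0) (by omega) φ hφ G.root H.root (fun j => ⟨j, by simp⟩)
    (fun j => G.root_mem_ball R j) fun j => by rw [hφ j]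

lemma Iso.dist_eq {V W : Type*} {G : SimpleGraph V} {H : SimpleGraph W} (φ : G ≃g H) (u v : V)
    (hG : G.Connected) (hH : H.Connected) : H.dist (φ u) (φ v) = G.dist u v := by
  have key : ∀ {V W : Type _} {G : SimpleGraph V} {H : SimpleGraph W} (φ : G ≃g H) (u v : V),
      G.Connected → H.dist (φ u) (φ v) ≤ G.dist u v := by
    intro V W G H φ u v hG
    obtain ⟨p, hp⟩ := hG.exists_walk_length_eq_dist u v
    rw [← hp, ← SimpleGraph.Walk.length_map φ.toHom p]
    exact SimpleGraph.dist_le _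
  apply le_antisymm (key φ u v hG)
  have key' : ∀ {V : Type _} {W : Type _} {G : SimpleGraph V} {H : SimpleGraph W} (φ : G ≃g H)
      (u v : V), H.Connected → G.dist u v ≤ H.dist (φ u) (φ v) := by
    intro V W G H φ u v hG
    obtain ⟨p, hp⟩ := hG.exists_walk_length_eq_dist (φ u) (φ v)
    rw [← hp, ← SimpleGraph.Walk.length_map φ.symm.toHom p]
    refine (SimpleGraph.dist_le _).trans_eq' ?_
    simp
  exact key' φ u v hH

lemma Iso.ballIso (r : ℕ) {G H : RootedGraph k} (h : Iso G H) : BallIso r G H := by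
  obtain ⟨φ, hφ⟩ := h
  have hd : ∀ v, φ v ∈ H.ball r ↔ v ∈ G.ball r := by
    intro v
    refine exists_congr fun i => ?_
    rw [← hφ i, Iso.dist_eq φ _ _ G.connected H.connected]
  refine ⟨⟨⟨fun v => ⟨φ v.1, (hd _).2 v.2⟩, fun v => ⟨φ.symm v.1, (hd _).1 (by simp)⟩,
    fun v => Subtype.ext (by simp), fun v => Subtype.ext (by simp)⟩, ?_⟩, ?_⟩
  · intro v w
    exact φ.map_adj_iff
  · intro i
    exact Subtype.ext (hφ i)

lemma finite_setOf_dist_le (G : RootedGraph k) (u : G.V) (n : ℕ) :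
    {v | G.graph.dist u v ≤ n}.Finite := by
  induction n with
  | zero =>
    refine (Set.finite_singleton u).subset fun v hv => ?_
    have : G.graph.dist u v = 0 := by simpa using hv
    exact (G.connected.dist_eq_zero_iff.1 this).symm
  | succ n ih =>
    refine (ih.union (ih.biUnion fun v _ => G.locFin v)).subset fun v hv => ?_
    by_cases h : G.graph.dist u v ≤ n
    · exact Or.inl h
    · right
      have hv' : G.graph.dist u v = n + 1 := le_antisymm hv (by omega)
      obtain ⟨p, hp⟩ := G.connected.exists_walk_length_eq_dist v u
      cases p with
      | nil => simp at hv'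
      | @cons _ b _ hb q =>
        rw [SimpleGraph.Walk.length_cons, SimpleGraph.dist_comm, hv'] at hp
        refine Set.mem_biUnion (x := b) ?_ hb.symm
        have := SimpleGraph.dist_le q
        rw [SimpleGraph.dist_comm] at this
        show G.graph.dist u b ≤ n
        omega

lemma ball_finite (G : RootedGraph k) (r : ℕ) : (G.ball r).Finite := by
  have : G.ball r = ⋃ i, {v | G.graph.dist (G.root i) v ≤ r} := by
    ext v; simp [ball]
  rw [this]
  exact Set.finite_iUnion fun i => G.finite_setOf_dist_le _ _

end RootedGraph

open RootedGraph

namespace GStar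

variable {k l : ℕ}

lemma toClass_eq_iff {G H : RootedGraph k} : G.toClass = H.toClass ↔ Iso G H :=
  Quotient.eq (r := RootedGraph.setoid k)

lemma toClass_mem_cylinder {r : ℕ} {G H : RootedGraph k} :
    G.toClass ∈ cylinder r H ↔ BallIso r H G := by
  constructor
  · rintro ⟨K, hK, h⟩
    exact h.trans (Iso.ballIso r (toClass_eq_iff.1 hK))
  · exact fun h => ⟨G, rfl, h⟩

lemma cylinder_congr {r : ℕ} {G H : RootedGraph k} (h : BallIso r G H) :
    cylinder r G = cylinder r H := by
  ext c
  induction c using Quotient.inductionOn with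
  | h K =>
    exact toClass_mem_cylinder.trans (Iff.trans ⟨h.symm.trans, h.trans⟩ toClass_mem_cylinder.symm)

/-- A code for the ball of radius `r` of a rooted graph. -/
def ballCode (G : RootedGraph k) (r : ℕ) :
    Σ n : ℕ, SimpleGraph (Fin n) × (Fin k → Fin n) :=
  haveI := (G.ball_finite r).to_subtype
  let e := Finite.equivFin (G.ball r)
  ⟨Nat.card (G.ball r), (G.graph.induce (G.ball r)).map e.toEmbedding,
    fun i => e ⟨G.root i, G.root_mem_ball r i⟩⟩

lemma ballIso_of_ballCode_eq {G H : RootedGraph k} {r : ℕ} (h : ballCode G r = ballCode H r) :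
    BallIso r G H := by
  have key : ∀ G : RootedGraph k, ∃ φ : G.graph.induce (G.ball r) ≃g (ballCode G r).2.1,
      ∀ i, φ ⟨G.root i, G.root_mem_ball r i⟩ = (ballCode G r).2.2 i := by
    intro G
    have := (G.ball_finite r).to_subtype
    exact ⟨SimpleGraph.Iso.map (Finite.equivFin (G.ball r)) _, fun i => rfl⟩
  obtain ⟨φ, hφ⟩ := key G
  obtain ⟨ψ, hψ⟩ := key H
  generalize ballCode G r = c at *
  generalize ballCode H r = c' at *
  subst h
  refine ⟨φ.trans ψ.symm, fun i => ?_⟩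
  change ψ.symm (φ _) = _
  rw [hφ, ← hψ i]
  exact ψ.symm_apply_apply _

/-- A cylinder depends only on the code of the ball that defines it, and codes range over a
countable type. -/
lemma countable_cylinders (k : ℕ) :
    {U : Set (GStar k) | ∃ (r : ℕ) (H : RootedGraph k), U = cylinder r H}.Countable := by
  have : {U : Set (GStar k) | ∃ (r : ℕ) (H : RootedGraph k), U = cylinder r H} ⊆
      ⋃ r : ℕ, Set.range (fun H : RootedGraph k => cylinder r H) := by
    rintro U ⟨r, H, rfl⟩
    exact Set.mem_iUnion.2 ⟨r, H, rfl⟩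
  refine (Set.countable_iUnion fun r => ?_).mono this
  have hf : Function.FactorsThrough (fun H : RootedGraph k => cylinder r H)
      (fun H => ballCode H r) := fun G H h => cylinder_congr (ballIso_of_ballCode_eq h)
  have : (fun H : RootedGraph k => cylinder r H) =
      Function.extend (fun H => ballCode H r) (fun H : RootedGraph k => cylinder r H)
        (fun _ => ∅) ∘ fun H => ballCode H r := by
    funext H
    exact (hf.extend_apply _ H).symm
  rw [this]
  exact (Set.countable_range _).mono (Set.range_comp_subset_range _ _)

instance (k : ℕ) : SecondCountableTopology (GStar k) := ⟨⟨_, countable_cylinders k, rfl⟩⟩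

lemma measurableSpace_eq (k : ℕ) : (inferInstance : MeasurableSpace (GStar k)) =
    MeasurableSpace.generateFrom
      {U : Set (GStar k) | ∃ (r : ℕ) (H : RootedGraph k), U = cylinder r H} :=
  borel_eq_generateFrom_of_subbasis rfl

/-- The local metric is an ultrametric: two balls that meet are nested. This allows induction on
Borel sets starting from cylinders. -/
lemma isPiSystem_cylinders (k : ℕ) :
    IsPiSystem {U : Set (GStar k) | ∃ (r : ℕ) (H : RootedGraph k), U = cylinder r H} := by
  have key : ∀ {r r' : ℕ} {H H' : RootedGraph k}, r ≤ r' →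
      (cylinder r H ∩ cylinder r' H').Nonempty →
      cylinder r H ∩ cylinder r' H' = cylinder r' H' := by
    rintro r r' H H' hr ⟨c, h1, h2⟩
    apply Set.inter_eq_right.2
    induction c using Quotient.inductionOn with
    | h K =>
      have h1 := toClass_mem_cylinder.1 h1
      have h2 := toClass_mem_cylinder.1 h2
      intro c hc
      induction c using Quotient.inductionOn with
      | h L =>
        have h3 := toClass_mem_cylinder.1 hc
        exact toClass_mem_cylinder.2 (h1.trans ((h2.symm.trans h3).mono hr))
  rintro _ ⟨r, H, rfl⟩ _ ⟨r', H', rfl⟩ hne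
  rcases le_total r r' with h | h
  · exact ⟨r', H', key h hne⟩
  · rw [Set.inter_comm] at hne ⊢
    exact ⟨r, H, key h hne⟩

lemma isOpen_cylinder (r : ℕ) (H : RootedGraph k) : IsOpen (cylinder r H) :=
  TopologicalSpace.isOpen_generateFrom_of_mem ⟨r, H, rfl⟩

/-- A function of rooted graphs determined by a ball of fixed radius is measurable. -/
lemma measurable_of_ballIso {β : Type*} [MeasurableSpace β] (f : GStar k → β) (R : ℕ)
    (hf : ∀ G H : RootedGraph k, BallIso R G H → f G.toClass = f H.toClass) : Measurable f := by
  intro s _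
  -- The function is constant on cylinders of radius `R`, hence every preimage is open, whatever the
  -- set.
  apply IsOpen.measurableSet
  rw [isOpen_iff_mem_nhds]
  intro c hc
  induction c using Quotient.inductionOn with
  | h G =>
    refine Filter.mem_of_superset ((isOpen_cylinder R G).mem_nhds
      (toClass_mem_cylinder.2 (BallIso.refl R G))) fun c' hc' => ?_
    induction c' using Quotient.inductionOn with
    | h H =>
      show f H.toClass ∈ s
      rw [← hf G H (toClass_mem_cylinder.1 hc')]
      exact hc

end GStar

end LocalTopology

/-! ### Borel functionals of rooted graphs and sums over an additional root. -/

section MeasurableFunctionals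

variable {k l : ℕ}

/-- The sum of `f` over the choices of an additional root at distance at most `n` of the first
root. -/
def GStar.sumBall [NeZero k] (n : ℕ) (f : GStar (k + 1) → ℝ≥0∞) (c : GStar k) : ℝ≥0∞ :=
  Quotient.liftOn c (fun G => ∑ x ∈ (G.finite_setOf_dist_le (G.root 0) n).toFinset,
    f (G.withRoots (Matrix.vecCons x G.root)).toClass) (by
    rintro G H ⟨φ, hφ⟩
    refine Finset.sum_equiv φ.toEquiv (fun x => ?_) (fun x _ => ?_)
    · simp only [Finite.mem_toFinset, Set.mem_ofPred_eq]
      rw [← hφ 0, show φ.toEquiv x = φ x from rfl, Iso.dist_eq φ _ _ G.connected H.connected]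
    · congr 1
      refine GStar.toClass_eq_iff.2 ⟨φ, fun i => ?_⟩
      refine Fin.cases ?_ (fun i => ?_) i
      · rfl
      · exact hφ i)

lemma GStar.sumBall_toClass [NeZero k] (n : ℕ) (f : GStar (k + 1) → ℝ≥0∞) (G : RootedGraph k) :
    sumBall n f G.toClass = ∑ x ∈ (G.finite_setOf_dist_le (G.root 0) n).toFinset,
      f (G.withRoots (Matrix.vecCons x G.root)).toClass := rfl

/-- The ball of radius `n + r` determines the whole sum: its isomorphism matches the summation
vertices within distance `n`, and restricts to the balls of radius `r` around them. -/
lemma GStar.measurable_sumBall_of_ballIso [NeZero k] (n r : ℕ) (f : GStar (k + 1) → ℝ≥0∞)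
    (hf : ∀ G H : RootedGraph (k + 1), BallIso r G H → f G.toClass = f H.toClass) :
    Measurable (sumBall n f) := by
  refine measurable_of_ballIso _ (n + r) fun G H hGH => ?_
  obtain ⟨φ, hφ⟩ := hGH
  have hφs : ∀ i, φ.symm ⟨H.root i, H.root_mem_ball _ i⟩ = ⟨G.root i, G.root_mem_ball _ i⟩ :=
    fun i => by rw [← hφ i]; exact φ.symm_apply_apply _
  rw [sumBall_toClass, sumBall_toClass]
  have hG : ∀ x ∈ (G.finite_setOf_dist_le (G.root 0) n).toFinset, x ∈ G.ball (n + r) := by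
    intro x hx
    have : G.graph.dist (G.root 0) x ≤ n := by simpa using hx
    exact ⟨0, by omega⟩
  have hH : ∀ x ∈ (H.finite_setOf_dist_le (H.root 0) n).toFinset, x ∈ H.ball (n + r) := by
    intro x hx
    have : H.graph.dist (H.root 0) x ≤ n := by simpa using hx
    exact ⟨0, by omega⟩
  refine Finset.sum_bij' (fun x hx => (φ ⟨x, hG x hx⟩).1) (fun x hx => (φ.symm ⟨x, hH x hx⟩).1)
    ?_ ?_ ?_ ?_ ?_
  · intro x hx
    have h := BallIso.dist_le_of_near (n := 0) (r := n) (by omega) φ (u := G.root 0) (v := x)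
      ⟨0, by simp⟩ (by simpa using hx) (G.root_mem_ball _ 0) (hG x hx)
    rw [hφ 0] at h
    simpa using h
  · intro x hx
    have h := BallIso.dist_le_of_near (n := 0) (r := n) (by omega) φ.symm (u := H.root 0) (v := x)
      ⟨0, by simp⟩ (by simpa using hx) (H.root_mem_ball _ 0) (hH x hx)
    rw [hφs 0] at h
    simpa using h
  · intro x hx
    have h := congrArg Subtype.val (φ.symm_apply_apply ⟨x, hG x hx⟩)
    exact h
  · intro x hx
    have h := congrArg Subtype.val (φ.apply_symm_apply ⟨x, hH x hx⟩)
    exact h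
  · intro x hx
    apply hf
    refine BallIso.restrict (n := n) (r := r) le_rfl φ hφ _ _ ?_ ?_ ?_
    · refine Fin.cases ⟨0, by simpa using hx⟩ fun i => ⟨i, by simp⟩
    · refine Fin.cases (hG x hx) fun i => ?_
      exact G.root_mem_ball _ i
    · refine Fin.cases rfl fun i => ?_
      have h := congrArg Subtype.val (hφ i)
      exact h.symm

/-- Restricting to a finite ball of additional roots keeps every sum finite, which legitimates the
subtraction in the complement step of the π-system induction. -/
lemma GStar.measurable_sumBall_indicator [NeZero k] (n : ℕ) {B : Set (GStar (k + 1))}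
    (hB : MeasurableSet B) : Measurable (sumBall n (B.indicator fun _ => 1)) := by
  have hone : Measurable (sumBall (k := k) n fun _ => 1) :=
    measurable_sumBall_of_ballIso n 0 _ fun _ _ _ => rfl
  induction B, hB using MeasurableSpace.induction_on_inter (measurableSpace_eq (k + 1))
    (isPiSystem_cylinders (k + 1)) with
  | empty =>
    convert (measurable_const (a := (0 : ℝ≥0∞)) : Measurable fun _ : GStar k => (0 : ℝ≥0∞)) with c
    induction c using Quotient.inductionOn with
    | h G => simp [show (⟦G⟧ : GStar k) = G.toClass from rfl, sumBall_toClass]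
  | basic U hU =>
    obtain ⟨r, H, rfl⟩ := hU
    refine measurable_sumBall_of_ballIso n r _ fun G K hGK => ?_
    have : G.toClass ∈ cylinder r H ↔ K.toClass ∈ cylinder r H := by
      rw [toClass_mem_cylinder, toClass_mem_cylinder]
      exact ⟨fun h => h.trans hGK, fun h => h.trans hGK.symm⟩
    by_cases h : G.toClass ∈ cylinder r H
    · simp [h, this.1 h]
    · simp [h, mt this.2 h]
  | compl U hU ih =>
    have : sumBall (k := k) n (Uᶜ.indicator fun _ => 1) =
        fun c => sumBall n (fun _ => 1) c - sumBall n (U.indicator fun _ => 1) c := ?_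
    · rw [this]; exact hone.sub ih
    funext c
    induction c using Quotient.inductionOn with
    | h G =>
      simp only [show (⟦G⟧ : GStar k) = G.toClass from rfl, sumBall_toClass]
      refine ENNReal.eq_sub_of_add_eq (ENNReal.sum_ne_top.2 fun x _ => ?_) ?_
      · refine ne_top_of_le_ne_top ENNReal.one_ne_top (Set.indicator_le_self _ _ _)
      · rw [← Finset.sum_add_distrib]
        refine Finset.sum_congr rfl fun x _ => ?_
        exact congrFun (Set.indicator_compl_add_self U (fun _ => (1 : ℝ≥0∞))) _
  | iUnion U hdisj hU ih =>
    have : sumBall (k := k) n ((⋃ i, U i).indicator fun _ => 1) =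
        fun c => ∑' i, sumBall n ((U i).indicator fun _ => 1) c := ?_
    · rw [this]; exact Measurable.tsum ih
    funext c
    induction c using Quotient.inductionOn with
    | h G =>
      simp only [show (⟦G⟧ : GStar k) = G.toClass from rfl, sumBall_toClass]
      rw [Summable.tsum_finsetSum fun _ _ => ENNReal.summable]
      refine Finset.sum_congr rfl fun x _ => ?_
      generalize (G.withRoots (Matrix.vecCons x G.root)).toClass = d
      by_cases hd : d ∈ ⋃ i, U i
      · obtain ⟨i, hi⟩ := Set.mem_iUnion.1 hd
        rw [tsum_eq_single i, Set.indicator_of_mem hd, Set.indicator_of_mem hi]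
        intro j hj
        exact Set.indicator_of_notMem (fun h => Set.disjoint_left.1 (hdisj hj) h hi) _
      · rw [Set.indicator_of_notMem hd]
        refine (ENNReal.tsum_eq_zero.2 fun i => ?_).symm
        exact Set.indicator_of_notMem (fun h => hd (Set.mem_iUnion.2 ⟨i, h⟩)) _

lemma GStar.measurable_sumBall [NeZero k] (n : ℕ) {f : GStar (k + 1) → ℝ≥0∞}
    (hf : Measurable f) : Measurable (sumBall n f) := by
  refine Measurable.ennreal_induction (motive := fun f => Measurable (sumBall (k := k) n f))
    ?_ ?_ ?_ hf
  · intro c s hs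
    convert! (measurable_sumBall_indicator n hs).const_mul c with d
    induction d using Quotient.inductionOn with
    | h G =>
      simp only [show (⟦G⟧ : GStar k) = G.toClass from rfl, sumBall_toClass, Finset.mul_sum]
      refine Finset.sum_congr rfl fun x _ => ?_
      by_cases hx : (G.withRoots (Matrix.vecCons x G.root)).toClass ∈ s <;> simp [hx]
  · intro f g _ hf hg ihf ihg
    refine (congrArg Measurable ?_).mp (ihf.add ihg)
    funext d
    induction d using Quotient.inductionOn with
    | h G =>
      simp only [show (⟦G⟧ : GStar k) = G.toClass from rfl, sumBall_toClass, Pi.add_apply]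
      exact Finset.sum_add_distrib.symm
  · intro f hf hmono ih
    convert! Measurable.iSup ih with d
    induction d using Quotient.inductionOn with
    | h G =>
      simp only [show (⟦G⟧ : GStar k) = G.toClass from rfl, sumBall_toClass]
      exact ENNReal.finsetSum_iSup_of_monotone fun x i j hij => hmono hij _

/-- A function of rooted graphs which comes from a Borel function on `GStar k`. -/
def MeasFn (F : RootedGraph k → ℝ≥0∞) : Prop :=
  ∃ f : GStar k → ℝ≥0∞, Measurable f ∧ ∀ G, f G.toClass = F G

namespace MeasFn

lemma const (c : ℝ≥0∞) : MeasFn fun _ : RootedGraph k => c :=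
  ⟨fun _ => c, measurable_const, fun _ => rfl⟩

lemma comp {F : RootedGraph k → ℝ≥0∞} (hF : MeasFn F) {g : ℝ≥0∞ → ℝ≥0∞} (hg : Measurable g) :
    MeasFn fun G => g (F G) := by
  obtain ⟨f, hf, h⟩ := hF
  exact ⟨g ∘ f, hg.comp hf, fun G => congrArg g (h G)⟩

lemma comp₂ {F F' : RootedGraph k → ℝ≥0∞} (hF : MeasFn F) (hF' : MeasFn F')
    {g : ℝ≥0∞ × ℝ≥0∞ → ℝ≥0∞} (hg : Measurable g) : MeasFn fun G => g (F G, F' G) := by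
  obtain ⟨f, hf, h⟩ := hF
  obtain ⟨f', hf', h'⟩ := hF'
  exact ⟨fun c => g (f c, f' c), hg.comp (hf.prodMk hf'), fun G => by simp [h, h']⟩

lemma add {F F' : RootedGraph k → ℝ≥0∞} (hF : MeasFn F) (hF' : MeasFn F') :
    MeasFn fun G => F G + F' G :=
  hF.comp₂ hF' (g := fun p => p.1 + p.2) (by fun_prop)

lemma mul {F F' : RootedGraph k → ℝ≥0∞} (hF : MeasFn F) (hF' : MeasFn F') :
    MeasFn fun G => F G * F' G :=
  hF.comp₂ hF' (g := fun p => p.1 * p.2) (by fun_prop)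

lemma iSup {ι : Type*} [Countable ι] {F : ι → RootedGraph k → ℝ≥0∞} (hF : ∀ i, MeasFn (F i)) :
    MeasFn fun G => ⨆ i, F i G := by
  choose f hf h using hF
  exact ⟨fun c => ⨆ i, f i c, Measurable.iSup hf, fun G => by simp [h]⟩

lemma liminf {F : ℕ → RootedGraph k → ℝ≥0∞} (hF : ∀ i, MeasFn (F i)) :
    MeasFn fun G => Filter.liminf (fun i => F i G) Filter.atTop := by
  choose f hf h using hF
  exact ⟨fun c => Filter.liminf (fun i => f i c) Filter.atTop, Measurable.liminf hf,
    fun G => by simp [h]⟩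

open Classical in
lemma ite_eq_zero {F A B : RootedGraph k → ℝ≥0∞} (hF : MeasFn F) (hA : MeasFn A) (hB : MeasFn B) :
    MeasFn fun G => if F G = 0 then A G else B G := by
  obtain ⟨f, hf, h⟩ := hF
  obtain ⟨a, ha, h1⟩ := hA
  obtain ⟨b, hb, h2⟩ := hB
  exact ⟨fun c => if f c = 0 then a c else b c,
    Measurable.ite (hf (measurableSet_singleton 0)) ha hb, fun G => by simp [h, h1, h2]⟩

/-- Selecting or permuting roots is continuous: whether the image lies in a cylinder of radius `r`
is decided by the original ball of the same radius. -/
lemma reroot {F : RootedGraph l → ℝ≥0∞} (hF : MeasFn F) (σ : Fin l → Fin k) :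
    MeasFn fun G : RootedGraph k => F (G.withRoots (G.root ∘ σ)) := by
  obtain ⟨f, hf, h⟩ := hF
  let ρ : GStar k → GStar l := fun c => Quotient.liftOn c
    (fun G => (G.withRoots (G.root ∘ σ)).toClass) (by
      rintro G H ⟨φ, hφ⟩
      exact GStar.toClass_eq_iff.2 ⟨φ, fun i => hφ (σ i)⟩)
  have hρ : Measurable ρ := by
    change @Measurable _ _ _ (borel (GStar l)) ρ
    rw [show borel (GStar l) = _ from GStar.measurableSpace_eq l]
    refine measurable_generateFrom ?_
    rintro _ ⟨r, H, rfl⟩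
    have := GStar.measurable_of_ballIso (fun c : GStar k => ρ c ∈ GStar.cylinder r H) r
      fun G K hGK => propext (GStar.toClass_mem_cylinder.trans (Iff.trans
        ⟨fun h => h.trans (hGK.reroot σ), fun h => h.trans (hGK.reroot σ).symm⟩
        GStar.toClass_mem_cylinder.symm))
    exact measurableSet_setOfPred.2 this
  exact ⟨f ∘ ρ, hf.comp hρ, fun G => h _⟩

/-- The graph is exhausted by the finite balls around its first root, so the full sum is a countable
supremum of the Borel functions `GStar.sumBall`. -/
lemma sum [NeZero k] {F : RootedGraph (k + 1) → ℝ≥0∞} (hF : MeasFn F) :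
    MeasFn fun G : RootedGraph k => ∑' x, F (G.withRoots (Matrix.vecCons x G.root)) := by
  obtain ⟨f, hf, h⟩ := hF
  refine ⟨fun c => ⨆ n, GStar.sumBall n f c,
    Measurable.iSup fun n => GStar.measurable_sumBall n hf, fun G => ?_⟩
  simp only [GStar.sumBall_toClass, h]
  rw [ENNReal.tsum_eq_iSup_sum]
  apply le_antisymm
  · exact iSup_le fun n => le_iSup (fun s : Finset G.V =>
      ∑ x ∈ s, F (G.withRoots (Matrix.vecCons x G.root))) _
  · refine iSup_le fun s => ?_
    refine le_iSup_of_le (s.sup fun x => G.graph.dist (G.root 0) x) ?_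
    refine Finset.sum_le_sum_of_subset fun x hx => ?_
    simp only [Finite.mem_toFinset, Set.mem_ofPred_eq]
    exact Finset.le_sup (f := fun x => G.graph.dist (G.root 0) x) hx

open Classical in
-- The ball of radius zero contains exactly the roots, so it still sees which of them are equal or
-- adjacent.
lemma of_ballIso_zero (p : RootedGraph k → Prop) (hp : ∀ G H, BallIso 0 G H → (p G ↔ p H)) :
    MeasFn fun G => if p G then (1 : ℝ≥0∞) else 0 := by
  refine ⟨fun c => Quotient.liftOn c (fun G => if p G then (1 : ℝ≥0∞) else 0) ?_, ?_,
    fun G => rfl⟩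
  · intro G H h
    simp only [hp G H (Iso.ballIso 0 h)]
  · refine GStar.measurable_of_ballIso _ 0 fun G H h => ?_
    show (if p G then (1 : ℝ≥0∞) else 0) = if p H then (1 : ℝ≥0∞) else 0
    simp only [hp G H h]

open Classical in
lemma adj (i j : Fin k) :
    MeasFn fun G : RootedGraph k => if G.graph.Adj (G.root i) (G.root j) then (1 : ℝ≥0∞) else 0 := by
  refine of_ballIso_zero _ fun G H => ?_
  rintro ⟨φ, hφ⟩
  have := φ.map_adj_iff (v := ⟨G.root i, G.root_mem_ball 0 i⟩) (w := ⟨G.root j, G.root_mem_ball 0 j⟩)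
  rw [hφ, hφ] at this
  exact this.symm

open Classical in
lemma eq (i j : Fin k) :
    MeasFn fun G : RootedGraph k => if G.root i = G.root j then (1 : ℝ≥0∞) else 0 := by
  refine of_ballIso_zero _ fun G H => ?_
  rintro ⟨φ, hφ⟩
  have := φ.injective.eq_iff (a := ⟨G.root i, G.root_mem_ball 0 i⟩) (b := ⟨G.root j, G.root_mem_ball 0 j⟩)
  rw [hφ, hφ, Subtype.mk.injEq, Subtype.mk.injEq] at this
  exact this.symm

end MeasFn

end MeasurableFunctionals

/-! ### The truncated continued fractions of a graph -/

section Messages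

open Filter Topology

variable {V : Type*} {G : SimpleGraph V} {t : ℝ≥0∞}

open Classical in
/-- The sum of `F` over the neighbours of `x` other than `o`. -/
def nbrSum (G : SimpleGraph V) (x : V) (o : Option V) (F : V → ℝ≥0∞) : ℝ≥0∞ :=
  ∑' y, if G.Adj x y ∧ o ≠ some y then F y else 0

/-- The continued fraction `h(x → o) = 1 / (t + ∑ h(y → x))`, with `y` running over the neighbours
of `x` other than `o`, truncated at depth `n`. -/
def msg (G : SimpleGraph V) (t : ℝ≥0∞) : ℕ → V → Option V → ℝ≥0∞
  | 0, _, _ => 0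
  | n + 1, x, o => (t + nbrSum G x o fun y => msg G t n y (some x))⁻¹

/-- The limit of the lower truncations. -/
def msgLo (G : SimpleGraph V) (t : ℝ≥0∞) (x : V) (o : Option V) : ℝ≥0∞ := ⨆ n, msg G t (2 * n) x o

/-- The limit of the upper truncations. -/
def msgHi (G : SimpleGraph V) (t : ℝ≥0∞) (x : V) (o : Option V) : ℝ≥0∞ :=
  ⨅ n, msg G t (2 * n + 1) x o

open Classical in
lemma nbrSum_eq_sum (hG : ∀ v, (G.neighborSet v).Finite) (x : V) (o : Option V) (F : V → ℝ≥0∞) :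
    nbrSum G x o F = ∑ y ∈ (hG x).toFinset with o ≠ some y, F y := by
  rw [nbrSum, tsum_eq_sum (s := (hG x).toFinset), Finset.sum_filter]
  · refine Finset.sum_congr rfl fun y hy => ?_
    have : G.Adj x y := by simpa using hy
    simp [this]
  · intro y hy
    have : ¬ G.Adj x y := by simpa using hy
    simp [this]

lemma nbrSum_mono {x : V} {o : Option V} {F F' : V → ℝ≥0∞} (h : ∀ y, G.Adj x y → F y ≤ F' y) :
    nbrSum G x o F ≤ nbrSum G x o F' := by
  refine ENNReal.tsum_le_tsum fun y => ?_
  split_ifs with hy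
  · exact h y hy.1
  · exact le_rfl

lemma nbrSum_congr {x : V} {o : Option V} {F F' : V → ℝ≥0∞}
    (h : ∀ y, G.Adj x y → o ≠ some y → F y = F' y) :
    nbrSum G x o F = nbrSum G x o F' := by
  refine tsum_congr fun y => ?_
  split_ifs with hy
  · exact h y hy.1 hy.2
  · rfl

lemma nbrSum_none_eq_add {x y : V} (h : G.Adj x y) (F : V → ℝ≥0∞) :
    nbrSum G x none F = nbrSum G x (some y) F + F y := by
  classical
  have : F y = ∑' z, if z = y then F z else 0 := (tsum_ite_eq y F).symm
  rw [nbrSum, nbrSum, this, ← ENNReal.tsum_add]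
  refine tsum_congr fun z => ?_
  by_cases hz : z = y
  · subst hz; simp [h]
  · simp [hz, Ne.symm hz]

lemma mul_nbrSum {x : V} {o : Option V} {F : V → ℝ≥0∞} (c : ℝ≥0∞) :
    c * nbrSum G x o F = nbrSum G x o fun y => c * F y := by
  rw [nbrSum, nbrSum, ← ENNReal.tsum_mul_left]
  refine tsum_congr fun y => ?_
  split_ifs <;> simp

lemma nbrSum_ne_top (hG : ∀ v, (G.neighborSet v).Finite) {x : V} {o : Option V} {F : V → ℝ≥0∞}
    (h : ∀ y, F y ≠ ∞) : nbrSum G x o F ≠ ∞ := by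
  rw [nbrSum_eq_sum hG]
  exact ENNReal.sum_ne_top.2 fun y _ => h y

lemma tendsto_nbrSum (hG : ∀ v, (G.neighborSet v).Finite) {ι : Type*} {l : Filter ι} {x : V}
    {o : Option V} {F : ι → V → ℝ≥0∞} {F' : V → ℝ≥0∞}
    (h : ∀ y, G.Adj x y → o ≠ some y → Tendsto (fun i => F i y) l (𝓝 (F' y))) :
    Tendsto (fun i => nbrSum G x o (F i)) l (𝓝 (nbrSum G x o F')) := by
  classical
  simp only [nbrSum_eq_sum hG]
  refine tendsto_finsetSum _ fun y hy => ?_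
  simp only [Finset.mem_filter, Finite.mem_toFinset, SimpleGraph.mem_neighborSet] at hy
  exact h y hy.1 hy.2

lemma msg_le_inv (n : ℕ) (x : V) (o : Option V) : msg G t n x o ≤ t⁻¹ := by
  cases n with
  | zero => exact zero_le
  | succ n => exact ENNReal.inv_le_inv.2 le_self_add

lemma msg_succ (n : ℕ) (x : V) (o : Option V) :
    msg G t (n + 1) x o = (t + nbrSum G x o fun y => msg G t n y (some x))⁻¹ := rfl

lemma msg_ne_top (ht : t ≠ 0) (n : ℕ) (x : V) (o : Option V) : msg G t n x o ≠ ∞ :=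
  ne_top_of_le_ne_top (ENNReal.inv_ne_top.2 ht) (msg_le_inv n x o)

lemma msg_succ_pos (hG : ∀ v, (G.neighborSet v).Finite) (ht : t ≠ 0) (ht' : t ≠ ∞) (n : ℕ) (x : V)
    (o : Option V) : msg G t (n + 1) x o ≠ 0 := by
  rw [msg_succ]
  exact ENNReal.inv_ne_zero.2 (ENNReal.add_ne_top.2
    ⟨ht', nbrSum_ne_top hG fun y => msg_ne_top ht n y _⟩)

/-- One step of the recursion reverses order and two steps preserve it. All the comparisons between
even and odd truncations follow from the starting value `0`. -/
lemma msg_succ_anti {m n : ℕ} (h : ∀ x o, msg G t m x o ≤ msg G t n x o) (x : V) (o : Option V) :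
    msg G t (n + 1) x o ≤ msg G t (m + 1) x o := by
  rw [msg_succ, msg_succ, ENNReal.inv_le_inv]
  gcongr
  exact nbrSum_mono fun y _ => h y _

lemma msg_even_le_add_two (n : ℕ) : ∀ x o, msg G t (2 * n) x o ≤ msg G t (2 * n + 2) x o := by
  induction n with
  | zero => exact fun x o => zero_le
  | succ n ih => exact msg_succ_anti (msg_succ_anti ih)

lemma msg_add_two_le_odd (n : ℕ) : ∀ x o, msg G t (2 * n + 3) x o ≤ msg G t (2 * n + 1) x o :=
  msg_succ_anti (msg_even_le_add_two n)

lemma msg_even_le_succ (n : ℕ) : ∀ x o, msg G t (2 * n) x o ≤ msg G t (2 * n + 1) x o := by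
  induction n with
  | zero => exact fun x o => zero_le
  | succ n ih => exact msg_succ_anti (msg_succ_anti ih)

lemma monotone_msg_even (x : V) (o : Option V) : Monotone fun n => msg G t (2 * n) x o :=
  monotone_nat_of_le_succ fun n => msg_even_le_add_two n x o

lemma antitone_msg_odd (x : V) (o : Option V) : Antitone fun n => msg G t (2 * n + 1) x o :=
  antitone_nat_of_succ_le fun n => msg_add_two_le_odd n x o

lemma tendsto_msg_even (x : V) (o : Option V) :
    Tendsto (fun n => msg G t (2 * n) x o) atTop (𝓝 (msgLo G t x o)) :=
  tendsto_atTop_iSup (monotone_msg_even x o)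

lemma tendsto_msg_odd (x : V) (o : Option V) :
    Tendsto (fun n => msg G t (2 * n + 1) x o) atTop (𝓝 (msgHi G t x o)) :=
  tendsto_atTop_iInf (antitone_msg_odd x o)

lemma msgLo_le_msgHi (x : V) (o : Option V) : msgLo G t x o ≤ msgHi G t x o :=
  le_of_tendsto_of_tendsto' (tendsto_msg_even x o) (tendsto_msg_odd x o)
    fun n => msg_even_le_succ n x o

/-- Passing to the limit in the recursion turns an even truncation into an odd one, so the upper
limit at a vertex is a function of the lower limits at its neighbours, and conversely. Local
finiteness makes the sum continuous. -/
lemma msgHi_eq (hG : ∀ v, (G.neighborSet v).Finite) (x : V) (o : Option V) :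
    msgHi G t x o = (t + nbrSum G x o fun y => msgLo G t y (some x))⁻¹ := by
  refine tendsto_nhds_unique (tendsto_msg_odd x o) ?_
  simp only [msg_succ]
  exact (continuous_inv.tendsto _).comp
    (tendsto_const_nhds.add (tendsto_nbrSum hG fun y _ _ => tendsto_msg_even y _))

lemma msgLo_eq (hG : ∀ v, (G.neighborSet v).Finite) (x : V) (o : Option V) :
    msgLo G t x o = (t + nbrSum G x o fun y => msgHi G t y (some x))⁻¹ := by
  refine tendsto_nhds_unique ((tendsto_add_atTop_iff_nat 1).2 (tendsto_msg_even x o)) ?_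
  have : ∀ n, 2 * (n + 1) = 2 * n + 1 + 1 := fun n => by ring
  simp only [this, msg_succ _ x o]
  exact (continuous_inv.tendsto _).comp
    (tendsto_const_nhds.add (tendsto_nbrSum hG fun y _ _ => tendsto_msg_odd y _))

lemma msgHi_ne_top (ht : t ≠ 0) (x : V) (o : Option V) : msgHi G t x o ≠ ∞ :=
  ne_top_of_le_ne_top (msg_ne_top ht 1 x o) (iInf_le (fun n => msg G t (2 * n + 1) x o) 0)

lemma msgLo_ne_top (ht : t ≠ 0) (x : V) (o : Option V) : msgLo G t x o ≠ ∞ :=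
  ne_top_of_le_ne_top (msgHi_ne_top ht x o) (msgLo_le_msgHi x o)

lemma msgLo_ne_zero (hG : ∀ v, (G.neighborSet v).Finite) (ht : t ≠ 0) (ht' : t ≠ ∞) (x : V)
    (o : Option V) : msgLo G t x o ≠ 0 := by
  rw [msgLo_eq hG]
  exact ENNReal.inv_ne_zero.2 (ENNReal.add_ne_top.2
    ⟨ht', nbrSum_ne_top hG fun y => msgHi_ne_top ht y _⟩)

lemma msgHi_ne_zero (hG : ∀ v, (G.neighborSet v).Finite) (ht : t ≠ 0) (ht' : t ≠ ∞) (x : V)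
    (o : Option V) : msgHi G t x o ≠ 0 :=
  fun h => msgLo_ne_zero hG ht ht' x o (le_antisymm (h ▸ msgLo_le_msgHi x o) zero_le)

/-- Both sides equal `a b / (1 + a b)`. This symmetry lets a message product be attributed to either
end of an edge. -/
lemma mul_inv_inv_add_comm {a b : ℝ≥0∞} (ha : a ≠ 0) (ha' : a ≠ ∞) (hb : b ≠ 0) (hb' : b ≠ ∞) :
    a * (b⁻¹ + a)⁻¹ = b * (a⁻¹ + b)⁻¹ := by
  have key : ∀ {a b : ℝ≥0∞}, b ≠ 0 → b ≠ ∞ → a * (b⁻¹ + a)⁻¹ = a * b * (1 + a * b)⁻¹ := by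
    intro a b hb hb'
    have : 1 + a * b = b * (b⁻¹ + a) := by
      rw [mul_add, ENNReal.mul_inv_cancel hb hb', mul_comm b a]
    rw [this, ENNReal.mul_inv (Or.inl hb) (Or.inl hb'), mul_assoc, ← mul_assoc b,
      ENNReal.mul_inv_cancel hb hb', one_mul]
  rw [key hb hb', key ha ha', mul_comm a b]

/-- This and `msgLo_mul_msgHi` write the two products at `o` through one function of an oriented
edge, read in its two orientations, which is what mass transport compares. -/
lemma msgHi_mul_msgLo (hG : ∀ v, (G.neighborSet v).Finite) {o x : V}
    (h : G.Adj o x) :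
    msgHi G t o none * msgLo G t x (some o) = msgLo G t x (some o) *
      ((msgHi G t o (some x))⁻¹ + msgLo G t x (some o))⁻¹ := by
  rw [msgHi_eq hG o none, msgHi_eq hG o (some x), inv_inv, nbrSum_none_eq_add h, ← add_assoc,
    mul_comm]

lemma msgLo_mul_msgHi (hG : ∀ v, (G.neighborSet v).Finite) (ht : t ≠ 0) (ht' : t ≠ ∞) {o x : V}
    (h : G.Adj o x) :
    msgLo G t o none * msgHi G t x (some o) = msgLo G t o (some x) *
      ((msgHi G t x (some o))⁻¹ + msgLo G t o (some x))⁻¹ := by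
  rw [mul_inv_inv_add_comm (msgLo_ne_zero hG ht ht' _ _) (msgLo_ne_top ht _ _)
    (msgHi_ne_zero hG ht ht' _ _) (msgHi_ne_top ht _ _), msgLo_eq hG o none, msgLo_eq hG o (some x),
    inv_inv, nbrSum_none_eq_add h, ← add_assoc, mul_comm]

lemma mul_inv_add_eq_one {s : ℝ≥0∞} (ht : t ≠ 0) (h : t + s ≠ ∞) :
    t * (t + s)⁻¹ + (t + s)⁻¹ * s = 1 := by
  rw [mul_comm t, ← mul_add]
  exact ENNReal.inv_mul_cancel (by simp [ht]) h

end Messages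

/-! ### Measurability of the continued fractions. -/

section MeasurableMessages

variable {k l : ℕ}

open Classical in
/-- A property of rooted graphs which defines a Borel set. -/
def MeasPred (p : RootedGraph k → Prop) : Prop := MeasFn fun G => if p G then (1 : ℝ≥0∞) else 0

namespace MeasPred

open Classical in
lemma ite {p : RootedGraph k → Prop} (hp : MeasPred p) {A B : RootedGraph k → ℝ≥0∞}
    (hA : MeasFn A) (hB : MeasFn B) : MeasFn fun G => if p G then A G else B G := by
  have := MeasFn.ite_eq_zero hp hB hA
  convert this using 2 with G
  by_cases h : p G <;> simp [h]

lemma not {p : RootedGraph k → Prop} (hp : MeasPred p) : MeasPred fun G => ¬ p G := by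
  have := hp.ite (MeasFn.const 0) (MeasFn.const 1)
  unfold MeasPred
  convert this using 2 with G
  by_cases h : p G <;> simp [h]

lemma and {p q : RootedGraph k → Prop} (hp : MeasPred p) (hq : MeasPred q) :
    MeasPred fun G => p G ∧ q G := by
  have := hp.ite hq (MeasFn.const 0)
  unfold MeasPred
  convert this using 2 with G
  by_cases h : p G <;> by_cases h' : q G <;> simp [h, h']

lemma adj (i j : Fin k) : MeasPred fun G : RootedGraph k => G.graph.Adj (G.root i) (G.root j) :=
  MeasFn.adj i j

lemma eq (i j : Fin k) : MeasPred fun G : RootedGraph k => G.root i = G.root j :=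
  MeasFn.eq i j

lemma eq_zero {F : RootedGraph k → ℝ≥0∞} (hF : MeasFn F) : MeasPred fun G => F G = 0 := by
  unfold MeasPred
  convert MeasFn.ite_eq_zero hF (MeasFn.const 1) (MeasFn.const 0) using 2 with G
  by_cases h : F G = 0 <;> simp [h]

lemma congr {p q : RootedGraph k → Prop} (hp : MeasPred p) (h : ∀ G, p G ↔ q G) : MeasPred q := by
  obtain rfl : p = q := funext fun G => propext (h G)
  exact hp

end MeasPred

lemma ite_eq_ite_of_iff {α : Type*} {p q : Prop} {_ : Decidable p} {_ : Decidable q} {a b : α}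
    (h : p ↔ q) : (if p then a else b) = if q then a else b := if_congr h rfl rfl

lemma MeasFn.congr {F F' : RootedGraph k → ℝ≥0∞} (hF : MeasFn F) (h : ∀ G, F G = F' G) :
    MeasFn F' := by
  obtain rfl : F = F' := funext h
  exact hF

lemma measFn_nbrSum_some {F : RootedGraph 3 → ℝ≥0∞} (hF : MeasFn F) :
    MeasFn fun G : RootedGraph 2 => nbrSum G.graph (G.root 0) (some (G.root 1)) fun y =>
      F (G.withRoots ![y, G.root 0, G.root 1]) := by
  classical
  -- The summation vertex is prepended, so it is root `0`, and the former roots `0` and `1` are now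
  -- `1` and `2`.
  have h := (((MeasPred.adj 1 0).and (MeasPred.eq 2 0).not).ite hF (MeasFn.const 0)).sum
  refine h.congr fun G => ?_
  refine tsum_congr fun y => ?_
  have h1 : (Matrix.vecCons y G.root : Fin 3 → G.V) = ![y, G.root 0, G.root 1] := by
    funext i; fin_cases i <;> rfl
  rw [h1]
  refine ite_eq_ite_of_iff ?_
  simp [RootedGraph.withRoots]

lemma measFn_nbrSum_none {F : RootedGraph 2 → ℝ≥0∞} (hF : MeasFn F) :
    MeasFn fun G : RootedGraph 1 => nbrSum G.graph (G.root 0) none fun y =>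
      F (G.withRoots ![y, G.root 0]) := by
  classical
  have h := ((MeasPred.adj 1 0).ite hF (MeasFn.const 0)).sum
  refine h.congr fun G => ?_
  refine tsum_congr fun y => ?_
  have h1 : (Matrix.vecCons y G.root : Fin 2 → G.V) = ![y, G.root 0] := by
    funext i; fin_cases i <;> rfl
  rw [h1]
  refine ite_eq_ite_of_iff ?_
  simp [RootedGraph.withRoots]

lemma measFn_msg_some (t : ℝ≥0∞) (n : ℕ) :
    MeasFn fun G : RootedGraph 2 => msg G.graph t n (G.root 0) (some (G.root 1)) := by
  induction n with
  | zero => exact MeasFn.const 0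
  | succ n ih =>
    exact (measFn_nbrSum_some (ih.reroot ![0, 1])).comp (g := fun s => (t + s)⁻¹) (by fun_prop)

lemma measFn_msg_none (t : ℝ≥0∞) (n : ℕ) :
    MeasFn fun G : RootedGraph 1 => msg G.graph t n (G.root 0) none := by
  cases n with
  | zero => exact MeasFn.const 0
  | succ n =>
    exact (measFn_nbrSum_none (measFn_msg_some t n)).comp (g := fun s => (t + s)⁻¹) (by fun_prop)

lemma measFn_msgLo_some (t : ℝ≥0∞) :
    MeasFn fun G : RootedGraph 2 => msgLo G.graph t (G.root 0) (some (G.root 1)) :=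
  MeasFn.iSup fun n => measFn_msg_some t (2 * n)

lemma measFn_msgLo_none (t : ℝ≥0∞) :
    MeasFn fun G : RootedGraph 1 => msgLo G.graph t (G.root 0) none :=
  MeasFn.iSup fun n => measFn_msg_none t (2 * n)

/-- The limit equation expresses the upper limit through lower limits, so measurability of suprema
is enough. -/
lemma measFn_msgHi_some (t : ℝ≥0∞) :
    MeasFn fun G : RootedGraph 2 => msgHi G.graph t (G.root 0) (some (G.root 1)) :=
  ((measFn_nbrSum_some ((measFn_msgLo_some t).reroot ![0, 1])).comp
    (g := fun s => (t + s)⁻¹) (by fun_prop)).congr fun G => (msgHi_eq G.locFin _ _).symm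

lemma measFn_msgHi_none (t : ℝ≥0∞) :
    MeasFn fun G : RootedGraph 1 => msgHi G.graph t (G.root 0) none :=
  ((measFn_nbrSum_none (measFn_msgLo_some t)).comp
    (g := fun s => (t + s)⁻¹) (by fun_prop)).congr fun G => (msgHi_eq G.locFin _ _).symm

end MeasurableMessages

/-! ### Mass transport -/

section MassTransport

variable {Ω : Type*} [MeasurableSpace Ω] {P : Measure Ω} {T : Ω → RootedGraph 1}

lemma RootedGraph.withRoots_o (G : RootedGraph 1) : G.withRoots ![G.o] = G := by
  obtain ⟨V, graph, con, fin, root⟩ := G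
  simp only [withRoots, RootedGraph.mk.injEq, heq_eq_eq, true_and]
  funext i
  fin_cases i
  rfl

lemma MeasFn.measurable {k : ℕ} {F : RootedGraph k → ℝ≥0∞} (hF : MeasFn F) {T : Ω → RootedGraph k}
    (hT : Measurable fun ω => (T ω).toClass) : Measurable fun ω => F (T ω) := by
  obtain ⟨f, hf, h⟩ := hF
  simp only [← h]
  exact hf.comp hT

lemma IsUnimodular.massTransport (hUni : IsUnimodular P T) {F : RootedGraph 2 → ℝ≥0∞}
    (hF : MeasFn F) :
    ∫⁻ ω, ∑' x, F ((T ω).withRoots ![(T ω).o, x]) ∂P =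
      ∫⁻ ω, ∑' x, F ((T ω).withRoots ![x, (T ω).o]) ∂P := by
  obtain ⟨f, hf, h⟩ := hF
  simpa only [h] using hUni f hf

/-- A property which holds almost surely at the root holds almost surely at all vertices. -/
lemma IsUnimodular.ae_forall (hUni : IsUnimodular P T) (hT : Measurable fun ω => (T ω).toClass)
    {F : RootedGraph 1 → ℝ≥0∞} (hF : MeasFn F) (h : ∀ᵐ ω ∂P, F (T ω) = 0) :
    ∀ᵐ ω ∂P, ∀ x, F ((T ω).withRoots ![x]) = 0 := by
  have hF2 : MeasFn fun G : RootedGraph 2 => F (G.withRoots ![G.root 1]) := by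
    refine (hF.reroot (k := 2) ![1]).congr fun G => ?_
    congr 2
    funext i
    fin_cases i
    rfl
  -- The transported mass is `F` at the receiver. One side sums `F` over all vertices, while the
  -- other repeats the value at the root, which is zero, once for each vertex.
  have h1 := hUni.massTransport hF2
  have h2 : ∫⁻ ω, ∑' x : (T ω).V, F ((T ω).withRoots ![(T ω).o]) ∂P = 0 := by
    refine (lintegral_congr_ae (g := fun _ => 0) ?_).trans (by simp)
    filter_upwards [h] with ω hω
    rw [withRoots_o, hω]
    simp
  have h3 : ∫⁻ ω, ∑' x : (T ω).V, F ((T ω).withRoots ![x]) ∂P = 0 := h1.trans h2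
  have hmeas : MeasFn fun G : RootedGraph 1 => ∑' x : G.V, F (G.withRoots ![x]) := by
    have := (hF.reroot (k := 2) ![0]).sum
    refine this.congr fun G => tsum_congr fun x => ?_
    show F (G.withRoots _) = _
    congr 2
    funext i
    fin_cases i
    rfl
  rw [lintegral_eq_zero_iff (hmeas.measurable hT)] at h3
  filter_upwards [h3] with ω hω x
  exact ENNReal.tsum_eq_zero.1 hω x

variable [IsProbabilityMeasure P]

/-- The lower and upper continued fractions agree at the root of a unimodular random graph. -/
lemma IsUnimodular.msgLo_root_eq_msgHi (hUni : IsUnimodular P T)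
    (hT : Measurable fun ω => (T ω).toClass) {t : ℝ≥0∞} (ht : t ≠ 0) (ht' : t ≠ ∞) :
    ∀ᵐ ω ∂P, msgLo (T ω).graph t (T ω).o none = msgHi (T ω).graph t (T ω).o none := by
  classical
  -- Summed over the second root, this gives `msgHi * ∑ msgLo` at the root. Summed over the first
  -- root, it gives `msgLo * ∑ msgHi`.
  let F : RootedGraph 2 → ℝ≥0∞ := fun G => if G.graph.Adj (G.root 0) (G.root 1) then
    msgLo G.graph t (G.root 1) (some (G.root 0)) *
      ((msgHi G.graph t (G.root 0) (some (G.root 1)))⁻¹ +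
        msgLo G.graph t (G.root 1) (some (G.root 0)))⁻¹ else 0
  have hF : MeasFn F := by
    refine (MeasPred.adj 0 1).ite (((measFn_msgLo_some t).reroot (k := 2) ![1, 0]).comp₂
      (measFn_msgHi_some t) (g := fun p => p.1 * (p.2⁻¹ + p.1)⁻¹) (by fun_prop)) (MeasFn.const 0)
  have h1 := hUni.massTransport hF
  have hl : ∀ G : RootedGraph 1, ∑' x, F (G.withRoots ![G.o, x]) =
      msgHi G.graph t G.o none * nbrSum G.graph G.o none fun x => msgLo G.graph t x (some G.o) := by
    intro G
    rw [mul_nbrSum]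
    refine tsum_congr fun x => ?_
    by_cases hx : G.graph.Adj G.o x
    · simp only [F, RootedGraph.withRoots, Matrix.cons_val_zero, Matrix.cons_val_one, hx, if_true,
        msgHi_mul_msgLo G.locFin hx]
      simp
    · simp [F, RootedGraph.withRoots, hx]
  have hr : ∀ G : RootedGraph 1, ∑' x, F (G.withRoots ![x, G.o]) =
      msgLo G.graph t G.o none * nbrSum G.graph G.o none fun x => msgHi G.graph t x (some G.o) := by
    intro G
    rw [mul_nbrSum]
    refine tsum_congr fun x => ?_
    by_cases hx : G.graph.Adj G.o x
    · simp only [F, RootedGraph.withRoots, Matrix.cons_val_zero, Matrix.cons_val_one, hx, if_true,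
        hx.symm, msgLo_mul_msgHi G.locFin ht ht' hx]
      simp
    · simp [F, RootedGraph.withRoots, hx, mt SimpleGraph.Adj.symm hx]
  simp only [hl, hr] at h1
  have ml := (measFn_msgLo_none t).measurable hT
  have mh := (measFn_msgHi_none t).measurable hT
  have e1 : ∀ G : RootedGraph 1, t * msgHi G.graph t G.o none + msgHi G.graph t G.o none *
      nbrSum G.graph G.o none (fun x => msgLo G.graph t x (some G.o)) = 1 := by
    intro G
    rw [msgHi_eq G.locFin]
    exact mul_inv_add_eq_one ht (ENNReal.add_ne_top.2
      ⟨ht', nbrSum_ne_top G.locFin fun y => msgLo_ne_top ht y _⟩)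
  have e2 : ∀ G : RootedGraph 1, t * msgLo G.graph t G.o none + msgLo G.graph t G.o none *
      nbrSum G.graph G.o none (fun x => msgHi G.graph t x (some G.o)) = 1 := by
    intro G
    rw [msgLo_eq G.locFin]
    exact mul_inv_add_eq_one ht (ENNReal.add_ne_top.2
      ⟨ht', nbrSum_ne_top G.locFin fun y => msgHi_ne_top ht y _⟩)
  have i1 := lintegral_add_left (μ := P) (mh.const_mul t) fun ω => msgHi (T ω).graph t (T ω).o none *
      nbrSum (T ω).graph (T ω).o none (fun x => msgLo (T ω).graph t x (some (T ω).o))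
  have i2 := lintegral_add_left (μ := P) (ml.const_mul t) fun ω => msgLo (T ω).graph t (T ω).o none *
      nbrSum (T ω).graph (T ω).o none (fun x => msgHi (T ω).graph t x (some (T ω).o))
  simp only [RootedGraph.o] at e1 e2 h1
  simp only [RootedGraph.o, e1, e2, lintegral_one, measure_univ] at i1 i2
  rw [lintegral_const_mul _ mh] at i1
  rw [lintegral_const_mul _ ml, ← h1] at i2
  -- The common transported mass is at most one, so it can be cancelled between the two
  -- normalisations, leaving equal expectations of the lower and upper limits.
  have hfin : ∫⁻ ω, msgHi (T ω).graph t ((T ω).root 0) none *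
      nbrSum (T ω).graph ((T ω).root 0) none
        (fun x => msgLo (T ω).graph t x (some ((T ω).root 0))) ∂P ≠ ∞ :=
    ne_top_of_le_ne_top ENNReal.one_ne_top (i1 ▸ le_add_self)
  have i3 := (ENNReal.add_left_inj hfin).1 (i1.symm.trans i2)
  have i4 := (ENNReal.mul_right_inj ht ht').1 i3
  -- The two limits are ordered pointwise and have equal finite integrals, the lower one being
  -- bounded by `t⁻¹`.
  refine ae_eq_of_ae_le_of_lintegral_le (ae_of_all _ fun ω => msgLo_le_msgHi _ _) ?_ mh.aemeasurable
    i4.le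
  refine ne_top_of_le_ne_top (b := ∫⁻ _, t⁻¹ ∂P) (by simp [ht]) (lintegral_mono fun ω => ?_)
  exact iSup_le fun n => msg_le_inv _ _ _

lemma IsUnimodular.msgLo_eq_msgHi (hUni : IsUnimodular P T)
    (hT : Measurable fun ω => (T ω).toClass) {t : ℝ≥0∞} (ht : t ≠ 0) (ht' : t ≠ ∞) :
    ∀ᵐ ω ∂P, ∀ x, msgLo (T ω).graph t x none = msgHi (T ω).graph t x none := by
  have hF : MeasFn fun G : RootedGraph 1 =>
      msgHi G.graph t (G.root 0) none - msgLo G.graph t (G.root 0) none :=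
    (measFn_msgHi_none t).comp₂ (measFn_msgLo_none t) (g := fun p => p.1 - p.2) (by fun_prop)
  filter_upwards [hUni.ae_forall hT hF (by
    filter_upwards [hUni.msgLo_root_eq_msgHi hT ht ht'] with ω hω
    exact tsub_eq_zero_of_le hω.ge)] with ω hω x
  exact le_antisymm (msgLo_le_msgHi _ _) (tsub_eq_zero_iff_le.1 (hω x))

end MassTransport

/-! ### The adjacency operator -/

section Operator

open Filter Topology ComplexConjugate

variable {V : Type*} {G : SimpleGraph V} {hG : ∀ v, (G.neighborSet v).Finite}

lemma basisVec_apply [DecidableEq V] (o x : V) :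
    (basisVec o : ell2 V) x = if x = o then (1 : ℂ) else 0 := by
  classical
  have : (basisVec o : ell2 V) = lp.single 2 o (1 : ℂ) := by
    unfold basisVec; congr!
  rw [this, lp.coeFn_single, Pi.single_apply]

lemma inner_basisVec_left (o : V) (ψ : ell2 V) : inner ℂ (basisVec o) ψ = ψ o := by
  classical
  have h := lp.inner_single_left (𝕜 := ℂ) (G := fun _ : V => ℂ) o (1 : ℂ) ψ
  have : (basisVec o : ell2 V) = lp.single 2 o (1 : ℂ) := by
    unfold basisVec; congr
  rw [this, h]
  simp

lemma inner_basisVec_right (o : V) (ψ : ell2 V) : inner ℂ ψ (basisVec o) = conj (ψ o) := by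
  rw [← inner_conj_symm, inner_basisVec_left]

lemma basisVec_mem_finSupp (o : V) : basisVec o ∈ finSupp V := by
  classical
  refine (Set.finite_singleton o).subset fun x hx => ?_
  by_contra h
  exact hx (by rw [basisVec_apply]; exact if_neg h)

lemma ell2_eq_zero_of_inner_basisVec {ψ : ell2 V} (h : ∀ v, ψ v = 0) : ψ = 0 := by
  ext v
  simpa using h v

lemma norm_apply_le (ψ : ell2 V) (v : V) : ‖ψ v‖ ≤ ‖ψ‖ :=
  lp.norm_apply_le_norm (by norm_num) ψ v

lemma tendsto_apply {ι : Type*} {l : Filter ι} {ψ : ι → ell2 V} {φ : ell2 V}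
    (h : Tendsto ψ l (𝓝 φ)) (v : V) : Tendsto (fun i => ψ i v) l (𝓝 (φ v)) := by
  have h1 : Tendsto (fun i => inner ℂ (basisVec v) (ψ i)) l (𝓝 (inner ℂ (basisVec v) φ)) :=
    tendsto_const_nhds.inner h
  simpa only [inner_basisVec_left] using h1

lemma continuous_apply_ell2 (v : V) : Continuous fun ψ : ell2 V => ψ v := by
  have : Continuous fun ψ : ell2 V => inner ℂ (basisVec v) ψ := by fun_prop
  simpa only [inner_basisVec_left] using this

/-- A finitely supported vector is a combination of basis vectors. -/
lemma finSupp_eq_sum {ψ : ell2 V} (hψ : ψ ∈ finSupp V) :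
    ψ = ∑ v ∈ Set.Finite.toFinset (show (Function.support (ψ : V → ℂ)).Finite from hψ),
      ψ v • basisVec v := by
  classical
  ext x
  simp only [lp.coeFn_sum, Finset.sum_apply, lp.coeFn_smul, Pi.smul_apply, basisVec_apply,
    smul_eq_mul, mul_ite, mul_one, mul_zero, Finset.sum_ite_eq]
  by_cases hx : ψ x = 0
  · simp [hx]
  · simp [hx]

lemma dense_finSupp : Dense (finSupp V : Set (ell2 V)) := by
  rw [Submodule.dense_iff_topologicalClosure_eq_top, Submodule.topologicalClosure_eq_top_iff]
  refine (Submodule.eq_bot_iff _).2 fun ψ hψ => ell2_eq_zero_of_inner_basisVec fun v => ?_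
  rw [← inner_basisVec_left]
  exact (Submodule.mem_orthogonal _ _).1 hψ _ (basisVec_mem_finSupp v)

/-- `χ` is the image of `ψ` under the adjacency operator, pointwise. -/
def AdjRel (hG : ∀ v, (G.neighborSet v).Finite) (ψ χ : ell2 V) : Prop :=
  ∀ x, χ x = ∑ y ∈ (hG x).toFinset, ψ y

lemma adjRel_adjOp (ψ : (adjOp G hG).domain) : AdjRel hG ψ (adjOp G hG ψ) := fun _ => rfl

lemma adjRel_iff_of_finSupp {ψ χ : ell2 V} (hψ : ψ ∈ finSupp V) :
    AdjRel hG ψ χ ↔ adjOp G hG ⟨ψ, hψ⟩ = χ := by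
  constructor
  · intro h
    ext x
    exact (h x).symm
  · rintro rfl
    exact adjRel_adjOp ⟨ψ, hψ⟩

lemma AdjRel.smul {ψ χ : ell2 V} (c : ℂ) (h : AdjRel hG ψ χ) :
    AdjRel hG (c • ψ) (c • χ) := fun x => by
  simp [h x, Finset.mul_sum]

lemma AdjRel.sub {ψ χ ψ' χ' : ell2 V} (h : AdjRel hG ψ χ) (h' : AdjRel hG ψ' χ') :
    AdjRel hG (ψ - ψ') (χ - χ') := fun x =>
  (congrArg₂ (· - ·) (h x) (h' x)).trans (Finset.sum_sub_distrib _ _).symm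

lemma adjOp_basisVec_apply [DecidableRel G.Adj] (v x : V) :
    (adjOp G hG ⟨basisVec v, basisVec_mem_finSupp v⟩) x = if G.Adj x v then (1 : ℂ) else 0 := by
  classical
  rw [adjRel_adjOp]
  simp [basisVec_apply]

lemma adjOp_basisVec (v : V) :
    adjOp G hG ⟨basisVec v, basisVec_mem_finSupp v⟩ = ∑ u ∈ (hG v).toFinset, basisVec u := by
  classical
  ext x
  rw [adjOp_basisVec_apply, lp.coeFn_sum, Finset.sum_apply]
  simp [basisVec_apply, G.adj_comm]

/-- Pointwise images are formal adjoints to the adjacency operator. -/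
lemma AdjRel.inner_adjOp {ψ χ : ell2 V} (h : AdjRel hG ψ χ) (η : (adjOp G hG).domain) :
    inner ℂ χ (η : ell2 V) = inner ℂ ψ (adjOp G hG η) := by
  have hbas : ∀ v, inner ℂ χ (basisVec v) =
      inner ℂ ψ (adjOp G hG ⟨basisVec v, basisVec_mem_finSupp v⟩) := by
    intro v
    rw [adjOp_basisVec, inner_sum, inner_basisVec_right, h v, map_sum]
    exact Finset.sum_congr rfl fun u _ => (inner_basisVec_right u ψ).symm
  have hsum := finSupp_eq_sum η.2
  set s := Set.Finite.toFinset (show (Function.support ((η : ell2 V) : V → ℂ)).Finite from η.2)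
  have h2 : η = ∑ v ∈ s, (η : ell2 V) v •
      (⟨basisVec v, basisVec_mem_finSupp v⟩ : (adjOp G hG).domain) := by
    apply Subtype.ext
    simpa using hsum
  conv_lhs => rw [hsum]
  conv_rhs => rw [h2]
  rw [← LinearPMap.toFun_eq_coe, map_sum, inner_sum, inner_sum]
  refine Finset.sum_congr rfl fun v _ => ?_
  rw [map_smul, inner_smul_right, inner_smul_right, hbas v]
  rfl

lemma adjOp_isFormalAdjoint : (adjOp G hG).IsFormalAdjoint (adjOp G hG) := fun ψ η =>
  (adjRel_adjOp ψ).inner_adjOp η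

lemma dense_adjOp_domain : Dense ((adjOp G hG).domain : Set (ell2 V)) := dense_finSupp

lemma adjOp_isClosable : (adjOp G hG).IsClosable :=
  (LinearPMap.adjoint_isClosed dense_adjOp_domain).isClosable.leIsClosable
    (LinearPMap.IsFormalAdjoint.le_adjoint dense_adjOp_domain adjOp_isFormalAdjoint)

/-- `χ` is the image of `ψ` under the closure of the adjacency operator. -/
def ClosRel (hG : ∀ v, (G.neighborSet v).Finite) (ψ χ : ell2 V) : Prop :=
  (ψ, χ) ∈ (adjOp G hG).closure.graph

lemma closRel_iff {ψ χ : ell2 V} :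
    ClosRel hG ψ χ ↔ (ψ, χ) ∈ closure ((adjOp G hG).graph : Set (ell2 V × ell2 V)) := by
  rw [ClosRel, ← adjOp_isClosable.graph_closure_eq_closure_graph]
  rfl

lemma closRel_adjOp (ψ : (adjOp G hG).domain) : ClosRel hG ψ (adjOp G hG ψ) :=
  closRel_iff.2 (subset_closure (LinearPMap.mem_graph _ ψ))

lemma closRel_closure (ψ : (adjOp G hG).closure.domain) :
    ClosRel hG ψ ((adjOp G hG).closure ψ) := LinearPMap.mem_graph _ ψ

lemma ClosRel.exists {ψ χ : ell2 V} (h : ClosRel hG ψ χ) :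
    ∃ hψ : ψ ∈ (adjOp G hG).closure.domain, (adjOp G hG).closure ⟨ψ, hψ⟩ = χ := by
  obtain ⟨y, h1, h2⟩ := (LinearPMap.mem_graph_iff _).1 h
  simp only at h1 h2
  subst h1
  exact ⟨y.2, h2⟩

lemma ClosRel.induction {ψ χ : ell2 V} (h : ClosRel hG ψ χ) {p : ell2 V × ell2 V → Prop}
    (hp : IsClosed {q | p q}) (h0 : ∀ η : (adjOp G hG).domain, p (η, adjOp G hG η)) :
    p (ψ, χ) := by
  have : closure ((adjOp G hG).graph : Set (ell2 V × ell2 V)) ⊆ {q | p q} := by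
    refine hp.closure_subset_iff.2 ?_
    rintro ⟨a, b⟩ hab
    obtain ⟨y, rfl, rfl⟩ := (LinearPMap.mem_graph_iff _).1 hab
    exact h0 y
  exact this (closRel_iff.1 h)

lemma ClosRel.exists_approx {ψ χ : ell2 V} (h : ClosRel hG ψ χ) {ε : ℝ} (hε : 0 < ε) :
    ∃ η : (adjOp G hG).domain, ‖ψ - η‖ < ε ∧ ‖χ - adjOp G hG η‖ < ε := by
  obtain ⟨⟨a, b⟩, hab, hd⟩ := Metric.mem_closure_iff.1 (closRel_iff.1 h) ε hε
  obtain ⟨y, rfl, rfl⟩ := (LinearPMap.mem_graph_iff _).1 hab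
  rw [Prod.dist_eq, max_lt_iff, dist_eq_norm, dist_eq_norm] at hd
  exact ⟨y, hd⟩

lemma ClosRel.adjRel {ψ χ : ell2 V} (h : ClosRel hG ψ χ) : AdjRel hG ψ χ := by
  refine h.induction (p := fun q => AdjRel hG q.1 q.2) ?_ fun η => adjRel_adjOp η
  simp only [AdjRel, Set.ofPred_forall]
  refine isClosed_iInter fun x => isClosed_eq ?_ ?_
  · exact (continuous_apply_ell2 x).comp continuous_snd
  · exact continuous_finsetSum _ fun y _ => (continuous_apply_ell2 y).comp continuous_fst

/-- Pairing a pointwise image with the adjacency operator is symmetric on finitely supported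
vectors, and this relation is closed in the graph topology. -/
lemma AdjRel.inner_closRel {ψ χ ψ' χ' : ell2 V} (h : AdjRel hG ψ χ) (h' : ClosRel hG ψ' χ') :
    inner ℂ χ ψ' = inner ℂ ψ χ' := by
  refine h'.induction (p := fun q => inner ℂ χ q.1 = inner ℂ ψ q.2) ?_ fun η => h.inner_adjOp η
  exact isClosed_eq (by fun_prop) (by fun_prop)

lemma dense_closure_domain : Dense ((adjOp G hG).closure.domain : Set (ell2 V)) :=
  dense_adjOp_domain.mono (adjOp G hG).le_closure.1

/-- Every square-summable pair related pointwise belongs to the graph of the adjoint, which is the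
closure itself under essential self-adjointness. From here on, resolvent equations can be checked
vertex by vertex. -/
lemma AdjRel.closRel (hess : EssSelfAdj G hG) {ψ χ : ell2 V} (h : AdjRel hG ψ χ) :
    ClosRel hG ψ χ := by
  have h1 : ∀ x : (adjOp G hG).closure.domain,
      inner ℂ χ (x : ell2 V) = inner ℂ ψ ((adjOp G hG).closure x) :=
    fun x => h.inner_closRel (closRel_closure x)
  have h2 : ψ ∈ (adjOp G hG).closure.adjoint.domain :=
    LinearPMap.mem_adjoint_domain_of_exists _ ⟨χ, h1⟩
  have h3 := LinearPMap.adjoint_apply_eq dense_closure_domain ⟨ψ, h2⟩ h1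
  have h4 : (ψ, χ) ∈ (adjOp G hG).closure.adjoint.graph := by
    rw [← h3]
    exact LinearPMap.mem_graph _ ⟨ψ, h2⟩
  rwa [LinearPMap.isSelfAdjoint_def.1 hess] at h4

lemma AdjRel.inner_adjRel (hess : EssSelfAdj G hG) {ψ χ ψ' χ' : ell2 V} (h : AdjRel hG ψ χ)
    (h' : AdjRel hG ψ' χ') : inner ℂ χ ψ' = inner ℂ ψ χ' :=
  h.inner_closRel (h'.closRel hess)

/-- The basic resolvent estimate. -/
lemma abs_im_mul_norm_le {E : Type*} [NormedAddCommGroup E] [InnerProductSpace ℂ E] {u v : E}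
    (h : inner ℂ v u = inner ℂ u v) (z : ℂ) : |z.im| * ‖u‖ ≤ ‖v - z • u‖ := by
  have h1 : (inner ℂ u v : ℂ).im = 0 := by
    rw [← inner_conj_symm] at h
    exact Complex.conj_eq_iff_im.1 h
  have h2 : (inner ℂ u (v - z • u) : ℂ).im = - (z.im * ‖u‖ ^ 2) := by
    rw [inner_sub_right, inner_smul_right, Complex.sub_im, h1, inner_self_eq_norm_sq_to_K]
    simp [← Complex.ofReal_pow]
  have h3 : |z.im| * ‖u‖ ^ 2 ≤ ‖u‖ * ‖v - z • u‖ := by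
    calc |z.im| * ‖u‖ ^ 2 = |(inner ℂ u (v - z • u) : ℂ).im| := by
          rw [h2, abs_neg, abs_mul, abs_of_nonneg (sq_nonneg ‖u‖)]
      _ ≤ ‖(inner ℂ u (v - z • u) : ℂ)‖ := Complex.abs_im_le_norm _
      _ ≤ _ := norm_inner_le_norm _ _
  rcases (norm_nonneg u).eq_or_lt with h0 | h0
  · rw [← h0]; simp
  · nlinarith

lemma ClosRel.norm_le {ψ χ : ell2 V} (h : ClosRel hG ψ χ) (z : ℂ) :
    |z.im| * ‖ψ‖ ≤ ‖χ - z • ψ‖ := abs_im_mul_norm_le (h.adjRel.inner_closRel h) z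

/-- If the deficiency space at `conj z` is trivial, then `A - z` is onto. -/
lemma exists_closRel_of_deficiency {z : ℂ} (hz : z.im ≠ 0)
    (hdef : ∀ φ : ell2 V, AdjRel hG φ (conj z • φ) → φ = 0) (f : ell2 V) :
    ∃ ψ, ClosRel hG ψ (f + z • ψ) := by
  let R : Submodule ℂ (ell2 V) := Submodule.map
    (LinearMap.snd ℂ (ell2 V) (ell2 V) - z • LinearMap.fst ℂ (ell2 V) (ell2 V))
    (adjOp G hG).closure.graph
  have hR : ∀ f, f ∈ R ↔ ∃ ψ, ClosRel hG ψ (f + z • ψ) := by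
    intro f
    constructor
    · rintro ⟨⟨ψ, χ⟩, h1, rfl⟩
      refine ⟨ψ, ?_⟩
      change ClosRel hG ψ (χ - z • ψ + z • ψ)
      rw [sub_add_cancel]
      exact h1
    · rintro ⟨ψ, h⟩
      exact ⟨(ψ, f + z • ψ), h, by simp⟩
  -- The estimate `ClosRel.norm_le` makes the preimages of a convergent sequence Cauchy, and the
  -- graph of the closure is closed.
  have hclosed : IsClosed (R : Set (ell2 V)) := by
    apply isClosed_of_closure_subset
    intro f hf
    obtain ⟨u, hu, hlim⟩ := mem_closure_iff_seq_limit.1 hf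
    choose ψ hψ using fun n => (hR (u n)).1 (hu n)
    have hc : CauchySeq ψ := by
      rw [Metric.cauchySeq_iff]
      intro ε hε
      have hz' : 0 < |z.im| := abs_pos.2 hz
      obtain ⟨N, hN⟩ := Metric.cauchySeq_iff.1 hlim.cauchySeq (|z.im| * ε) (by positivity)
      refine ⟨N, fun m hm n hn => ?_⟩
      have h1 : ClosRel hG (ψ m - ψ n) ((u m + z • ψ m) - (u n + z • ψ n)) :=
        Submodule.sub_mem _ (hψ m) (hψ n)
      have h2 := h1.norm_le z
      have h3 : (u m + z • ψ m) - (u n + z • ψ n) - z • (ψ m - ψ n) = u m - u n := by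
        rw [smul_sub]; abel
      rw [h3] at h2
      have h4 := hN m hm n hn
      rw [dist_eq_norm] at h4 ⊢
      exact lt_of_mul_lt_mul_left (h2.trans_lt h4) hz'.le
    obtain ⟨ψ', hψ'⟩ := cauchySeq_tendsto_of_complete hc
    refine (hR f).2 ⟨ψ', ?_⟩
    have hcl : IsClosed ((adjOp G hG).closure.graph : Set (ell2 V × ell2 V)) :=
      adjOp_isClosable.closure_isClosed
    exact hcl.mem_of_tendsto (hψ'.prodMk_nhds (hlim.add (hψ'.const_smul z)))
      (Eventually.of_forall hψ)
  -- Orthogonality to `(A - z) e_v` for all `v` is exactly the pointwise eigenvalue equation at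
  -- `conj z`.
  have horth : Rᗮ = ⊥ := by
    refine (Submodule.eq_bot_iff _).2 fun φ hφ => hdef φ fun v => ?_
    have h1 : adjOp G hG ⟨basisVec v, basisVec_mem_finSupp v⟩ - z • basisVec v ∈ R :=
      (hR _).2 ⟨basisVec v, by
        rw [sub_add_cancel]
        exact closRel_adjOp ⟨basisVec v, basisVec_mem_finSupp v⟩⟩
    have h2 := (Submodule.mem_orthogonal' _ _).1 hφ _ h1
    rw [adjOp_basisVec, inner_sub_right, inner_sum, inner_smul_right, inner_basisVec_right] at h2
    simp only [inner_basisVec_right, ← map_sum] at h2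
    have h3 := congrArg conj (sub_eq_zero.1 h2)
    simp only [map_mul, Complex.conj_conj] at h3
    simpa using h3.symm
  have htop : R = ⊤ := by
    rw [← hclosed.submodule_topologicalClosure_eq]
    exact (Submodule.topologicalClosure_eq_top_iff).2 horth
  exact (hR f).1 (htop ▸ Submodule.mem_top)

/-- The adjacency operator is essentially self-adjoint as soon as its deficiency spaces at a pair of
conjugate points are trivial. -/
lemma essSelfAdj_of_deficiency {z : ℂ} (hz : z.im ≠ 0)
    (h1 : ∀ φ : ell2 V, AdjRel hG φ (z • φ) → φ = 0)
    (h2 : ∀ φ : ell2 V, AdjRel hG φ (conj z • φ) → φ = 0) : EssSelfAdj G hG := by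
  rw [EssSelfAdj, LinearPMap.isSelfAdjoint_def]
  have hle : (adjOp G hG).closure ≤ (adjOp G hG).closure.adjoint :=
    LinearPMap.IsFormalAdjoint.le_adjoint dense_closure_domain fun x y =>
      (closRel_closure x).adjRel.inner_closRel (closRel_closure y)
  refine (le_antisymm hle (LinearPMap.le_of_le_graph ?_)).symm
  rintro ⟨ψ, χ⟩ hψ
  have hadj : AdjRel hG ψ χ := by
    obtain ⟨y, rfl, rfl⟩ := (LinearPMap.mem_graph_iff _).1 hψ
    intro x
    have h3 := LinearPMap.adjoint_isFormalAdjoint (T := (adjOp G hG).closure)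
      dense_closure_domain y
      ⟨basisVec x, (adjOp G hG).le_closure.1 (basisVec_mem_finSupp x)⟩
    have h4 : (adjOp G hG).closure
        ⟨basisVec x, (adjOp G hG).le_closure.1 (basisVec_mem_finSupp x)⟩ =
        adjOp G hG ⟨basisVec x, basisVec_mem_finSupp x⟩ :=
      ((adjOp G hG).le_closure.2 rfl).symm
    rw [h4, adjOp_basisVec, inner_basisVec_right, inner_sum] at h3
    simp only [inner_basisVec_right, ← map_sum] at h3
    exact (starRingEnd ℂ).injective h3
  -- Triviality at `conj z` solves the equation inside the closure. Triviality at `z` then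
  -- identifies this solution with the given vector of the adjoint's domain.
  obtain ⟨ψ', h⟩ := exists_closRel_of_deficiency hz h2 (χ - z • ψ)
  have h5 := h.adjRel.sub hadj
  have h6 : χ - z • ψ + z • ψ' - χ = z • (ψ' - ψ) := by rw [smul_sub]; abel
  rw [h6] at h5
  have h7 : ψ' = ψ := sub_eq_zero.1 (h1 _ h5)
  rw [h7, sub_add_cancel] at h
  exact h

lemma EssSelfAdj.deficiency (hess : EssSelfAdj G hG) {z : ℂ} (hz : z.im ≠ 0) {φ : ell2 V}
    (h : AdjRel hG φ (z • φ)) : φ = 0 := by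
  have h1 := (h.closRel hess).norm_le z
  rw [sub_self, norm_zero] at h1
  have h2 : 0 < |z.im| := abs_pos.2 hz
  exact norm_eq_zero.1 (le_antisymm (by nlinarith [norm_nonneg φ]) (norm_nonneg φ))

lemma EssSelfAdj.exists_resolvent (hess : EssSelfAdj G hG) {z : ℂ} (hz : z.im ≠ 0) (f : ell2 V) :
    ∃ ψ, ClosRel hG ψ (f + z • ψ) :=
  exists_closRel_of_deficiency hz (fun _ h => hess.deficiency (by simpa using hz) h) f

lemma EssSelfAdj.resolvent_unique (hess : EssSelfAdj G hG) {z : ℂ} (hz : z.im ≠ 0)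
    {f ψ ψ' : ell2 V} (h : AdjRel hG ψ (f + z • ψ)) (h' : AdjRel hG ψ' (f + z • ψ')) : ψ = ψ' := by
  refine sub_eq_zero.1 (hess.deficiency hz ?_)
  have := h.sub h'
  rwa [add_sub_add_left_eq_sub, ← smul_sub] at this

end Operator

/-! ### Existence of spectral measures -/

section SpectralExistence

open Filter Topology ComplexConjugate

/-- The measure puts mass `|⟨b_j, e⟩|²` on the eigenvalue of `b_j`. Its second moment is recorded
because it gives tightness when the finite truncations grow. -/
lemma exists_spectralMeasure_of_finiteDimensional {E : Type*} [NormedAddCommGroup E]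
    [InnerProductSpace ℂ E] [FiniteDimensional ℂ E] {B : E →ₗ[ℂ] E} (hB : B.IsSymmetric) {e : E}
    (he : ‖e‖ = 1) :
    ∃ μ : ProbabilityMeasure ℝ,
      ∫⁻ x, ENNReal.ofReal (x ^ 2) ∂(μ : Measure ℝ) = ENNReal.ofReal (‖B e‖ ^ 2) ∧
      ∀ z : ℂ, z.im ≠ 0 → ∃ ψ, B ψ - z • ψ = e ∧
        inner ℂ e ψ = ∫ x : ℝ, 1 / ((x : ℂ) - z) ∂(μ : Measure ℝ) := by
  let b := hB.eigenvectorBasis rfl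
  let l := hB.eigenvalues rfl
  have hb : ∀ j, B (b j) = (l j : ℂ) • b j := fun j => hB.apply_eigenvectorBasis rfl j
  let w : Fin (Module.finrank ℂ E) → ℝ := fun j => ‖inner ℂ (b j) e‖ ^ 2
  have hw : ∑ j, w j = 1 := by
    rw [b.sum_sq_norm_inner_right e, he, one_pow]
  let m : Measure ℝ := ∑ j, ENNReal.ofReal (w j) • Measure.dirac (l j)
  have hm : IsProbabilityMeasure m := by
    refine ⟨?_⟩
    simp only [m, Measure.coe_finsetSum, Finset.sum_apply, Measure.smul_apply, smul_eq_mul,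
      measure_univ, mul_one]
    rw [← ENNReal.ofReal_sum_of_nonneg fun j _ => sq_nonneg _, hw, ENNReal.ofReal_one]
  refine ⟨⟨m, hm⟩, ?_, ?_⟩
  · change ∫⁻ x, ENNReal.ofReal (x ^ 2) ∂m = _
    simp only [m]
    rw [lintegral_finsetSum_measure]
    simp only [lintegral_smul_measure, lintegral_dirac, smul_eq_mul]
    rw [← b.sum_sq_norm_inner_right (B e), ENNReal.ofReal_sum_of_nonneg fun j _ => sq_nonneg _]
    refine Finset.sum_congr rfl fun j _ => ?_
    rw [← hB (b j) e, hb j, inner_smul_left, norm_mul, ← ENNReal.ofReal_mul (sq_nonneg _)]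
    congr 1
    simp [mul_pow, mul_comm]
  · intro z hz
    have hne : ∀ j, (l j : ℂ) - z ≠ 0 := by
      intro j h
      apply hz
      have := congrArg Complex.im h
      simpa using this
    refine ⟨∑ j, (inner ℂ (b j) e / ((l j : ℂ) - z)) • b j, ?_, ?_⟩
    · rw [map_sum, Finset.smul_sum, ← Finset.sum_sub_distrib]
      conv_rhs => rw [← b.sum_repr' e]
      refine Finset.sum_congr rfl fun j _ => ?_
      rw [map_smul, hb j, smul_smul, smul_smul, ← sub_smul]
      congr 1
      have := hne j
      field_simp
    · change _ = ∫ x : ℝ, 1 / ((x : ℂ) - z) ∂m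
      simp only [m]
      rw [integral_finsetSum_measure]
      · rw [inner_sum]
        refine Finset.sum_congr rfl fun j _ => ?_
        rw [integral_smul_measure, integral_dirac, inner_smul_right,
          ENNReal.toReal_ofReal (sq_nonneg _), Complex.real_smul]
        rw [← inner_conj_symm e (b j), div_mul_eq_mul_div, RCLike.mul_conj, mul_one_div]
        simp
      · intro j _
        exact (integrable_dirac (by simp)).smul_measure ENNReal.ofReal_ne_top

variable {V : Type*} {G : SimpleGraph V} {hG : ∀ v, (G.neighborSet v).Finite}

lemma sum_norm_sq_le (ψ : ell2 V) (F : Finset V) : ∑ x ∈ F, ‖ψ x‖ ^ 2 ≤ ‖ψ‖ ^ 2 := by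
  have := lp.sum_rpow_le_norm_rpow (p := 2) (by norm_num) ψ F
  simpa using this

/-- Finite truncations of the adjacency operator: the measures approximating the spectral measure,
with the corresponding resolvents. -/
lemma exists_truncated_spectralMeasure (hG : ∀ v, (G.neighborSet v).Finite) (F : Finset V) {o : V}
    (ho : o ∈ F) :
    ∃ μ : ProbabilityMeasure ℝ,
      ∫⁻ x, ENNReal.ofReal (x ^ 2) ∂(μ : Measure ℝ) ≤ ((hG o).toFinset.card : ℝ≥0∞) ∧
      ∀ z : ℂ, z.im ≠ 0 → ∀ η : (adjOp G hG).domain,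
        (∀ x ∈ Function.support ((η : ell2 V) : V → ℂ), x ∈ F) →
        |z.im| * ‖(∫ x : ℝ, 1 / ((x : ℂ) - z) ∂(μ : Measure ℝ)) - (η : ell2 V) o‖ ≤
          ‖basisVec o - (adjOp G hG η - z • (η : ell2 V))‖ := by
  classical
  let M : Matrix F F ℂ := fun x y => if G.Adj x y then 1 else 0
  have hM : M.IsHermitian := by
    ext x y
    rw [Matrix.conjTranspose_apply]
    by_cases h : G.Adj x y
    · simp [M, h, h.symm]
    · simp [M, h, mt SimpleGraph.Adj.symm h]
  have hB := Matrix.isSymmetric_toEuclideanLin_iff.2 hM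
  let e : EuclideanSpace ℂ F := EuclideanSpace.single ⟨o, ho⟩ 1
  have hBapp : ∀ (u : EuclideanSpace ℂ F) (x : F),
      (M.toEuclideanLin u) x = ∑ y : F, if G.Adj x y then u y else 0 := by
    intro u x
    change (M.mulVec u) x = _
    simp [Matrix.mulVec, dotProduct, M]
  obtain ⟨μ, h1, h2⟩ := exists_spectralMeasure_of_finiteDimensional hB (e := e) (by simp [e])
  refine ⟨μ, h1.trans_le ?_, fun z hz η hη => ?_⟩
  · have h3 : ‖M.toEuclideanLin e‖ ^ 2 = ∑ x : F, if G.Adj x o then (1 : ℝ) else 0 := by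
      rw [EuclideanSpace.norm_sq_eq]
      refine Finset.sum_congr rfl fun x _ => ?_
      rw [hBapp]
      have : ∀ y : F, (if G.Adj x y then e y else 0) =
          if y = ⟨o, ho⟩ then (if G.Adj x o then (1 : ℂ) else 0) else 0 := by
        intro y
        by_cases hy : y = ⟨o, ho⟩
        · subst hy; simp [e]
        · simp [e, hy]
      simp only [this, Finset.sum_ite_eq', Finset.mem_univ, if_true]
      split_ifs <;> simp
    rw [h3, Finset.sum_boole, ENNReal.ofReal_natCast]
    have : (Finset.univ.filter fun x : F => G.Adj x o).card ≤ (hG o).toFinset.card := by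
      refine Finset.card_le_card_of_injOn Subtype.val (fun x hx => ?_)
        (Subtype.val_injective.injOn)
      have : G.Adj x o := by simpa using hx
      simpa using this.symm
    exact_mod_cast this
  · obtain ⟨ψ, h3, h4⟩ := h2 z hz
    let u : EuclideanSpace ℂ F := WithLp.toLp 2 fun x => (η : ell2 V) x
    have hu : ∀ x : F, u x = (η : ell2 V) x := fun x => rfl
    -- Since `η` is supported in `F`, the truncated operator applied to it agrees on `F` with the
    -- full operator. The error of `u` in the finite problem is thus the restriction of the error of
    -- `η` in the full one.
    have hres : ∀ x : F, (M.toEuclideanLin (ψ - u) - z • (ψ - u)) x =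
        (basisVec o - (adjOp G hG η - z • (η : ell2 V)) : ell2 V) x := by
      intro x
      have h5 : M.toEuclideanLin (ψ - u) - z • (ψ - u) =
          e - (M.toEuclideanLin u - z • u) := by
        rw [← h3, map_sub, smul_sub]; abel
      rw [h5]
      have h6 : e x = (basisVec o : ell2 V) x := by
        rw [basisVec_apply]
        by_cases hx : x = ⟨o, ho⟩
        · subst hx; simp [e]
        · have : (x : V) ≠ o := fun h => hx (Subtype.ext h)
          simp [e, hx, this]
      have h7 : M.toEuclideanLin u x = (adjOp G hG η) x := by
        rw [hBapp, adjRel_adjOp]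
        rw [Finset.sum_coe_sort F fun y => if G.Adj x y then (η : ell2 V) y else 0,
          ← Finset.sum_filter]
        refine Finset.sum_subset_zero_on_sdiff (fun y hy => ?_) (fun y hy => ?_) fun _ _ => rfl
        · simpa using (Finset.mem_filter.1 hy).2
        · rw [Finset.mem_sdiff, Finset.mem_filter, not_and'] at hy
          by_contra hne
          exact hy.2 (by simpa using hy.1) (hη y hne)
      change e x - (M.toEuclideanLin u x - z * u x) = (basisVec o : ell2 V) x -
        ((adjOp G hG η) x - z * (η : ell2 V) x)
      rw [h6, h7, hu]
    have h8 : ‖M.toEuclideanLin (ψ - u) - z • (ψ - u)‖ ≤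
        ‖basisVec o - (adjOp G hG η - z • (η : ell2 V))‖ := by
      rw [← abs_of_nonneg (norm_nonneg (M.toEuclideanLin (ψ - u) - z • (ψ - u))),
        ← abs_of_nonneg (norm_nonneg (basisVec o - (adjOp G hG η - z • (η : ell2 V)))),
        ← sq_le_sq, EuclideanSpace.norm_sq_eq]
      refine le_trans (le_of_eq ?_) (sum_norm_sq_le _ F)
      rw [← Finset.sum_coe_sort F]
      exact Finset.sum_congr rfl fun x _ => by rw [hres x]
    have h9 := abs_im_mul_norm_le (hB (ψ - u) (ψ - u)) z
    have h10 : ‖(ψ - u) ⟨o, ho⟩‖ ≤ ‖ψ - u‖ := PiLp.norm_apply_le _ _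
    have h11 : (∫ x : ℝ, 1 / ((x : ℂ) - z) ∂(μ : Measure ℝ)) = ψ ⟨o, ho⟩ := by
      rw [← h4]
      simp [e, EuclideanSpace.inner_single_left]
    rw [h11]
    calc |z.im| * ‖ψ ⟨o, ho⟩ - (η : ell2 V) o‖ = |z.im| * ‖(ψ - u) ⟨o, ho⟩‖ := rfl
      _ ≤ |z.im| * ‖ψ - u‖ := by gcongr
      _ ≤ _ := h9.trans h8

/-- This is Chebyshev's inequality with a uniform second moment. -/
lemma isTightMeasureSet_of_sq_le {S : Set (Measure ℝ)} {C : ℝ≥0∞} (hC : C ≠ ∞)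
    (hS : ∀ μ ∈ S, ∫⁻ x, ENNReal.ofReal (x ^ 2) ∂μ ≤ C) : IsTightMeasureSet S := by
  rw [isTightMeasureSet_iff_exists_isCompact_measure_compl_le]
  intro ε hε
  rcases eq_or_ne ε ∞ with rfl | hε'
  · exact ⟨∅, isCompact_empty, fun _ _ => le_top⟩
  -- The extra `1` keeps the threshold nonzero when `C` vanishes.
  let r : ℝ≥0∞ := (C + 1) / ε
  have hr : r ≠ ∞ := ENNReal.div_ne_top (by simp [hC]) hε.ne'
  have hr0 : r ≠ 0 := by simp [r, hε']
  let R : ℝ := √r.toReal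
  refine ⟨Icc (-R) R, isCompact_Icc, fun μ hμ => ?_⟩
  have hsub : (Icc (-R) R)ᶜ ⊆ {x | r ≤ ENNReal.ofReal (x ^ 2)} := by
    intro x hx
    have h1 : R < |x| := by
      by_contra h
      exact hx (abs_le.1 (not_lt.1 h))
    have h2 : r.toReal ≤ x ^ 2 := by
      rw [← Real.sq_sqrt (ENNReal.toReal_nonneg (a := r)), ← sq_abs x]
      exact pow_le_pow_left₀ (Real.sqrt_nonneg _) h1.le 2
    exact (ENNReal.le_ofReal_iff_toReal_le hr (sq_nonneg x)).2 h2
  have h3 := mul_meas_ge_le_lintegral₀ (μ := μ) (f := fun x => ENNReal.ofReal (x ^ 2))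
    (by fun_prop) r
  have h4 : r * μ (Icc (-R) R)ᶜ ≤ C :=
    (mul_le_mul_right (measure_mono hsub) r).trans (h3.trans (hS μ hμ))
  have h5 : μ (Icc (-R) R)ᶜ ≤ C / r := by
    rw [ENNReal.le_div_iff_mul_le (Or.inl hr0) (Or.inl hr), mul_comm]
    exact h4
  refine h5.trans ?_
  rw [ENNReal.div_le_iff hr0 hr]
  simp only [r]
  rw [ENNReal.mul_div_cancel hε.ne' hε']
  exact le_self_add

/-- The truncated measures have second moment at most the degree of `o`, so they have a limit along
an ultrafilter. Its Stieltjes transform is the resolvent entry, because the resolvent vector can be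
approximated in graph norm by finitely supported vectors, which large truncations see exactly. -/
lemma exists_isSpectralMeasure (hess : EssSelfAdj G hG) (o : V) :
    ∃ μ, IsSpectralMeasure G hG o μ := by
  classical
  choose μ hμ hres using fun F : Finset V =>
    exists_truncated_spectralMeasure hG (insert o F) (Finset.mem_insert_self o F)
  have hcomp : IsCompact (closure (Set.range μ)) := by
    refine isCompact_closure_of_isTightMeasureSet
      (isTightMeasureSet_of_sq_le (ENNReal.natCast_ne_top (hG o).toFinset.card) ?_)
    rintro _ ⟨_, ⟨F, rfl⟩, rfl⟩
    exact hμ F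
  let U : Ultrafilter (Finset V) := Ultrafilter.of atTop
  obtain ⟨ν, -, hν⟩ := hcomp.ultrafilter_le_nhds (U.map μ) (by
    rw [le_principal_iff]
    exact Ultrafilter.mem_map.2 (Eventually.of_forall fun F => subset_closure ⟨F, rfl⟩))
  have hν : Tendsto μ U (𝓝 ν) := hν
  rw [ProbabilityMeasure.tendsto_iff_forall_integral_rclike_tendsto ℂ] at hν
  refine ⟨ν, inferInstance, fun z hz => ?_⟩
  obtain ⟨ψ, hψ⟩ := hess.exists_resolvent hz (basisVec o)
  obtain ⟨hd, hd'⟩ := hψ.exists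
  refine ⟨⟨ψ, hd⟩, by rw [hd']; simp, ?_⟩
  have hne : ∀ x : ℝ, (x : ℂ) - z ≠ 0 := by
    intro x h
    apply hz
    have := congrArg Complex.im h
    simpa using this
  let f : BoundedContinuousFunction ℝ ℂ := BoundedContinuousFunction.ofNormedAddCommGroup
    (fun x => 1 / ((x : ℂ) - z)) (by
      refine Continuous.div continuous_const (by fun_prop) hne) (1 / |z.im|) (by
      intro x
      rw [norm_div, norm_one]
      refine one_div_le_one_div_of_le (abs_pos.2 hz) ?_
      have := Complex.abs_im_le_norm ((x : ℂ) - z)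
      simpa using this)
  have h1 : Tendsto (fun F => ∫ x : ℝ, 1 / ((x : ℂ) - z) ∂(μ F : Measure ℝ)) U
      (𝓝 (∫ x : ℝ, 1 / ((x : ℂ) - z) ∂(ν : Measure ℝ))) := hν f
  have h2 : Tendsto (fun F => ∫ x : ℝ, 1 / ((x : ℂ) - z) ∂(μ F : Measure ℝ)) U (𝓝 (ψ o)) := by
    have hz' : 0 < |z.im| := abs_pos.2 hz
    refine Metric.tendsto_nhds.2 fun ε hε => ?_
    -- The first term accounts for the resolvent error of the approximant `η`, and the final `1` for
    -- the error of its value at `o`.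
    let c : ℝ := (1 + ‖z‖) / |z.im| + 1
    have hc : 0 < c := by positivity
    obtain ⟨η, h3, h4⟩ := hψ.exists_approx (div_pos hε hc)
    set δ := ε / c with hδ
    have hsupp : (Function.support ((η : ell2 V) : V → ℂ)).Finite := η.2
    have hev : ∀ᶠ F : Finset V in U, hsupp.toFinset ≤ F :=
      (Ultrafilter.of_le (f := atTop)) (eventually_ge_atTop hsupp.toFinset)
    filter_upwards [hev] with F hF
    have h5 := hres F z hz η fun x hx =>
      Finset.mem_insert_of_mem (hF ((Set.Finite.mem_toFinset hsupp).2 hx))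
    have h6 : ‖basisVec o - (adjOp G hG η - z • (η : ell2 V))‖ < (1 + ‖z‖) * δ := by
      have : basisVec o - (adjOp G hG η - z • (η : ell2 V)) =
          (basisVec o + z • ψ - adjOp G hG η) - z • (ψ - η) := by rw [smul_sub]; abel
      rw [this, add_mul, one_mul]
      refine (norm_sub_le _ _).trans_lt (add_lt_add_of_lt_of_le h4 ?_)
      rw [norm_smul]
      gcongr
    have h7 : ‖(∫ x : ℝ, 1 / ((x : ℂ) - z) ∂(μ F : Measure ℝ)) - (η : ell2 V) o‖ ≤
        (1 + ‖z‖) / |z.im| * δ := by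
      rw [div_mul_eq_mul_div, le_div_iff₀ hz', mul_comm]
      exact h5.trans h6.le
    have h8 : ‖(η : ell2 V) o - ψ o‖ < δ := by
      rw [norm_sub_rev]
      exact (norm_apply_le (ψ - (η : ell2 V)) o).trans_lt h3
    rw [dist_eq_norm]
    calc _ ≤ _ := norm_sub_le_norm_sub_add_norm_sub _ ((η : ell2 V) o) _
      _ < (1 + ‖z‖) / |z.im| * δ + δ := add_lt_add_of_le_of_lt h7 h8
      _ = ε := by rw [hδ]; field_simp; simp only [c]; field_simp
  rw [inner_basisVec_left]
  exact tendsto_nhds_unique h2 h1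

end SpectralExistence

/-! ### Trees -/

section Trees

variable {V : Type*} {G : SimpleGraph V}

/-- Both neighbours extend geodesics from `o` to paths ending at `v`, and a tree has only one such
path. -/
lemma IsTree.eq_of_dist_succ (hT : G.IsTree) {o u v w : V} (hu : G.Adj u v) (hw : G.Adj w v)
    (h1 : G.dist o v = G.dist o u + 1) (h2 : G.dist o v = G.dist o w + 1) : u = w := by
  obtain ⟨p, hp⟩ := hT.connected.exists_walk_length_eq_dist o u
  obtain ⟨q, hq⟩ := hT.connected.exists_walk_length_eq_dist o w
  have h3 : (p.concat hu).IsPath :=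
    SimpleGraph.Walk.isPath_of_length_eq_dist _ (by rw [SimpleGraph.Walk.length_concat, hp, h1])
  have h4 : (q.concat hw).IsPath :=
    SimpleGraph.Walk.isPath_of_length_eq_dist _ (by rw [SimpleGraph.Walk.length_concat, hq, h2])
  have h5 : (⟨_, h3⟩ : G.Path o v) = ⟨_, h4⟩ := (hT.isAcyclic.subsingleton_path o v).elim _ _
  have h6 := congrArg (fun r : G.Path o v => r.1.penultimate) h5
  simpa using h6

lemma exists_parent (hG : G.Connected) {o v : V} (h : v ≠ o) :
    ∃ u, G.Adj u v ∧ G.dist o v = G.dist o u + 1 := by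
  obtain ⟨p, hp⟩ := hG.exists_walk_length_eq_dist v o
  cases p with
  | nil => exact absurd rfl h
  | @cons _ b _ hb q =>
    refine ⟨b, hb.symm, ?_⟩
    rw [SimpleGraph.Walk.length_cons] at hp
    have h1 := SimpleGraph.dist_le q
    have h2 := hG.dist_triangle (u := v) (v := b) (w := o)
    rw [SimpleGraph.dist_eq_one_iff_adj.2 hb] at h2
    rw [SimpleGraph.dist_comm (u := o), SimpleGraph.dist_comm (u := o)]
    omega

lemma dist_le_succ_of_adj (hG : G.Connected) (o : V) {u v : V} (h : G.Adj u v) :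
    G.dist o v ≤ G.dist o u + 1 := by
  have := hG.dist_triangle (u := o) (v := u) (w := v)
  rwa [SimpleGraph.dist_eq_one_iff_adj.2 h] at this

lemma IsTree.dist_eq_succ_or (hT : G.IsTree) {x o : V} (h : G.Adj o x) (v : V) :
    G.dist o v = G.dist x v + 1 ∨ G.dist x v = G.dist o v + 1 := by
  rw [SimpleGraph.dist_comm (u := o), SimpleGraph.dist_comm (u := x)]
  exact hT.dist_eq_dist_add_one_of_adj v h

/-- Along a walk avoiding `o`, the nearer of `o` and `x` cannot change: by uniqueness of parents
such a change happens only across the edge between them. Conversely, a geodesic from `x` through `o`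
would make `o` nearer than `x`. -/
lemma IsTree.mem_branchSet_iff (hT : G.IsTree) {x o : V} (h : G.Adj o x) (v : V) :
    v ∈ branchSet G x o ↔ G.dist o v = G.dist x v + 1 := by
  have hox : G.dist o x = 1 := SimpleGraph.dist_eq_one_iff_adj.2 h
  constructor
  · rintro ⟨p, hp⟩
    have key : ∀ {a b : V} (p : G.Walk a b), G.dist o a = G.dist x a + 1 → o ∉ p.support →
        G.dist o b = G.dist x b + 1 := by
      intro a b p
      induction p with
      | nil => exact fun h _ => h
      | @cons a b c hab q ih =>
        intro ha ho
        rw [SimpleGraph.Walk.support_cons, List.mem_cons, not_or] at ho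
        refine ih ?_ ho.2
        have hbo : b ≠ o := fun hb => ho.2 (hb ▸ q.start_mem_support)
        rcases IsTree.dist_eq_succ_or hT h b with h1 | h1
        · exact h1
        · exfalso
          have h2 := dist_le_succ_of_adj hT.connected o hab.symm
          have h3 := dist_le_succ_of_adj hT.connected x hab
          have h4 : G.dist o a = G.dist o b + 1 := by omega
          by_cases hax : a = x
          · subst hax
            rw [SimpleGraph.dist_self] at ha
            exact hbo (hT.connected.dist_eq_zero_iff.1 (by omega)).symm
          · obtain ⟨u, hu, hu'⟩ := exists_parent hT.connected hax
            have h5 := hT.connected.dist_triangle (u := o) (v := x) (w := u)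
            have h6 := dist_le_succ_of_adj hT.connected o hu
            have h7 : u = b := IsTree.eq_of_dist_succ hT hu hab.symm (by omega) h4
            subst h7
            omega
    exact key p (by simp [hox]) hp
  · intro hv
    obtain ⟨p, hp⟩ := hT.connected.exists_walk_length_eq_dist x v
    refine ⟨p, fun ho => ?_⟩
    classical
    have h1 := congrArg SimpleGraph.Walk.length (p.take_spec ho)
    rw [SimpleGraph.Walk.length_append] at h1
    have h2 := SimpleGraph.dist_le (p.dropUntil o ho)
    omega

/-- Geodesics from `o` to vertices behind the edge from `x` to `y` pass through `y`. The induction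
excludes a backward step, which would give a vertex two parents. -/
lemma IsTree.dist_eq_of_mem_branchSet (hT : G.IsTree) {o x y v : V} (hxy : G.Adj x y)
    (h : G.dist o y = G.dist o x + 1) (hv : G.dist x v = G.dist y v + 1) :
    G.dist o v = G.dist o y + G.dist y v := by
  induction hn : G.dist y v using Nat.strong_induction_on generalizing v with
  | _ n ih =>
    rcases n with _ | n
    · rw [hT.connected.dist_eq_zero_iff.1 hn, add_zero]
    · have hvy : v ≠ y := by rintro rfl; simp at hn
      have hbr : ∀ {u v : V}, G.Adj u v → G.dist x v = G.dist y v + 1 →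
          G.dist y v = G.dist y u + 1 → G.dist x u = G.dist y u + 1 := by
        intro u v hu hv hu'
        rcases IsTree.dist_eq_succ_or hT hxy u with h1 | h1
        · exact h1
        · have := dist_le_succ_of_adj hT.connected x hu
          omega
      obtain ⟨u, hu, hu'⟩ := exists_parent hT.connected hvy
      have hxu := hbr hu hv hu'
      have h1 := ih n (by omega) hxu (by omega)
      rcases hT.dist_eq_dist_add_one_of_adj o hu with h2 | h2
      · exfalso
        by_cases huy : u = y
        · subst huy
          have := IsTree.eq_of_dist_succ hT hxy hu.symm h h2
          subst this
          simp at hv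
        · obtain ⟨w, hw, hw'⟩ := exists_parent hT.connected huy
          have h3 := ih (G.dist y w) (by omega) (hbr hw hxu hw') rfl
          have h4 : w = v := IsTree.eq_of_dist_succ hT hw hu.symm (by omega) h2
          subst h4
          omega
      · omega

variable {M : Type*} [CommMonoid M]

open Classical in
/-- The neighbour of `v` towards `o`. -/
def parent (G : SimpleGraph V) (o v : V) : V :=
  if h : ∃ u, G.Adj u v ∧ G.dist o v = G.dist o u + 1 then h.choose else v

lemma parent_spec (hG : G.Connected) {o v : V} (h : v ≠ o) :
    G.Adj (parent G o v) v ∧ G.dist o v = G.dist o (parent G o v) + 1 := by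
  have h1 := exists_parent hG h
  rw [parent, dif_pos h1]
  exact h1.choose_spec

lemma IsTree.parent_eq (hT : G.IsTree) {o u v : V} (hu : G.Adj u v)
    (h : G.dist o v = G.dist o u + 1) : parent G o v = u := by
  have hv : v ≠ o := by rintro rfl; simp at h
  have := parent_spec hT.connected hv
  exact IsTree.eq_of_dist_succ hT this.1 hu this.2 h

/-- Auxiliary recursion for `pathProd`. -/
def pathProdAux (G : SimpleGraph V) (w : V → V → M) (o : V) : ℕ → V → M
  | 0, _ => 1
  | n + 1, v => pathProdAux G w o n (parent G o v) * w v (parent G o v)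

/-- The product of the weights of the edges `(child, parent)` on the path from `o` to `v`. -/
def pathProd (G : SimpleGraph V) (w : V → V → M) (o v : V) : M := pathProdAux G w o (G.dist o v) v

lemma pathProd_self (w : V → V → M) (o : V) : pathProd G w o o = 1 := by
  simp [pathProd, pathProdAux]

lemma IsTree.pathProd_succ (hT : G.IsTree) (w : V → V → M) {o u v : V} (hu : G.Adj u v)
    (h : G.dist o v = G.dist o u + 1) : pathProd G w o v = pathProd G w o u * w v u := by
  rw [pathProd, h, pathProdAux, IsTree.parent_eq hT hu h, pathProd]

lemma IsTree.pathProd_adj (hT : G.IsTree) (w : V → V → M) {o v : V} (h : G.Adj o v) :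
    pathProd G w o v = w v o := by
  rw [IsTree.pathProd_succ hT w h (by simp [SimpleGraph.dist_eq_one_iff_adj.2 h]), pathProd_self,
    one_mul]

/-- Induction along the paths starting from `o`. -/
lemma dist_induction (hG : G.Connected) (o : V) {p : V → Prop} (h0 : p o)
    (h : ∀ u v, G.Adj u v → G.dist o v = G.dist o u + 1 → p u → p v) (v : V) : p v := by
  induction hn : G.dist o v generalizing v with
  | zero => rw [← hG.dist_eq_zero_iff.1 hn]; exact h0
  | succ n ih =>
    have hv : v ≠ o := by rintro rfl; simp at hn
    obtain ⟨u, hu, hu'⟩ := exists_parent hG hv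
    exact h u v hu hu' (ih u (by omega))

lemma IsTree.pathProd_mul (hT : G.IsTree) (w : V → V → M) {o y v : V}
    (h : G.dist o v = G.dist o y + G.dist y v) :
    pathProd G w o v = pathProd G w o y * pathProd G w y v := by
  refine dist_induction (p := fun v => G.dist o v = G.dist o y + G.dist y v →
    pathProd G w o v = pathProd G w o y * pathProd G w y v) hT.connected y ?_ ?_ v h
  · intro _
    rw [pathProd_self, mul_one]
  · intro u v hu hu' ih hv
    have h1 := hT.connected.dist_triangle (u := o) (v := y) (w := u)
    have h2 := dist_le_succ_of_adj hT.connected o hu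
    have h3 : G.dist o u = G.dist o y + G.dist y u := by omega
    rw [IsTree.pathProd_succ hT w hu (by omega), IsTree.pathProd_succ hT w hu hu', ih h3, mul_assoc]

lemma map_pathProd {N : Type*} [CommMonoid N] (f : M →* N) (w : V → V → M) (o v : V) :
    f (pathProd G w o v) = pathProd G (fun a b => f (w a b)) o v := by
  have : ∀ n v, f (pathProdAux G w o n v) = pathProdAux G (fun a b => f (w a b)) o n v := by
    intro n
    induction n with
    | zero => exact fun v => map_one f
    | succ n ih => intro v; rw [pathProdAux, map_mul, ih, pathProdAux]
  exact this _ _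

lemma pathProd_mul_weights (w w' : V → V → M) (o v : V) :
    pathProd G (fun a b => w a b * w' a b) o v = pathProd G w o v * pathProd G w' o v := by
  have : ∀ n v, pathProdAux G (fun a b => w a b * w' a b) o n v =
      pathProdAux G w o n v * pathProdAux G w' o n v := by
    intro n
    induction n with
    | zero => exact fun v => (one_mul 1).symm
    | succ n ih =>
      intro v
      rw [pathProdAux, ih, pathProdAux, pathProdAux]
      exact mul_mul_mul_comm _ _ _ _
  exact this _ _

lemma finite_ball_of_locallyFinite (hc : G.Connected) (hG : ∀ v, (G.neighborSet v).Finite) (o : V)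
    (n : ℕ) : {v | G.dist o v ≤ n}.Finite := by
  induction n with
  | zero =>
    refine (Set.finite_singleton o).subset fun v hv => ?_
    have : G.dist o v = 0 := by simpa using hv
    exact (hc.dist_eq_zero_iff.1 this).symm
  | succ n ih =>
    refine (ih.union (ih.biUnion fun v _ => hG v)).subset fun v hv => ?_
    by_cases h : G.dist o v ≤ n
    · exact Or.inl h
    · right
      have hv' : G.dist o v = n + 1 := le_antisymm hv (by omega)
      obtain ⟨u, hu, hu'⟩ := exists_parent hc (o := o) (v := v) (by rintro rfl; simp at hv')
      exact Set.mem_biUnion (x := u) (show G.dist o u ≤ n by omega) hu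

open Classical in
lemma sum_nbrs_eq_add (hG : ∀ v, (G.neighborSet v).Finite) {A : Type*}
    [AddCommMonoid A] {u v : V} (hu : G.Adj u v) (f : V → A) :
    ∑ y ∈ (hG v).toFinset, f y = f u + ∑ y ∈ (hG v).toFinset.erase u, f y := by
  rw [Finset.add_sum_erase]
  simpa using hu.symm

lemma IsTree.dist_of_adj_ne_parent (hT : G.IsTree) {o u v y : V} (hu : G.Adj u v)
    (h : G.dist o v = G.dist o u + 1) (hy : G.Adj v y) (hyu : y ≠ u) :
    G.dist o y = G.dist o v + 1 := by
  rcases hT.dist_eq_dist_add_one_of_adj o hy with h1 | h1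
  · exact absurd (IsTree.eq_of_dist_succ hT hy.symm hu h1 h) hyu
  · exact h1

end Trees

/-! ### Solutions of the resolvent equation on trees -/

section TreeResolvent

open Filter Topology ComplexConjugate

variable {V : Type*} {G : SimpleGraph V} {hG : ∀ v, (G.neighborSet v).Finite} {t : ℝ}

lemma ell2_add_apply (ψ φ : ell2 V) (v : V) : (ψ + φ) v = ψ v + φ v := rfl

lemma ell2_sub_apply (ψ φ : ell2 V) (v : V) : (ψ - φ) v = ψ v - φ v := rfl

lemma ell2_smul_apply (c : ℂ) (ψ : ell2 V) (v : V) : (c • ψ) v = c * ψ v := rfl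

/-- The restriction of a vector to a set of vertices. -/
def ellRestrict (S : Set V) (ψ : ell2 V) : ell2 V :=
  ⟨S.indicator ψ, (lp.memℓp ψ).mono' fun _ => norm_indicator_le_norm_self _ _⟩

lemma ellRestrict_apply_of_mem {S : Set V} {v : V} (h : v ∈ S) (ψ : ell2 V) :
    ellRestrict S ψ v = ψ v := Set.indicator_of_mem h _

lemma ellRestrict_apply_of_notMem {S : Set V} {v : V} (h : v ∉ S) (ψ : ell2 V) :
    ellRestrict S ψ v = 0 := Set.indicator_of_notMem h _

lemma ellRestrict_smul (S : Set V) (c : ℂ) (ψ : ell2 V) :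
    ellRestrict S (c • ψ) = c • ellRestrict S ψ := by
  ext v
  by_cases h : v ∈ S
  · simp [ellRestrict_apply_of_mem h]
  · simp [ellRestrict_apply_of_notMem h]

lemma ellRestrict_add (S : Set V) (ψ φ : ell2 V) :
    ellRestrict S (ψ + φ) = ellRestrict S ψ + ellRestrict S φ := by
  ext v
  by_cases h : v ∈ S
  · simp [ellRestrict_apply_of_mem h]
  · simp [ellRestrict_apply_of_notMem h]

lemma ellRestrict_add_compl (S : Set V) (ψ : ell2 V) :
    ellRestrict S ψ + ellRestrict Sᶜ ψ = ψ := by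
  ext v
  by_cases h : v ∈ S
  · simp [ellRestrict_apply_of_mem h, ellRestrict_apply_of_notMem (show v ∉ Sᶜ from fun h' => h' h)]
  · simp [ellRestrict_apply_of_mem (show v ∈ Sᶜ from h), ellRestrict_apply_of_notMem h]

lemma inner_ellRestrict_ellRestrict (S : Set V) (ψ φ : ell2 V) :
    inner ℂ (ellRestrict S ψ) (ellRestrict S φ) = inner ℂ (ellRestrict S ψ) φ := by
  rw [lp.inner_eq_tsum, lp.inner_eq_tsum]
  refine tsum_congr fun v => ?_
  by_cases h : v ∈ S
  · simp [ellRestrict_apply_of_mem h]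
  · simp [ellRestrict_apply_of_notMem h]

lemma inner_ellRestrict_add (S : Set V) (ψ φ : ell2 V) :
    inner ℂ (ellRestrict S ψ) (ellRestrict S φ) +
      inner ℂ (ellRestrict Sᶜ ψ) (ellRestrict Sᶜ φ) = inner ℂ ψ φ := by
  rw [inner_ellRestrict_ellRestrict, inner_ellRestrict_ellRestrict, ← inner_add_left,
    ellRestrict_add_compl]

lemma ellRestrict_mem_finSupp (S : Set V) {ψ : ell2 V} (h : ψ ∈ finSupp V) :
    ellRestrict S ψ ∈ finSupp V := by
  refine Set.Finite.subset (show (Function.support (ψ : V → ℂ)).Finite from h) fun v hv => ?_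
  by_cases hS : v ∈ S
  · rwa [Function.mem_support, ellRestrict_apply_of_mem hS] at hv
  · exact absurd (ellRestrict_apply_of_notMem hS ψ) hv

/-- The vertices at even distance of `o`. -/
def evenSet (G : SimpleGraph V) (o : V) : Set V := {v | Even (G.dist o v)}

lemma IsTree.evenSet_adj (hT : G.IsTree) (o : V) {u v : V} (h : G.Adj u v) :
    u ∈ evenSet G o ↔ v ∉ evenSet G o := by
  simp only [evenSet, Set.mem_ofPred_eq]
  rcases hT.dist_eq_dist_add_one_of_adj o h with h1 | h1 <;> rw [h1, Nat.even_add_one]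
  simp

lemma self_mem_evenSet (o : V) : o ∈ evenSet G o := by simp [evenSet]

/-- A tree is bipartite, so adjacency maps functions on even vertices to functions on odd vertices
and conversely. -/
lemma AdjRel.even (hT : G.IsTree) (o : V) {φ χ : ell2 V} (h : AdjRel hG φ χ) :
    AdjRel hG (ellRestrict (evenSet G o) φ) (ellRestrict (evenSet G o)ᶜ χ) := by
  intro v
  by_cases hv : v ∈ evenSet G o
  · rw [ellRestrict_apply_of_notMem (show v ∉ (evenSet G o)ᶜ from fun h' => h' hv)]
    refine (Finset.sum_eq_zero fun u hu =>
      ellRestrict_apply_of_notMem (v := u) ?_ φ).symm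
    exact (IsTree.evenSet_adj hT o (by simpa using hu)).1 hv
  · rw [ellRestrict_apply_of_mem (show v ∈ (evenSet G o)ᶜ from hv), h v]
    refine Finset.sum_congr rfl fun u hu => (ellRestrict_apply_of_mem ?_ _).symm
    exact (IsTree.evenSet_adj hT o (show G.Adj u v by
      simpa [G.adj_comm] using hu)).2 hv

lemma AdjRel.odd (hT : G.IsTree) (o : V) {φ χ : ell2 V} (h : AdjRel hG φ χ) :
    AdjRel hG (ellRestrict (evenSet G o)ᶜ φ) (ellRestrict (evenSet G o) χ) := by
  have h1 := h.sub (h.even hT o)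
  rwa [show φ - ellRestrict (evenSet G o) φ = ellRestrict (evenSet G o)ᶜ φ from
    sub_eq_of_eq_add' (ellRestrict_add_compl _ _).symm,
    show χ - ellRestrict (evenSet G o)ᶜ χ = ellRestrict (evenSet G o) χ from
    sub_eq_of_eq_add (ellRestrict_add_compl _ _).symm] at h1

lemma AdjRel.closRel_of_finSupp {ψ χ : ell2 V} (hψ : ψ ∈ finSupp V) (h : AdjRel hG ψ χ) :
    ClosRel hG ψ χ := by
  rw [← (adjRel_iff_of_finSupp hψ).1 h]
  exact closRel_adjOp ⟨ψ, hψ⟩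

/-- Symmetry moves `i t` from one slot of the inner product to the other. Conjugation changes its
sign, so the contributions of the two parities cancel. -/
lemma inner_eq_zero_of_parity {S : Set V} (ht : t ≠ 0) {φ θ : ell2 V}
    (hφ : AdjRel hG (ellRestrict Sᶜ φ) ((Complex.I * t) • ellRestrict S φ))
    (hθ : ClosRel hG (ellRestrict S θ) ((Complex.I * t) • ellRestrict Sᶜ θ)) :
    inner ℂ φ θ = 0 := by
  have h := hφ.inner_closRel hθ
  rw [inner_smul_left, inner_smul_right] at h
  rw [← inner_ellRestrict_add S]
  simp only [map_mul, Complex.conj_I, Complex.conj_ofReal] at h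
  have h2 : (Complex.I * t : ℂ) ≠ 0 := by simp [ht]
  apply mul_left_cancel₀ h2
  linear_combination -h

/-- The computation is that of `inner_eq_zero_of_parity`, except that the point source at `o`
survives and is divided by `t`. -/
lemma inner_eq_of_parity {S : Set V} {o : V} (ho : o ∈ S) (ht : t ≠ 0) {c : ℝ} {φ θ : ell2 V}
    (hφ : AdjRel hG (ellRestrict S φ) ((Complex.I * t) • ellRestrict Sᶜ φ))
    (hθ : ClosRel hG (ellRestrict Sᶜ θ)
      ((Complex.I * t) • ellRestrict S θ - (Complex.I * c) • basisVec o)) :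
    inner ℂ φ θ = (c / t : ℝ) * conj (φ o) := by
  have h := hφ.inner_closRel hθ
  rw [inner_smul_left, inner_sub_right, inner_smul_right, inner_smul_right, inner_basisVec_right,
    ellRestrict_apply_of_mem ho] at h
  rw [← inner_ellRestrict_add S]
  simp only [map_mul, Complex.conj_I, Complex.conj_ofReal] at h
  have h2 : (Complex.I * t : ℂ) ≠ 0 := by simp [ht]
  apply mul_left_cancel₀ h2
  have h3 : (t : ℂ) ≠ 0 := by simp [ht]
  push_cast
  have h4 : Complex.I * t * (c / t * conj (φ o)) = Complex.I * c * conj (φ o) := by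
    field_simp
  rw [h4]
  linear_combination -h

/-- The product of the weights `-i a` along the paths from `o`. -/
def thetaFun (G : SimpleGraph V) (a : V → V → ℝ) (o v : V) : ℂ :=
  pathProd G (fun x y => -Complex.I * (a x y : ℂ)) o v

open Classical in
-- The ratio of consecutive values is `-i` times a continued fraction, and the recursion for that
-- fraction is precisely the equation `A θ = i t θ` away from the root.
lemma sum_thetaFun (hT : G.IsTree) (hG : ∀ v, (G.neighborSet v).Finite) {a : V → V → ℝ}
    {o u v : V} (hu : G.Adj u v) (h : G.dist o v = G.dist o u + 1)
    (ha : a v u * (t + ∑ y ∈ (hG v).toFinset.erase u, a y v) = 1) :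
    ∑ y ∈ (hG v).toFinset, thetaFun G a o y = Complex.I * t * thetaFun G a o v := by
  rw [sum_nbrs_eq_add hG hu]
  have h1 : thetaFun G a o v = thetaFun G a o u * (-Complex.I * a v u) :=
    IsTree.pathProd_succ hT _ hu h
  have h2 : ∑ y ∈ (hG v).toFinset.erase u, thetaFun G a o y =
      thetaFun G a o v * (-Complex.I * (∑ y ∈ (hG v).toFinset.erase u, a y v : ℝ)) := by
    push_cast
    rw [Finset.mul_sum, Finset.mul_sum]
    refine Finset.sum_congr rfl fun y hy => ?_
    have hy1 : G.Adj v y := by simpa using (Finset.mem_erase.1 hy).2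
    have hy2 := IsTree.dist_of_adj_ne_parent hT hu h hy1 (Finset.mem_erase.1 hy).1
    exact IsTree.pathProd_succ hT _ hy1 hy2
  rw [h2]
  have h3 : (a v u : ℂ) * (t + (∑ y ∈ (hG v).toFinset.erase u, a y v : ℝ)) = 1 := by
    exact_mod_cast ha
  have h4 : thetaFun G a o u =
      thetaFun G a o v * Complex.I * (t + (∑ y ∈ (hG v).toFinset.erase u, a y v : ℝ)) := by
    rw [h1]
    linear_combination (-thetaFun G a o u) * h3 + (thetaFun G a o u * (a v u : ℂ) *
      (t + (∑ y ∈ (hG v).toFinset.erase u, a y v : ℝ))) * Complex.I_mul_I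
  linear_combination h4

lemma sum_thetaFun_root (hT : G.IsTree) (hG : ∀ v, (G.neighborSet v).Finite) {a : V → V → ℝ}
    (o : V) : ∑ y ∈ (hG o).toFinset, thetaFun G a o y =
      -Complex.I * (∑ y ∈ (hG o).toFinset, a y o : ℝ) := by
  push_cast
  rw [Finset.mul_sum]
  refine Finset.sum_congr rfl fun y hy => ?_
  exact IsTree.pathProd_adj hT _ (by simpa using hy)

open Classical in
lemma toReal_mul_eq_one {T : ℝ≥0∞} (hG : ∀ v, (G.neighborSet v).Finite) (hT : T ≠ 0)
    (hT' : T ≠ ∞) {v : V} {o : Option V} {F : V → ℝ≥0∞} (hF : ∀ y, F y ≠ ∞) :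
    ((T + nbrSum G v o F)⁻¹).toReal *
      (T.toReal + ∑ y ∈ (hG v).toFinset with o ≠ some y, (F y).toReal) = 1 := by
  rw [nbrSum_eq_sum hG, ENNReal.toReal_inv, ENNReal.toReal_add hT'
    (ENNReal.sum_ne_top.2 fun y _ => hF y), ENNReal.toReal_sum fun y _ => hF y]
  refine inv_mul_cancel₀ (ne_of_gt ?_)
  have : 0 < T.toReal := ENNReal.toReal_pos hT hT'
  positivity

open Classical in
lemma filter_ne_some (hG : ∀ v, (G.neighborSet v).Finite) (v u : V) :
    ((hG v).toFinset.filter fun y => some u ≠ some y) = (hG v).toFinset.erase u := by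
  ext y
  simp only [ne_eq, Option.some.injEq, Finset.mem_filter, Finset.mem_erase]
  tauto

open Classical in
lemma filter_ne_none (hG : ∀ v, (G.neighborSet v).Finite) (v : V) :
    ((hG v).toFinset.filter fun y => (none : Option V) ≠ some y) = (hG v).toFinset := by
  simp

/-- The real-valued truncated continued fraction. -/
def rmsg (G : SimpleGraph V) (t : ℝ) (n : ℕ) (x : V) (o : Option V) : ℝ :=
  (msg G (ENNReal.ofReal t) n x o).toReal

open Classical in
lemma rmsg_succ_some (hG : ∀ v, (G.neighborSet v).Finite) (ht : 0 < t) (n : ℕ) (v u : V) :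
    rmsg G t (n + 1) v (some u) *
      (t + ∑ y ∈ (hG v).toFinset.erase u, rmsg G t n y (some v)) = 1 := by
  have ht0 : ENNReal.ofReal t ≠ 0 := by simpa using ht
  have h := toReal_mul_eq_one (T := ENNReal.ofReal t) (v := v) (o := some u) hG ht0
    ENNReal.ofReal_ne_top fun y => msg_ne_top (G := G) (t := ENNReal.ofReal t) ht0 n y (some v)
  rwa [filter_ne_some, ENNReal.toReal_ofReal ht.le] at h

lemma rmsg_succ_none (hG : ∀ v, (G.neighborSet v).Finite) (ht : 0 < t) (n : ℕ) (v : V) :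
    rmsg G t (n + 1) v none * (t + ∑ y ∈ (hG v).toFinset, rmsg G t n y (some v)) = 1 := by
  have ht0 : ENNReal.ofReal t ≠ 0 := by simpa using ht
  have h := toReal_mul_eq_one (T := ENNReal.ofReal t) (v := v) (o := none) hG ht0
    ENNReal.ofReal_ne_top fun y => msg_ne_top (G := G) (t := ENNReal.ofReal t) ht0 n y (some v)
  rwa [filter_ne_none, ENNReal.toReal_ofReal ht.le] at h

/-- The weights of the truncation at depth `N`. -/
def truncWeight (G : SimpleGraph V) (t : ℝ) (N : ℕ) (o v u : V) : ℝ :=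
  rmsg G t (N - G.dist o v) v (some u)

/-- The last factor on the path has no depth left, and truncation at depth zero is `0`. -/
lemma thetaFun_trunc_eq_zero (hT : G.IsTree) {N : ℕ} {o v : V} (hN : N ≠ 0)
    (hv : N ≤ G.dist o v) : thetaFun G (truncWeight G t N o) o v = 0 := by
  have hvo : v ≠ o := by rintro rfl; simp at hv; exact hN hv
  obtain ⟨u, hu, hu'⟩ := exists_parent hT.connected hvo
  rw [thetaFun, IsTree.pathProd_succ hT _ hu hu', truncWeight, Nat.sub_eq_zero_of_le hv]
  simp [rmsg, msg]

/-- The truncated solution of the resolvent equation. -/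
def thetaVec (hT : G.IsTree) (hG : ∀ v, (G.neighborSet v).Finite) (t : ℝ) (N : ℕ) (hN : N ≠ 0)
    (o : V) : ell2 V :=
  ⟨thetaFun G (truncWeight G t N o) o, (memℓp_zero (E := fun _ => ℂ)
    ((finite_ball_of_locallyFinite hT.connected hG o N).subset fun v hv => by
      by_contra h
      exact hv (thetaFun_trunc_eq_zero hT hN (not_le.1 h).le))).of_exponent_ge zero_le⟩

variable {N : ℕ} {hN : N ≠ 0} {hT : G.IsTree} {o : V}

lemma thetaVec_mem_finSupp : thetaVec hT hG t N hN o ∈ finSupp V :=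
  (finite_ball_of_locallyFinite hT.connected hG o N).subset fun v hv => by
    by_contra h
    exact hv (thetaFun_trunc_eq_zero hT hN (not_le.1 h).le)

lemma thetaVec_eq_zero {v : V} (hv : N ≤ G.dist o v) : thetaVec hT hG t N hN o v = 0 :=
  thetaFun_trunc_eq_zero hT hN hv

lemma thetaVec_self : thetaVec hT hG t N hN o o = 1 := pathProd_self _ _

/-- The resolvent equation can fail only on the sphere of radius `N`, where the vector is zero but
its inner neighbours need not be. -/
lemma sum_thetaVec (ht : 0 < t) {v : V} (hv : v ≠ o) (hd : G.dist o v ≠ N) :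
    ∑ y ∈ (hG v).toFinset, thetaVec hT hG t N hN o y =
      Complex.I * t * thetaVec hT hG t N hN o v := by
  classical
  rcases lt_or_gt_of_ne hd with h | h
  · obtain ⟨u, hu, hu'⟩ := exists_parent hT.connected hv
    refine sum_thetaFun hT hG hu hu' ?_
    rw [← rmsg_succ_some hG ht (N - G.dist o v - 1) v u, truncWeight]
    congr 2
    · omega
    · refine Finset.sum_congr rfl fun y hy => ?_
      have hy1 : G.Adj v y := by simpa using (Finset.mem_erase.1 hy).2
      have hy2 := IsTree.dist_of_adj_ne_parent hT hu hu' hy1 (Finset.mem_erase.1 hy).1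
      rw [truncWeight, hy2]
      congr 1
  · rw [thetaVec_eq_zero h.le, mul_zero]
    refine Finset.sum_eq_zero fun y hy => thetaVec_eq_zero ?_
    have hy1 : G.Adj y v := by simpa [G.adj_comm] using hy
    have := dist_le_succ_of_adj hT.connected o hy1
    omega

lemma sum_thetaVec_root (ht : 0 < t) :
    ∑ y ∈ (hG o).toFinset, thetaVec hT hG t N hN o y =
      Complex.I * t - Complex.I * ((rmsg G t N o none)⁻¹ : ℝ) := by
  refine (sum_thetaFun_root hT hG o).trans ?_
  obtain ⟨n, rfl⟩ := Nat.exists_eq_succ_of_ne_zero hN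
  have h := rmsg_succ_none hG ht n o
  have h1 : (rmsg G t (n + 1) o none)⁻¹ = t + ∑ y ∈ (hG o).toFinset, rmsg G t n y (some o) :=
    inv_eq_of_mul_eq_one_right h
  have h2 : ∑ y ∈ (hG o).toFinset, truncWeight G t (n + 1) o y o =
      ∑ y ∈ (hG o).toFinset, rmsg G t n y (some o) := by
    refine Finset.sum_congr rfl fun y hy => ?_
    have hy1 : G.Adj o y := by simpa using hy
    rw [truncWeight, SimpleGraph.dist_eq_one_iff_adj.2 hy1]
    rfl
  rw [Nat.succ_eq_add_one, h1, h2]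
  push_cast
  ring

lemma adjRel_thetaVec_apply (ht : 0 < t) {χ : ell2 V}
    (h : AdjRel hG (thetaVec hT hG t N hN o) χ) {v : V} (hd : G.dist o v ≠ N) :
    χ v = ((Complex.I * t) • thetaVec hT hG t N hN o -
      (Complex.I * ((rmsg G t N o none)⁻¹ : ℝ)) • basisVec o : ell2 V) v := by
  classical
  rw [h v]
  by_cases hv : v = o
  · subst hv
    rw [sum_thetaVec_root ht]
    simp only [ell2_sub_apply, ell2_smul_apply, basisVec_apply, thetaVec_self, if_pos, mul_one]
  · rw [sum_thetaVec ht hv hd]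
    simp only [ell2_sub_apply, ell2_smul_apply, basisVec_apply, hv, if_false, mul_zero, sub_zero]

lemma exists_adjRel_thetaVec : ∃ χ, AdjRel hG (thetaVec hT hG t N hN o) χ :=
  ⟨adjOp G hG ⟨thetaVec hT hG t N hN o, thetaVec_mem_finSupp⟩,
    adjRel_adjOp ⟨thetaVec hT hG t N hN o, thetaVec_mem_finSupp⟩⟩

/-- The pairing of the vector with its image under `A` is real. The defect on the sphere does not
contribute, as the vector vanishes there, so only the diagonal term and the source at `o` remain in
the imaginary part. -/
lemma norm_sq_thetaVec (ht : 0 < t) :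
    ‖thetaVec hT hG t N hN o‖ ^ 2 = (rmsg G t N o none)⁻¹ / t := by
  obtain ⟨χ, h⟩ := exists_adjRel_thetaVec (hT := hT) (hG := hG) (t := t) (hN := hN) (o := o)
  set θ := thetaVec hT hG t N hN o
  set c := (rmsg G t N o none)⁻¹
  have h1 : inner ℂ θ χ = inner ℂ θ ((Complex.I * t) • θ - (Complex.I * c) • basisVec o) := by
    rw [lp.inner_eq_tsum, lp.inner_eq_tsum]
    refine tsum_congr fun v => ?_
    by_cases hd : G.dist o v = N
    · rw [show θ v = 0 from thetaVec_eq_zero hd.ge, inner_zero_left, inner_zero_left]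
    · rw [adjRel_thetaVec_apply ht h hd]
  have h2 : inner ℂ χ θ = inner ℂ θ χ := h.inner_closRel (h.closRel_of_finSupp thetaVec_mem_finSupp)
  have h3 : (inner ℂ θ χ : ℂ).im = 0 := by
    rw [← inner_conj_symm] at h2
    exact Complex.conj_eq_iff_im.1 h2
  rw [h1, inner_sub_right, inner_smul_right, inner_smul_right, inner_basisVec_right,
    show θ o = 1 from thetaVec_self, inner_self_eq_norm_sq_to_K] at h3
  have h4 : t * ‖θ‖ ^ 2 - c = 0 := by
    simpa [← Complex.ofReal_pow] using h3
  rw [eq_div_iff ht.ne']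
  linarith

/-- The sphere where the equation may fail consists of even vertices, so the equation is exact on
the odd ones. For odd `N` the parities are exchanged, and the source at `o` appears. -/
lemma thetaVec_even (ht : 0 < t) (he : Even N) :
    ClosRel hG (ellRestrict (evenSet G o) (thetaVec hT hG t N hN o))
      ((Complex.I * t) • ellRestrict (evenSet G o)ᶜ (thetaVec hT hG t N hN o)) := by
  classical
  obtain ⟨χ, h⟩ := exists_adjRel_thetaVec (hT := hT) (hG := hG) (t := t) (hN := hN) (o := o)
  have h1 := h.even hT o
  have h2 : ellRestrict (evenSet G o)ᶜ χ =
      (Complex.I * t) • ellRestrict (evenSet G o)ᶜ (thetaVec hT hG t N hN o) := by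
    ext v
    by_cases hv : v ∈ evenSet G o
    · simp [ellRestrict_apply_of_notMem (show v ∉ (evenSet G o)ᶜ from fun h => h hv)]
    · have hd : G.dist o v ≠ N := fun hd => hv (by simpa [evenSet, hd] using he)
      have hvo : v ≠ o := by rintro rfl; exact hv (self_mem_evenSet v)
      have hv' : v ∈ (evenSet G o)ᶜ := hv
      rw [ellRestrict_apply_of_mem hv', adjRel_thetaVec_apply ht h hd]
      simp [ell2_sub_apply, ell2_smul_apply, ellRestrict_apply_of_mem hv', basisVec_apply, hvo]
  rw [h2] at h1
  exact h1.closRel_of_finSupp (ellRestrict_mem_finSupp _ thetaVec_mem_finSupp)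

lemma thetaVec_odd (ht : 0 < t) (ho : ¬ Even N) :
    ClosRel hG (ellRestrict (evenSet G o)ᶜ (thetaVec hT hG t N hN o))
      ((Complex.I * t) • ellRestrict (evenSet G o) (thetaVec hT hG t N hN o) -
        (Complex.I * ((rmsg G t N o none)⁻¹ : ℝ)) • basisVec o) := by
  classical
  obtain ⟨χ, h⟩ := exists_adjRel_thetaVec (hT := hT) (hG := hG) (t := t) (hN := hN) (o := o)
  have h1 := h.odd hT o
  have h2 : ellRestrict (evenSet G o) χ =
      (Complex.I * t) • ellRestrict (evenSet G o) (thetaVec hT hG t N hN o) -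
        (Complex.I * ((rmsg G t N o none)⁻¹ : ℝ)) • basisVec o := by
    ext v
    by_cases hv : v ∈ evenSet G o
    · have hd : G.dist o v ≠ N := fun hd => ho (by simpa [evenSet, hd] using hv)
      rw [ellRestrict_apply_of_mem hv, adjRel_thetaVec_apply ht h hd]
      simp only [ell2_sub_apply, ell2_smul_apply, ellRestrict_apply_of_mem hv]
    · have hvo : v ≠ o := by rintro rfl; exact hv (self_mem_evenSet v)
      simp [ell2_sub_apply, ell2_smul_apply, ellRestrict_apply_of_notMem hv, basisVec_apply, hvo]
  rw [h2] at h1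
  exact h1.closRel_of_finSupp (ellRestrict_mem_finSupp _ thetaVec_mem_finSupp)

lemma inner_thetaVec_of_deficiency_even (ht : 0 < t) (he : Even N) {φ : ell2 V}
    (hφ : AdjRel hG φ ((Complex.I * t) • φ)) :
    inner ℂ φ (thetaVec hT hG t N hN o) = 0 := by
  refine inner_eq_zero_of_parity ht.ne' ?_ (thetaVec_even ht he)
  have := hφ.odd hT o
  rwa [ellRestrict_smul] at this

lemma inner_thetaVec_of_deficiency_odd (ht : 0 < t) (ho : ¬ Even N) {φ : ell2 V}
    (hφ : AdjRel hG φ ((Complex.I * t) • φ)) :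
    inner ℂ φ (thetaVec hT hG t N hN o) = ((rmsg G t N o none)⁻¹ / t : ℝ) * conj (φ o) := by
  refine inner_eq_of_parity (self_mem_evenSet o) ht.ne' ?_ (thetaVec_odd ht ho)
  have := hφ.even hT o
  rwa [ellRestrict_smul] at this

/-- The inner product of the two truncations equals the squared norm of the odd one, so the
expansion of the square reduces to a difference of squared norms. -/
lemma norm_sq_thetaVec_sub (ht : 0 < t) {M : ℕ} {hM : M ≠ 0} (he : Even N) (ho : ¬ Even M) :
    ‖thetaVec hT hG t M hM o - thetaVec hT hG t N hN o‖ ^ 2 =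
      ((rmsg G t N o none)⁻¹ - (rmsg G t M o none)⁻¹) / t := by
  have h1 : inner ℂ (thetaVec hT hG t N hN o) (thetaVec hT hG t M hM o) =
      ((rmsg G t M o none)⁻¹ / t : ℝ) * conj (thetaVec hT hG t N hN o o) :=
    inner_eq_of_parity (self_mem_evenSet o) ht.ne' (thetaVec_even ht he).adjRel (thetaVec_odd ht ho)
  rw [thetaVec_self, map_one, mul_one] at h1
  rw [norm_sub_rev, @norm_sub_sq ℂ, norm_sq_thetaVec ht, norm_sq_thetaVec ht, h1]
  rw [RCLike.re_to_complex, Complex.ofReal_re]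
  ring

/-! ### Convergence of the truncations when the two limits agree. -/

section Limits

variable {x : V} {p : Option V}

lemma tendsto_msg_of_eq {T : ℝ≥0∞} (h : msgLo G T x p = msgHi G T x p) :
    Tendsto (fun n => msg G T n x p) atTop (𝓝 (msgLo G T x p)) := by
  intro s hs
  have h1 := tendsto_msg_even (G := G) (t := T) x p hs
  have h2 := tendsto_msg_odd (G := G) (t := T) x p (h ▸ hs)
  rw [mem_map, mem_atTop_sets] at h1 h2 ⊢
  obtain ⟨a, ha⟩ := h1
  obtain ⟨b, hb⟩ := h2
  refine ⟨2 * a + 2 * b, fun n hn => ?_⟩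
  rcases Nat.even_or_odd' n with ⟨k, rfl | rfl⟩
  · exact ha k (by omega)
  · exact hb k (by omega)

/-- The limit of the continued fraction. -/
def hmsg (G : SimpleGraph V) (t : ℝ) (x : V) (p : Option V) : ℝ :=
  (msgLo G (ENNReal.ofReal t) x p).toReal

lemma tendsto_rmsg (ht : 0 < t)
    (h : msgLo G (ENNReal.ofReal t) x p = msgHi G (ENNReal.ofReal t) x p) :
    Tendsto (fun n => rmsg G t n x p) atTop (𝓝 (hmsg G t x p)) :=
  (ENNReal.tendsto_toReal (msgLo_ne_top (by simpa using ht) x p)).comp (tendsto_msg_of_eq h)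

lemma hmsg_pos (hG : ∀ v, (G.neighborSet v).Finite) (ht : 0 < t) (x : V) (p : Option V) :
    0 < hmsg G t x p :=
  ENNReal.toReal_pos (msgLo_ne_zero hG (by simpa using ht) (by simp) x p)
    (msgLo_ne_top (by simpa using ht) x p)

/-- Equality at `x` is equality of two finite sums of finite terms ordered term by term, which
forces equality of every term. -/
lemma msgLo_eq_msgHi_child {T : ℝ≥0∞} (hG : ∀ v, (G.neighborSet v).Finite) (hT : T ≠ 0)
    (hT' : T ≠ ∞) (h : msgLo G T x p = msgHi G T x p) {y : V} (hy : G.Adj x y) (hp : p ≠ some y) :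
    msgLo G T y (some x) = msgHi G T y (some x) := by
  classical
  rw [msgLo_eq hG, msgHi_eq hG, inv_inj, ENNReal.add_right_inj hT', nbrSum_eq_sum hG,
    nbrSum_eq_sum hG] at h
  by_contra hne
  have hlt : msgLo G T y (some x) < msgHi G T y (some x) :=
    lt_of_le_of_ne (msgLo_le_msgHi _ _) hne
  have hym : y ∈ (hG x).toFinset.filter fun z => p ≠ some z := by simp [hy, hp]
  refine absurd h (ne_of_gt ?_)
  rw [← Finset.add_sum_erase _ _ hym, ← Finset.add_sum_erase _ _ hym]
  refine ENNReal.add_lt_add_of_lt_of_le ?_ hlt ?_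
  · exact ENNReal.sum_ne_top.2 fun z _ => msgLo_ne_top hT z _
  · exact Finset.sum_le_sum fun z _ => msgLo_le_msgHi z _

end Limits

/-- A deficiency vector pairs to zero with even truncations and to a fixed positive multiple of
`conj (φ o)`, in the limit, with odd ones. Consecutive truncations merge in norm, so `φ o` must
vanish. -/
lemma deficiency_apply_eq_zero (hT : G.IsTree) (ht : 0 < t)
    (hc : msgLo G (ENNReal.ofReal t) o none = msgHi G (ENNReal.ofReal t) o none) {φ : ell2 V}
    (hφ : AdjRel hG φ ((Complex.I * t) • φ)) : φ o = 0 := by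
  have hpos := hmsg_pos hG ht o none
  have hlim := (tendsto_rmsg ht hc).inv₀ hpos.ne'
  have hk : ∀ k : ℕ, (rmsg G t (2 * k + 2 + 1) o none)⁻¹ / t * ‖φ o‖ ≤
      ‖φ‖ * √(((rmsg G t (2 * k + 2) o none)⁻¹ - (rmsg G t (2 * k + 2 + 1) o none)⁻¹) / t) := by
    intro k
    have he : Even (2 * k + 2) := ⟨k + 1, by ring⟩
    have ho : ¬ Even (2 * k + 2 + 1) := by rw [Nat.even_add_one]; simpa using he
    have h1 := inner_thetaVec_of_deficiency_even (hT := hT) (hN := by omega) (o := o) ht he hφ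
    have h2 := inner_thetaVec_of_deficiency_odd (hT := hT) (hN := by omega) (o := o) ht ho hφ
    have h3 := norm_sq_thetaVec_sub (hT := hT) (hG := hG) (hN := by omega) (hM := by omega)
      (o := o) ht he ho
    have h4 := norm_inner_le_norm (𝕜 := ℂ) φ (thetaVec hT hG t (2 * k + 2 + 1) (by omega) o -
      thetaVec hT hG t (2 * k + 2) (by omega) o)
    rw [inner_sub_right, h1, h2, sub_zero, norm_mul, RCLike.norm_conj, Complex.norm_real] at h4
    rw [← h3, Real.sqrt_sq (norm_nonneg _)]
    refine le_trans ?_ h4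
    gcongr
    exact le_abs_self _
  have l1 : Tendsto (fun k : ℕ => (rmsg G t (2 * k + 2) o none)⁻¹) atTop
      (𝓝 (hmsg G t o none)⁻¹) :=
    hlim.comp (tendsto_atTop_mono (fun k => (by omega : k ≤ 2 * k + 2)) tendsto_id)
  have l2 : Tendsto (fun k : ℕ => (rmsg G t (2 * k + 2 + 1) o none)⁻¹) atTop
      (𝓝 (hmsg G t o none)⁻¹) :=
    hlim.comp (tendsto_atTop_mono (fun k => (by omega : k ≤ 2 * k + 2 + 1)) tendsto_id)
  have l3 := le_of_tendsto_of_tendsto' ((l2.div_const t).mul_const ‖φ o‖)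
    ((((l1.sub l2).div_const t).sqrt).const_mul ‖φ‖) hk
  rw [sub_self, zero_div, Real.sqrt_zero, mul_zero] at l3
  have h5 : 0 < (hmsg G t o none)⁻¹ / t := by positivity
  have h6 : ‖φ o‖ ≤ 0 := by
    by_contra hlt
    have : 0 < (hmsg G t o none)⁻¹ / t * ‖φ o‖ := mul_pos h5 (not_le.1 hlt)
    linarith
  exact norm_le_zero_iff.1 h6

/-- A tree on which the lower and upper continued fractions agree has an essentially self-adjoint
adjacency operator. -/
lemma essSelfAdj_of_msgLo_eq_msgHi (hT : G.IsTree) (hG : ∀ v, (G.neighborSet v).Finite)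
    (ht : 0 < t)
    (hc : ∀ o, msgLo G (ENNReal.ofReal t) o none = msgHi G (ENNReal.ofReal t) o none) :
    EssSelfAdj G hG := by
  have key : ∀ φ : ell2 V, AdjRel hG φ ((Complex.I * t) • φ) → φ = 0 := fun φ hφ =>
    ell2_eq_zero_of_inner_basisVec fun v => deficiency_apply_eq_zero hT ht (hc v) hφ
  refine essSelfAdj_of_deficiency (z := Complex.I * t) (by simpa using ht.ne') key fun φ hφ => ?_
  by_cases hV : Nonempty V
  · obtain ⟨o⟩ := hV
    simp only [map_mul, Complex.conj_I, Complex.conj_ofReal] at hφ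
    have h1 := hφ.even hT o
    have h2 := hφ.odd hT o
    rw [ellRestrict_smul] at h1 h2
    have h3 := h1.sub h2
    -- Changing the sign on odd vertices conjugates the adjacency operator to its opposite, which
    -- reduces the conjugate point to the point already treated.
    have h4 := key (ellRestrict (evenSet G o) φ - ellRestrict (evenSet G o)ᶜ φ) (by
      convert h3 using 1
      module)
    have h5 := ellRestrict_add_compl (evenSet G o) φ
    apply ell2_eq_zero_of_inner_basisVec
    intro v
    have h6 := congrArg (fun ψ : ell2 V => ψ v) h4
    by_cases hv : v ∈ evenSet G o
    · simpa [ellRestrict_apply_of_mem hv,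
        ellRestrict_apply_of_notMem (show v ∉ (evenSet G o)ᶜ from fun h => h hv)] using h6
    · simpa [ellRestrict_apply_of_notMem hv,
        ellRestrict_apply_of_mem (show v ∈ (evenSet G o)ᶜ from hv)] using h6
  · ext v
    exact absurd ⟨v⟩ hV

/-- The solution of the resolvent equation at `i t` is given by products of continued fractions
along paths. -/
lemma exists_treeResolvent (hT : G.IsTree) (hG : ∀ v, (G.neighborSet v).Finite) (ht : 0 < t)
    (hc : msgLo G (ENNReal.ofReal t) o none = msgHi G (ENNReal.ofReal t) o none) :
    ∃ ψ : ell2 V, AdjRel hG ψ (basisVec o + (Complex.I * t) • ψ) ∧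
      ∀ v, ψ v = Complex.I * hmsg G t o none *
        thetaFun G (fun v u => hmsg G t v (some u)) o v := by
  classical
  have ht0 : ENNReal.ofReal t ≠ 0 := by simpa using ht
  have ht1 : ENNReal.ofReal t ≠ ∞ := by simp
  -- Equality of the two limits at the root propagates along the edges leading away from it.
  have hdart : ∀ v u, G.Adj u v → G.dist o v = G.dist o u + 1 →
      msgLo G (ENNReal.ofReal t) v (some u) = msgHi G (ENNReal.ofReal t) v (some u) := by
    intro v
    refine dist_induction (p := fun v => ∀ u, G.Adj u v → G.dist o v = G.dist o u + 1 →
      msgLo G (ENNReal.ofReal t) v (some u) = msgHi G (ENNReal.ofReal t) v (some u))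
      hT.connected o ?_ ?_ v
    · intro u _ h
      simp at h
    · intro u v hu hu' ih w hw hw'
      obtain rfl := IsTree.eq_of_dist_succ hT hw hu hw' hu'
      by_cases hwo : w = o
      · subst hwo
        exact msgLo_eq_msgHi_child hG ht0 ht1 hc hw (by simp)
      · obtain ⟨p, hp, hp'⟩ := exists_parent hT.connected hwo
        refine msgLo_eq_msgHi_child hG ht0 ht1 (ih p hp hp') hw ?_
        intro h
        rw [Option.some.injEq] at h
        subst h
        omega
  have hrec : ∀ v u, G.Adj u v → G.dist o v = G.dist o u + 1 → hmsg G t v (some u) *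
      (t + ∑ y ∈ (hG v).toFinset.erase u, hmsg G t y (some v)) = 1 := by
    intro v u hu hu'
    have h := toReal_mul_eq_one (T := ENNReal.ofReal t) (v := v) (o := some u) hG ht0 ht1
      fun y => msgHi_ne_top (G := G) ht0 y (some v)
    rw [← msgLo_eq hG, filter_ne_some, ENNReal.toReal_ofReal ht.le] at h
    rw [← h]
    congr 2
    refine Finset.sum_congr rfl fun y hy => ?_
    have hy1 : G.Adj v y := by simpa using (Finset.mem_erase.1 hy).2
    have hy2 := IsTree.dist_of_adj_ne_parent hT hu hu' hy1 (Finset.mem_erase.1 hy).1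
    rw [hmsg, hdart y v hy1 hy2]
  have hroot : hmsg G t o none * (t + ∑ y ∈ (hG o).toFinset, hmsg G t y (some o)) = 1 := by
    have h := toReal_mul_eq_one (T := ENNReal.ofReal t) (v := o) (o := none) hG ht0 ht1
      fun y => msgHi_ne_top (G := G) ht0 y (some o)
    rw [← msgLo_eq hG, filter_ne_none, ENNReal.toReal_ofReal ht.le] at h
    rw [← h]
    congr 2
    refine Finset.sum_congr rfl fun y hy => ?_
    have hy1 : G.Adj o y := by simpa using hy
    rw [hmsg, hdart y o hy1 (by simp [SimpleGraph.dist_eq_one_iff_adj.2 hy1])]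
  let a : V → V → ℝ := fun v u => hmsg G t v (some u)
  have hlim : ∀ v, Tendsto (fun k : ℕ => thetaVec hT hG t (2 * k + 1) (by omega) o v) atTop
      (𝓝 (thetaFun G a o v)) := by
    intro v
    refine dist_induction (p := fun v => Tendsto (fun k : ℕ =>
      thetaVec hT hG t (2 * k + 1) (by omega) o v) atTop (𝓝 (thetaFun G a o v))) hT.connected o
      ?_ ?_ v
    · simp only [thetaVec_self]
      rw [thetaFun, pathProd_self]
      exact tendsto_const_nhds
    · intro u v hu hu' ih
      have h1 : ∀ k : ℕ, thetaVec hT hG t (2 * k + 1) (by omega) o v =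
          thetaVec hT hG t (2 * k + 1) (by omega) o u *
            (-Complex.I * (rmsg G t (2 * k + 1 - G.dist o v) v (some u) : ℂ)) :=
        fun k => IsTree.pathProd_succ hT _ hu hu'
      have h2 : thetaFun G a o v = thetaFun G a o u * (-Complex.I * (a v u : ℂ)) :=
        IsTree.pathProd_succ hT _ hu hu'
      simp only [h1, h2]
      refine ih.mul (tendsto_const_nhds.mul ?_)
      refine (Complex.continuous_ofReal.tendsto _).comp ((tendsto_rmsg ht (hdart v u hu hu')).comp
        (tendsto_atTop_mono (f := fun k => k - G.dist o v)
          (fun k => (by omega : k - G.dist o v ≤ 2 * k + 1 - G.dist o v)) ?_))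
      exact tendsto_sub_atTop_nat _
  have hbdd : Bornology.IsBounded
      (Set.range fun k : ℕ => thetaVec hT hG t (2 * k + 1) (by omega) o) := by
    rw [isBounded_iff_forall_norm_le]
    refine ⟨√((rmsg G t 2 o none)⁻¹ / t), ?_⟩
    rintro _ ⟨k, rfl⟩
    refine Real.le_sqrt_of_sq_le ?_
    rw [norm_sq_thetaVec ht]
    -- Depth two is the first even truncation that is nonzero, so it bounds all odd truncations
    -- below and the norms above.
    have h2 : msg G (ENNReal.ofReal t) 2 o none ≤ msg G (ENNReal.ofReal t) (2 * k + 1) o none :=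
      (le_iSup (fun n => msg G (ENNReal.ofReal t) (2 * n) o none) 1).trans
        (hc.le.trans (iInf_le (fun n => msg G (ENNReal.ofReal t) (2 * n + 1) o none) k))
    have h3 : 0 < rmsg G t 2 o none :=
      ENNReal.toReal_pos (msg_succ_pos hG ht0 ht1 1 o none) (msg_ne_top ht0 _ _ _)
    have h4 : rmsg G t 2 o none ≤ rmsg G t (2 * k + 1) o none :=
      ENNReal.toReal_mono (msg_ne_top ht0 _ _ _) h2
    gcongr
  -- A pointwise limit of a sequence bounded in `ℓ²` is square summable.
  let θ : ell2 V := ⟨thetaFun G a o, lp.memℓp_of_tendsto hbdd (tendsto_pi_nhds.2 hlim)⟩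
  have hθ : ∀ v, θ v = thetaFun G a o v := fun v => rfl
  refine ⟨(Complex.I * hmsg G t o none) • θ, fun v => ?_, fun v => rfl⟩
  simp only [lp.coeFn_smul, Pi.smul_apply, smul_eq_mul, lp.coeFn_add, Pi.add_apply,
    ← Finset.mul_sum, hθ]
  by_cases hv : v = o
  · subst hv
    rw [sum_thetaFun_root hT hG, basisVec_apply, if_pos rfl, thetaFun, pathProd_self]
    have h : (hmsg G t v none : ℂ) * (t + (∑ y ∈ (hG v).toFinset, a y v : ℝ)) = 1 := by
      exact_mod_cast hroot
    linear_combination -h + (hmsg G t v none : ℂ) *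
      (t + (∑ y ∈ (hG v).toFinset, a y v : ℝ)) * Complex.I_mul_I
  · obtain ⟨u, hu, hu'⟩ := exists_parent hT.connected hv
    rw [sum_thetaFun hT hG hu hu' (hrec v u hu hu'), basisVec_apply, if_neg hv]
    ring

end TreeResolvent

/-! ### Branches of trees -/

section Branches

open Filter Topology ComplexConjugate

variable {V : Type*} {G : SimpleGraph V} {x o : V}

lemma IsTree.parent_mem_branchSet (hT : G.IsTree) (h : G.Adj o x) {u v : V}
    (hv : v ∈ branchSet G x o) (hu : G.Adj u v) (hd : G.dist x v = G.dist x u + 1) :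
    u ∈ branchSet G x o := by
  rw [IsTree.mem_branchSet_iff hT h] at hv ⊢
  have := dist_le_succ_of_adj hT.connected o hu
  rcases IsTree.dist_eq_succ_or hT h u with h1 | h1 <;> omega

lemma mem_branchSet_of_adj {u v : V}
    (hv : v ∈ branchSet G x o) (hu : G.Adj v u) (huo : u ≠ o) : u ∈ branchSet G x o := by
  obtain ⟨p, hp⟩ := hv
  exact ⟨p.concat hu, by simp [SimpleGraph.Walk.support_concat, hp, huo.symm]⟩

lemma IsTree.eq_of_adj_of_mem_branchSet (hT : G.IsTree) (h : G.Adj o x) {v : V}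
    (hv : v ∈ branchSet G x o) (hu : G.Adj v o) : v = x := by
  rw [IsTree.mem_branchSet_iff hT h, SimpleGraph.dist_eq_one_iff_adj.2 hu.symm] at hv
  exact (hT.connected.dist_eq_zero_iff.1 (by omega)).symm

lemma notMem_branchSet (x o : V) : o ∉ branchSet G x o := by
  rintro ⟨p, hp⟩
  exact hp p.end_mem_support

lemma IsTree.exists_branch_walk (hT : G.IsTree) (h : G.Adj o x) (v : branchSet G x o) :
    ∃ p : (branch G x o).Walk ⟨x, mem_branchSet G h⟩ v, p.length = G.dist x v := by
  induction hn : G.dist x v using Nat.strong_induction_on generalizing v with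
  | _ n ih =>
    by_cases hv : (v : V) = x
    · have : v = ⟨x, mem_branchSet G h⟩ := Subtype.ext hv
      subst this
      rw [SimpleGraph.dist_self] at hn
      subst hn
      exact ⟨SimpleGraph.Walk.nil, rfl⟩
    · obtain ⟨u, hu, hu'⟩ := exists_parent hT.connected hv
      obtain ⟨p, hp⟩ := ih (G.dist x u) (by omega)
        ⟨u, IsTree.parent_mem_branchSet hT h v.2 hu hu'⟩ rfl
      exact ⟨p.concat (show (branch G x o).Adj ⟨u, _⟩ v from hu), by
        rw [SimpleGraph.Walk.length_concat, hp]; omega⟩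

lemma IsTree.branch (hT : G.IsTree) (h : G.Adj o x) : (branch G x o).IsTree := by
  refine ⟨?_, hT.isAcyclic.induce _⟩
  have : Nonempty (branchSet G x o) := ⟨⟨x, mem_branchSet G h⟩⟩
  refine ⟨fun u v => ?_⟩
  exact (IsTree.exists_branch_walk hT h u).choose.reachable.symm.trans
    (IsTree.exists_branch_walk hT h v).choose.reachable

lemma IsTree.branch_dist (hT : G.IsTree) (h : G.Adj o x) (v : branchSet G x o) :
    (AtomAtZero.branch G x o).dist ⟨x, mem_branchSet G h⟩ v = G.dist x v := by
  refine le_antisymm ?_ ?_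
  · obtain ⟨p, hp⟩ := IsTree.exists_branch_walk hT h v
    rw [← hp]
    exact SimpleGraph.dist_le p
  · obtain ⟨p, hp⟩ := (IsTree.branch hT h).connected.exists_walk_length_eq_dist
      ⟨x, mem_branchSet G h⟩ v
    rw [← hp, ← SimpleGraph.Walk.length_map (SimpleGraph.Embedding.induce _).toHom p]
    exact SimpleGraph.dist_le _

/-- Passing to the branch deletes a neighbour only at `x`, namely `o`. It must therefore be the
excluded neighbour there. -/
lemma IsTree.nbrSum_branch (hT : G.IsTree) (h : G.Adj o x) {v : branchSet G x o}
    {q : Option (branchSet G x o)} {q' : Option V}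
    (hq : ∀ y : branchSet G x o, G.Adj v y → (q = some y ↔ q' = some (y : V)))
    (hq' : (v : V) = x → q' = some o) {F : branchSet G x o → ℝ≥0∞} {F' : V → ℝ≥0∞}
    (hF : ∀ y : branchSet G x o, G.Adj v y → q ≠ some y → F y = F' y) :
    nbrSum (AtomAtZero.branch G x o) v q F = nbrSum G v q' F' := by
  classical
  rw [nbrSum, nbrSum]
  rw [← tsum_subtype_eq_of_support_subset (s := branchSet G x o)]
  · refine tsum_congr fun y => ?_
    by_cases hy : G.Adj v y
    · by_cases hqy : q = some y
      · simp [hqy, (hq y hy).1 hqy]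
      · have hqy' : ¬ q' = some (y : V) := fun e => hqy ((hq y hy).2 e)
        simp [hqy, hqy', hy, hF y hy hqy]
    · simp [hy]
  · intro y hy
    rw [Function.mem_support] at hy
    by_contra hyB
    apply hy
    rw [if_neg]
    rintro ⟨h1, h2⟩
    by_cases hyo : y = o
    · subst hyo
      exact h2 (hq' (IsTree.eq_of_adj_of_mem_branchSet hT h v.2 h1))
    · exact hyB (mem_branchSet_of_adj v.2 h1 hyo)

lemma IsTree.msg_branch_some (hT : G.IsTree) (h : G.Adj o x) (t : ℝ≥0∞) (n : ℕ)
    {u v : branchSet G x o} (hu : G.Adj u v) (hd : G.dist x v = G.dist x u + 1) :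
    msg (AtomAtZero.branch G x o) t n v (some u) = msg G t n v (some (u : V)) := by
  induction n generalizing u v with
  | zero => rfl
  | succ n ih =>
    rw [msg_succ, msg_succ]
    congr 2
    refine IsTree.nbrSum_branch hT h (fun y _ => by simp [Subtype.ext_iff]) ?_ ?_
    · intro hv
      rw [hv] at hd
      simp at hd
    · intro y hy hne
      exact ih hy (IsTree.dist_of_adj_ne_parent hT hu hd hy fun e => hne (by
        rw [Option.some.injEq]; exact (Subtype.ext e).symm))

lemma IsTree.msg_branch_none (hT : G.IsTree) (h : G.Adj o x) (t : ℝ≥0∞) (n : ℕ) :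
    msg (AtomAtZero.branch G x o) t n ⟨x, mem_branchSet G h⟩ none = msg G t n x (some o) := by
  cases n with
  | zero => rfl
  | succ n =>
    rw [msg_succ, msg_succ]
    congr 2
    refine IsTree.nbrSum_branch hT h (fun y _ => ?_) (fun _ => rfl) ?_
    · simp only [reduceCtorEq, Option.some.injEq, false_iff]
      intro e
      have key : ∀ z : V, o = z → z ∈ branchSet G x o → False := by
        rintro _ rfl hz
        exact notMem_branchSet _ _ hz
      exact key _ e y.2
    · intro y hy _
      exact IsTree.msg_branch_some hT h t n (u := ⟨x, mem_branchSet G h⟩) hy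
        (by simp [SimpleGraph.dist_eq_one_iff_adj.2 hy])

lemma IsTree.msgLo_branch_some (hT : G.IsTree) (h : G.Adj o x) (t : ℝ≥0∞)
    {u v : branchSet G x o} (hu : G.Adj u v) (hd : G.dist x v = G.dist x u + 1) :
    msgLo (AtomAtZero.branch G x o) t v (some u) = msgLo G t v (some (u : V)) :=
  iSup_congr fun _ => IsTree.msg_branch_some hT h t _ hu hd

lemma IsTree.msgLo_branch_none (hT : G.IsTree) (h : G.Adj o x) (t : ℝ≥0∞) :
    msgLo (AtomAtZero.branch G x o) t ⟨x, mem_branchSet G h⟩ none = msgLo G t x (some o) :=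
  iSup_congr fun _ => IsTree.msg_branch_none hT h t _

lemma IsTree.msgHi_branch_none (hT : G.IsTree) (h : G.Adj o x) (t : ℝ≥0∞) :
    msgHi (AtomAtZero.branch G x o) t ⟨x, mem_branchSet G h⟩ none = msgHi G t x (some o) :=
  iInf_congr fun _ => IsTree.msg_branch_none hT h t _

lemma IsTree.pathProd_branch (hT : G.IsTree) (h : G.Adj o x) {M : Type*} [CommMonoid M]
    {w : branchSet G x o → branchSet G x o → M} {w' : V → V → M}
    (hw : ∀ u v : branchSet G x o, G.Adj u v → G.dist x v = G.dist x u + 1 → w v u = w' v u)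
    (v : branchSet G x o) :
    pathProd (AtomAtZero.branch G x o) w ⟨x, mem_branchSet G h⟩ v = pathProd G w' x v := by
  refine dist_induction (p := fun v : branchSet G x o => pathProd (AtomAtZero.branch G x o) w
    ⟨x, mem_branchSet G h⟩ v = pathProd G w' x v) (IsTree.branch hT h).connected
    ⟨x, mem_branchSet G h⟩ (by rw [pathProd_self, pathProd_self]) ?_ v
  intro u v hu hd ih
  have hd' : G.dist x v = G.dist x u + 1 := by
    rwa [IsTree.branch_dist hT h, IsTree.branch_dist hT h] at hd
  rw [IsTree.pathProd_succ (IsTree.branch hT h) w hu hd,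
    IsTree.pathProd_succ hT w' (show G.Adj (u : V) v from hu) hd', ih,
    hw u v hu hd']

/-- Extension by zero of a vector on a branch. -/
def extendBranch (φ : ell2 (branchSet G x o)) : ell2 V :=
  ⟨Function.extend Subtype.val φ 0, show Memℓp (E := fun _ => ℂ) _ 2 by
    have h := lp.memℓp φ
    rw [memℓp_gen_iff (by norm_num)] at h ⊢
    have h2 := (Subtype.val_injective.summable_iff (f := fun v : V =>
      ‖Function.extend Subtype.val (φ : branchSet G x o → ℂ) 0 v‖ ^ (2 : ℝ≥0∞).toReal) (by
        intro v hv
        rw [Function.extend_apply' _ _ _ (by simpa using hv)]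
        simp)).1
    refine h2 (h.congr fun v => ?_)
    simp⟩

lemma extendBranch_apply (φ : ell2 (branchSet G x o)) (v : branchSet G x o) :
    extendBranch φ v = φ v := Subtype.val_injective.extend_apply _ _ _

lemma extendBranch_apply_of_notMem (φ : ell2 (branchSet G x o)) {v : V}
    (hv : v ∉ branchSet G x o) : extendBranch φ v = 0 :=
  Function.extend_apply' _ _ _ (by simpa using hv)

lemma IsTree.adjRel_extendBranch (hT : G.IsTree) (hG : ∀ v, (G.neighborSet v).Finite)
    (h : G.Adj o x) {φ χ : ell2 (branchSet G x o)} (hφ : AdjRel (branch_locFin G hG x o) φ χ) :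
    AdjRel hG (extendBranch φ)
      (extendBranch χ + φ ⟨x, mem_branchSet G h⟩ • basisVec o) := by
  classical
  intro v
  rw [ell2_add_apply, ell2_smul_apply, basisVec_apply]
  by_cases hv : v ∈ branchSet G x o
  · have hvo : v ≠ o := by rintro rfl; exact notMem_branchSet x v hv
    rw [if_neg hvo, mul_zero, add_zero, extendBranch_apply χ ⟨v, hv⟩, hφ]
    refine Finset.sum_of_injOn Subtype.val Subtype.val_injective.injOn ?_ ?_ ?_
    · intro y hy
      simpa using hy
    · intro y _ hy
      refine extendBranch_apply_of_notMem _ fun hyB => hy ⟨⟨y, hyB⟩, ?_, rfl⟩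
      simp_all
    · intro y _
      exact (extendBranch_apply φ y).symm
  · rw [extendBranch_apply_of_notMem _ hv]
    by_cases hvo : v = o
    · subst hvo
      rw [if_pos rfl, mul_one, zero_add, Finset.sum_eq_single x]
      · exact (extendBranch_apply φ ⟨x, mem_branchSet G h⟩).symm
      · intro y hy hyx
        refine extendBranch_apply_of_notMem _ fun hyB => hyx ?_
        exact IsTree.eq_of_adj_of_mem_branchSet hT h hyB (by simpa [G.adj_comm] using hy)
      · intro hx
        simp [h] at hx
    · rw [if_neg hvo, mul_zero, add_zero]
      refine (Finset.sum_eq_zero fun y hy =>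
        extendBranch_apply_of_notMem φ (v := y) fun hyB => hv ?_).symm
      exact mem_branchSet_of_adj hyB (by simpa [G.adj_comm] using hy) hvo

/-- The branches of an essentially self-adjoint tree are essentially self-adjoint. -/
lemma EssSelfAdj.branch {hG : ∀ v, (G.neighborSet v).Finite} (hess : EssSelfAdj G hG)
    (hT : G.IsTree) {t : ℝ} (ht : 0 < t)
    (hc : msgLo G (ENNReal.ofReal t) o none = msgHi G (ENNReal.ofReal t) o none)
    (h : G.Adj o x) : EssSelfAdj (AtomAtZero.branch G x o) (branch_locFin G hG x o) := by
  classical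
  obtain ⟨ψ, hψ, hψ'⟩ := exists_treeResolvent hT hG ht hc
  have hψo : ψ o ≠ 0 := by
    rw [hψ', thetaFun, pathProd_self, mul_one]
    simpa using (hmsg_pos hG ht o none).ne'
  -- Extended by zero, a deficiency vector of the branch violates the equation only at `o`, by its
  -- value at `x`. Subtracting this multiple of the resolvent vector gives a deficiency vector of
  -- the whole tree, hence zero. Evaluation at `o` then kills the multiple.
  have key : ∀ {z : ℂ} (hz : z.im ≠ 0) {ψ : ell2 V}, AdjRel hG ψ (basisVec o + z • ψ) → ψ o ≠ 0 →
      ∀ φ, AdjRel (branch_locFin G hG x o) φ (z • φ) → φ = 0 := by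
    intro z hz ψ hψ hψo φ hφ
    have h1 := IsTree.adjRel_extendBranch hT hG h hφ
    have h2 : extendBranch (z • φ) = z • extendBranch φ := by
      ext v
      rw [ell2_smul_apply]
      by_cases hv : v ∈ branchSet G x o
      · rw [extendBranch_apply _ ⟨v, hv⟩, extendBranch_apply _ ⟨v, hv⟩, ell2_smul_apply]
      · rw [extendBranch_apply_of_notMem _ hv, extendBranch_apply_of_notMem _ hv, mul_zero]
    have h3 := hψ.smul (φ ⟨x, mem_branchSet G h⟩)
    have h4 := hess.deficiency hz (φ := extendBranch φ - φ ⟨x, mem_branchSet G h⟩ • ψ) (by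
      have h4 := h1.sub h3
      rw [h2] at h4
      convert h4 using 1
      module)
    have h5 := congrArg (fun χ : ell2 V => χ o) h4
    simp only [ell2_sub_apply, ell2_smul_apply,
      extendBranch_apply_of_notMem φ (notMem_branchSet x o)] at h5
    have h6 : φ ⟨x, mem_branchSet G h⟩ = 0 := by
      have : φ ⟨x, mem_branchSet G h⟩ * ψ o = 0 := by
        have h7 : (0 : ℂ) - φ ⟨x, mem_branchSet G h⟩ * ψ o = 0 := h5
        linear_combination -h7
      exact (mul_eq_zero.1 this).resolve_right hψo
    rw [h6, zero_smul, sub_zero] at h4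
    apply ell2_eq_zero_of_inner_basisVec
    intro v
    rw [← extendBranch_apply, h4]
    rfl
  refine essSelfAdj_of_deficiency (z := Complex.I * t) (by simpa using ht.ne')
    (key (by simpa using ht.ne') hψ hψo) ?_
  have h1 := hψ.even hT o
  have h2 := hψ.odd hT o
  rw [ellRestrict_add, ellRestrict_smul] at h1 h2
  have hb1 : ellRestrict (evenSet G o)ᶜ (basisVec o) = 0 := by
    ext v
    by_cases hv : v ∈ (evenSet G o)ᶜ
    · rw [ellRestrict_apply_of_mem hv, basisVec_apply, if_neg]
      · rfl
      · rintro rfl; exact hv (self_mem_evenSet _)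
    · rw [ellRestrict_apply_of_notMem hv]; rfl
  have hb2 : ellRestrict (evenSet G o) (basisVec o) = basisVec o := by
    have := ellRestrict_add_compl (evenSet G o) (basisVec o)
    rwa [hb1, add_zero] at this
  rw [hb1, zero_add] at h1
  rw [hb2] at h2
  -- The odd part minus the even part of the resolvent vector solves the equation at the conjugate
  -- point.
  refine key (by simpa using ht.ne') (ψ := ellRestrict (evenSet G o)ᶜ ψ -
    ellRestrict (evenSet G o) ψ) ?_ ?_
  · have h3 := h2.sub h1
    convert h3 using 1
    simp only [map_mul, Complex.conj_I, Complex.conj_ofReal]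
    module
  · rw [ell2_sub_apply, ellRestrict_apply_of_mem (self_mem_evenSet o),
      ellRestrict_apply_of_notMem
        (show o ∉ (evenSet G o)ᶜ from fun h => h (self_mem_evenSet o))]
    simpa using hψo

end Branches

/-! ### Behaviour near zero of the Poisson integrals of a measure -/

section Poisson

open Filter Topology

/-- The scale `2⁻ⁿ`. -/
def tn (n : ℕ) : ℝ := (1 / 2) ^ n

lemma tn_pos (n : ℕ) : 0 < tn n := by unfold tn; positivity

lemma tn_eq (n : ℕ) : tn n = 2 * tn (n + 1) := by simp only [tn, pow_succ]; ring

lemma tn_anti : Antitone tn := antitone_nat_of_succ_le fun n => by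
  rw [tn_eq n]; linarith [tn_pos (n + 1)]

lemma tendsto_tn : Tendsto tn atTop (𝓝 0) :=
  tendsto_pow_atTop_nhds_zero_of_lt_one (by norm_num) (by norm_num)

/-- The scale `2⁻ⁿ` as an extended nonnegative real. -/
def te (n : ℕ) : ℝ≥0∞ := ENNReal.ofReal (tn n)

lemma te_ne_zero (n : ℕ) : te n ≠ 0 := by simpa [te] using tn_pos n

lemma te_ne_top (n : ℕ) : te n ≠ ∞ := ENNReal.ofReal_ne_top

lemma te_eq (n : ℕ) : te n = 2 * te (n + 1) := by
  rw [te, tn_eq, ENNReal.ofReal_mul (by norm_num), te]; simp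

lemma tendsto_te : Tendsto te atTop (𝓝 0) := by
  have := ENNReal.tendsto_ofReal tendsto_tn
  rwa [ENNReal.ofReal_zero] at this

/-- The Poisson integral `∫ t / (x² + t²)`. -/
def poisson (μ : Measure ℝ) (t : ℝ) : ℝ≥0∞ := ∫⁻ x, ENNReal.ofReal (t / (x ^ 2 + t ^ 2)) ∂μ

/-- The integral `∫ x² / ((x² + t²) (x² + s²))` for `s = tₙ` and `t = tₙ₊₁`. -/
def bInt (μ : Measure ℝ) (n : ℕ) : ℝ≥0∞ :=
  ∫⁻ x, ENNReal.ofReal (x ^ 2 / ((x ^ 2 + tn (n + 1) ^ 2) * (x ^ 2 + tn n ^ 2))) ∂μ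

variable (μ : Measure ℝ)

/-- With the ratio two between heights, the combination has numerator proportional to `x²`, so it
does not see an atom at zero. -/
lemma two_mul_poisson (n : ℕ) :
    2 * poisson μ (tn n) = poisson μ (tn (n + 1)) + 3 * te (n + 1) * bInt μ n := by
  have ht := tn_pos (n + 1)
  rw [poisson, poisson, bInt, te, ← lintegral_const_mul' _ _ (by simp),
    ← lintegral_const_mul _ (by fun_prop), ← lintegral_add_left (by fun_prop)]
  refine lintegral_congr fun x => ?_
  rw [show (2 : ℝ≥0∞) = ENNReal.ofReal 2 by simp, show (3 : ℝ≥0∞) = ENNReal.ofReal 3 by simp,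
    ← ENNReal.ofReal_mul (by norm_num), ← ENNReal.ofReal_mul (by norm_num),
    ← ENNReal.ofReal_mul (by positivity), ← ENNReal.ofReal_add (by positivity) (by
      have := tn_pos n; positivity), tn_eq n]
  congr 1
  field_simp
  ring

lemma tendsto_mul_poisson [IsFiniteMeasure μ] :
    Tendsto (fun n => te n * poisson μ (tn n)) atTop (𝓝 (alpha μ)) := by
  have h1 : ∀ n, te n * poisson μ (tn n) =
      ∫⁻ x, ENNReal.ofReal (tn n ^ 2 / (x ^ 2 + tn n ^ 2)) ∂μ := by
    intro n
    have ht := tn_pos n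
    rw [te, poisson, ← lintegral_const_mul _ (by fun_prop)]
    refine lintegral_congr fun x => ?_
    rw [← ENNReal.ofReal_mul ht.le]
    congr 1
    ring
  have h2 : alpha μ = ∫⁻ x, indicator {0} (fun _ => 1) x ∂μ := by
    rw [lintegral_indicator (by simp)]; simp [alpha]
  simp only [h1]
  rw [h2]
  refine tendsto_lintegral_of_dominated_convergence (fun _ => 1) (fun n => by fun_prop) ?_ (by simp)
    (Eventually.of_forall fun x => ?_)
  · intro n
    refine Eventually.of_forall fun x => ?_
    have ht := tn_pos n
    rw [← ENNReal.ofReal_one]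
    refine ENNReal.ofReal_le_ofReal ?_
    rw [div_le_one (by positivity)]
    nlinarith [sq_nonneg x]
  · by_cases hx : x = 0
    · subst hx
      rw [indicator_of_mem (by simp)]
      refine tendsto_const_nhds.congr fun n => ?_
      have ht := tn_pos n
      rw [zero_pow two_ne_zero, zero_add, div_self (by positivity), ENNReal.ofReal_one]
    · rw [indicator_of_notMem (by simpa using hx), ← ENNReal.ofReal_zero]
      refine ENNReal.tendsto_ofReal ?_
      have h3 : Tendsto (fun n => tn n ^ 2) atTop (𝓝 0) := by
        simpa using tendsto_tn.pow 2
      have h4 := h3.div (h3.const_add (x ^ 2)) (by simpa using hx)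
      rw [zero_div] at h4
      exact h4

lemma tendsto_poisson_div :
    Tendsto (fun n => poisson μ (tn n) / te n) atTop (𝓝 (beta μ)) ∧
      Monotone fun n => poisson μ (tn n) / te n := by
  have h1 : ∀ n, poisson μ (tn n) / te n = ∫⁻ x, (ENNReal.ofReal (x ^ 2 + tn n ^ 2))⁻¹ ∂μ := by
    intro n
    have ht := tn_pos n
    rw [te, poisson, ENNReal.div_eq_inv_mul, ← lintegral_const_mul _ (by fun_prop)]
    refine lintegral_congr fun x => ?_
    have hp : 0 < x ^ 2 + tn n ^ 2 := by positivity
    rw [← ENNReal.ofReal_inv_of_pos ht, ← ENNReal.ofReal_mul (by positivity),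
      ← ENNReal.ofReal_inv_of_pos hp]
    congr 1
    field_simp
  have hmono : ∀ x : ℝ, Monotone fun n => (ENNReal.ofReal (x ^ 2 + tn n ^ 2))⁻¹ := by
    intro x m n hmn
    refine ENNReal.inv_le_inv.2 (ENNReal.ofReal_le_ofReal ?_)
    have := tn_anti hmn
    have := tn_pos n
    gcongr
  simp only [h1]
  refine ⟨lintegral_tendsto_of_tendsto_of_monotone (fun n => by fun_prop)
    (Eventually.of_forall hmono) (Eventually.of_forall fun x => ?_),
    fun m n hmn => lintegral_mono fun x => hmono x hmn⟩
  refine tendsto_inv_iff.2 (ENNReal.tendsto_ofReal ?_)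
  simpa using (tendsto_tn.pow 2).const_add (x ^ 2)

/-- The integrands vanish at zero and increase to `x⁻²` elsewhere, so monotone convergence applies
even if the limit is infinite. -/
lemma tendsto_bInt : Tendsto (fun n => bInt μ n) atTop (𝓝 (betaStar μ)) ∧
    Monotone fun n => bInt μ n := by
  have hmono : ∀ x : ℝ, Monotone fun n =>
      ENNReal.ofReal (x ^ 2 / ((x ^ 2 + tn (n + 1) ^ 2) * (x ^ 2 + tn n ^ 2))) := by
    intro x m n hmn
    have h1 := tn_pos n
    have h2 := tn_pos (n + 1)
    have h3 := tn_anti hmn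
    have h4 := tn_anti (Nat.add_le_add_right hmn 1)
    refine ENNReal.ofReal_le_ofReal ?_
    gcongr
  refine ⟨?_, fun m n hmn => lintegral_mono fun x => hmono x hmn⟩
  have h2 : betaStar μ = ∫⁻ x, indicator {0}ᶜ (fun x => (ENNReal.ofReal (x ^ 2))⁻¹) x ∂μ := by
    rw [lintegral_indicator (by simp)]; rfl
  rw [h2]
  refine lintegral_tendsto_of_tendsto_of_monotone (fun n => by fun_prop)
    (Eventually.of_forall hmono) (Eventually.of_forall fun x => ?_)
  by_cases hx : x = 0
  · subst hx
    simp
  · have hp : 0 < x ^ 2 := by positivity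
    rw [indicator_of_mem (by simpa using hx), ← ENNReal.ofReal_inv_of_pos hp]
    refine ENNReal.tendsto_ofReal ?_
    have h3 : Tendsto (fun n => tn n ^ 2) atTop (𝓝 0) := by
      simpa using tendsto_tn.pow 2
    have h4 := h3.comp (tendsto_add_atTop_nat 1)
    have h5 := (tendsto_const_nhds (x := x ^ 2)).div
      ((h4.const_add (x ^ 2)).mul (h3.const_add (x ^ 2))) (by simpa using hx)
    rw [show (x ^ 2)⁻¹ = x ^ 2 / ((x ^ 2 + 0) * (x ^ 2 + 0)) by field_simp; ring]
    exact h5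

lemma bInt_eq (n : ℕ) [IsFiniteMeasure μ] :
    bInt μ n = (2 * poisson μ (tn n) - poisson μ (tn (n + 1))) / (3 * te (n + 1)) := by
  have hfin : poisson μ (tn (n + 1)) ≠ ∞ := by
    have ht := tn_pos (n + 1)
    refine ne_top_of_le_ne_top (b := ENNReal.ofReal (1 / tn (n + 1)) * μ univ) (by finiteness) ?_
    rw [← lintegral_const]
    refine lintegral_mono fun x => ENNReal.ofReal_le_ofReal ?_
    rw [div_le_div_iff₀ (by positivity) ht]
    nlinarith [sq_nonneg x]
  rw [two_mul_poisson, ENNReal.add_sub_cancel_left hfin, ENNReal.eq_div_iff]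
  · simp [te_ne_zero]
  · simp [ENNReal.mul_eq_top, te_ne_top]

lemma betaStar_le_beta : betaStar μ ≤ beta μ := setLIntegral_le_lintegral _ _

lemma betaStar_eq_beta (h : alpha μ = 0) : betaStar μ = beta μ := by
  have : (μ.restrict {0}ᶜ) = μ := Measure.restrict_eq_self_of_ae_mem (by
    rw [ae_iff]; simpa [alpha] using h)
  rw [betaStar, this, beta]

lemma alpha_eq_zero_of_beta_ne_top (h : beta μ ≠ ∞) : alpha μ = 0 := by
  by_contra h0
  apply h
  have h1 : ∫⁻ x in {0}, (ENNReal.ofReal (x ^ 2))⁻¹ ∂μ = ∞ := by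
    rw [lintegral_singleton]
    simp only [alpha] at h0
    simp [ENNReal.top_mul h0]
  exact top_le_iff.1 (h1 ▸ setLIntegral_le_lintegral _ _)

end Poisson

/-! ### The Green function of a tree on the imaginary axis -/

section Green

open Filter Topology ComplexConjugate

variable {V : Type*} {G : SimpleGraph V} {hG : ∀ v, (G.neighborSet v).Finite} {o : V}

/-- An essentially self-adjoint tree for which the continued fractions at `o` converge. -/
structure ConvTree (G : SimpleGraph V) (hG : ∀ v, (G.neighborSet v).Finite) (o : V) : Prop where
  isTree : G.IsTree
  ess : EssSelfAdj G hG
  conv : ∀ n, msgLo G (te n) o none = msgHi G (te n) o none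

/-- The continued fraction at the scale `2⁻ⁿ`. -/
def hE (G : SimpleGraph V) (n : ℕ) (x : V) (p : Option V) : ℝ≥0∞ := msgLo G (te n) x p

lemma hE_ne_top (n : ℕ) (x : V) (p : Option V) : hE G n x p ≠ ∞ := msgLo_ne_top (te_ne_zero n) x p

lemma hE_ne_zero (hG : ∀ v, (G.neighborSet v).Finite) (n : ℕ) (x : V) (p : Option V) :
    hE G n x p ≠ 0 := msgLo_ne_zero hG (te_ne_zero n) (te_ne_top n) x p

/-- The modulus of the Green function at `i 2⁻ⁿ`. -/
def gE (G : SimpleGraph V) (n : ℕ) (o v : V) : ℝ≥0∞ :=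
  hE G n o none * pathProd G (fun v u => hE G n v (some u)) o v

lemma gE_ne_top (n : ℕ) (o v : V) : gE G n o v ≠ ∞ := by
  refine ENNReal.mul_ne_top (hE_ne_top n o none) ?_
  have : ∀ k v, pathProdAux G (fun v u => hE G n v (some u)) o k v ≠ ∞ := by
    intro k
    induction k with
    | zero => intro v; simp [pathProdAux]
    | succ k ih => intro v; exact ENNReal.mul_ne_top (ih _) (hE_ne_top _ _ _)
  exact this _ v

lemma gE_self (n : ℕ) (o : V) : gE G n o o = hE G n o none := by
  rw [gE, pathProd_self, mul_one]

lemma IsTree.pathProd_const (hT : G.IsTree) {M : Type*} [CommMonoid M] (c : M) (o v : V) :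
    pathProd G (fun _ _ => c) o v = c ^ G.dist o v := by
  refine dist_induction (p := fun v => pathProd G (fun _ _ => c) o v = c ^ G.dist o v)
    hT.connected o (by simp [pathProd_self]) ?_ v
  intro u v hu hd ih
  rw [IsTree.pathProd_succ hT _ hu hd, ih, hd, pow_succ]

/-- The phase of the Green function depends only on the distance, so the products at different
scales have aligned phases and can be handled in `[0, ∞]`. -/
lemma ConvTree.exists_green (h : ConvTree G hG o) (n : ℕ) :
    ∃ ψ : ell2 V, AdjRel hG ψ (basisVec o + (Complex.I * tn n) • ψ) ∧
      ∀ v, ψ v = Complex.I * (-Complex.I) ^ G.dist o v * ((gE G n o v).toReal : ℂ) := by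
  obtain ⟨ψ, h1, h2⟩ := exists_treeResolvent h.isTree hG (tn_pos n) (h.conv n)
  refine ⟨ψ, h1, fun v => ?_⟩
  rw [h2, thetaFun, pathProd_mul_weights, IsTree.pathProd_const h.isTree, gE, ENNReal.toReal_mul]
  have h3 := map_pathProd (ENNReal.toRealHom : ℝ≥0∞ →* ℝ) (fun v u => hE G n v (some u))
    (G := G) o v
  have h4 := map_pathProd (Complex.ofRealHom : ℝ →* ℂ)
    (fun v u => (hE G n v (some u)).toReal) (G := G) o v
  have h3' : (pathProd G (fun v u => hE G n v (some u)) o v).toReal =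
    pathProd G (fun v u => (hE G n v (some u)).toReal) o v := h3
  have h4' : ((pathProd G (fun v u => (hE G n v (some u)).toReal) o v : ℝ) : ℂ) =
    pathProd G (fun v u => ((hE G n v (some u)).toReal : ℂ)) o v := h4
  rw [h3']
  push_cast
  rw [h4']
  simp only [hmsg, hE, te]
  ring

/-- The vector `(A - i 2⁻ⁿ)⁻¹ e_o`. -/
def greenVec (h : ConvTree G hG o) (n : ℕ) : ell2 V := (h.exists_green n).choose

lemma adjRel_greenVec (h : ConvTree G hG o) (n : ℕ) :
    AdjRel hG (greenVec h n) (basisVec o + (Complex.I * tn n) • greenVec h n) :=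
  (h.exists_green n).choose_spec.1

lemma greenVec_apply (h : ConvTree G hG o) (n : ℕ) (v : V) :
    greenVec h n v = Complex.I * (-Complex.I) ^ G.dist o v * ((gE G n o v).toReal : ℂ) :=
  (h.exists_green n).choose_spec.2 v

lemma greenVec_self (h : ConvTree G hG o) (n : ℕ) :
    greenVec h n o = Complex.I * ((hE G n o none).toReal : ℂ) := by
  rw [greenVec_apply, SimpleGraph.dist_self, pow_zero, mul_one, gE_self]

lemma norm_greenVec_apply (h : ConvTree G hG o) (n : ℕ) (v : V) :
    ‖greenVec h n v‖ = (gE G n o v).toReal := by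
  rw [greenVec_apply, norm_mul, norm_mul, norm_pow, norm_neg, Complex.norm_I, one_pow, one_mul,
    one_mul, Complex.norm_real, Real.norm_of_nonneg ENNReal.toReal_nonneg]

lemma inner_greenVec_apply (h : ConvTree G hG o) (n m : ℕ) (v : V) :
    (inner ℂ (greenVec h n v) (greenVec h m v) : ℂ) =
      (((gE G n o v * gE G m o v).toReal : ℝ) : ℂ) := by
  rw [greenVec_apply, greenVec_apply, RCLike.inner_apply]
  simp only [map_mul, Complex.conj_I, map_pow, map_neg, Complex.conj_ofReal, neg_neg,
    ENNReal.toReal_mul]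
  have h1 : (-Complex.I) ^ G.dist o v * Complex.I ^ G.dist o v = 1 := by
    rw [← mul_pow]
    simp
  push_cast
  linear_combination (-(Complex.I * Complex.I) * (gE G m o v).toReal * (gE G n o v).toReal) * h1 -
    (gE G m o v).toReal * (gE G n o v).toReal * Complex.I_mul_I

open Classical in
/-- The sum over `S` of the products of the Green functions at two scales. -/
def greenSum (G : SimpleGraph V) (S : Set V) (n m : ℕ) (o : V) : ℝ≥0∞ :=
  ∑' v, if v ∈ S then gE G n o v * gE G m o v else 0

lemma greenSum_comm (S : Set V) (n m : ℕ) : greenSum G S n m o = greenSum G S m n o := by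
  simp only [greenSum, mul_comm]

lemma greenSum_mono {S S' : Set V} (h : S ⊆ S') (n m : ℕ) :
    greenSum G S n m o ≤ greenSum G S' n m o := by
  refine ENNReal.tsum_le_tsum fun v => ?_
  by_cases hv : v ∈ S
  · rw [if_pos hv, if_pos (h hv)]
  · rw [if_neg hv]
    exact zero_le

lemma greenSum_add_diff {S S' : Set V} (h : S ⊆ S') (n m : ℕ) :
    greenSum G S n m o + greenSum G (S' \ S) n m o = greenSum G S' n m o := by
  rw [greenSum, greenSum, ← ENNReal.tsum_add]
  refine tsum_congr fun v => ?_
  by_cases hv : v ∈ S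
  · simp [hv, h hv]
  · rw [if_neg hv, zero_add]
    by_cases hv' : v ∈ S'
    · rw [if_pos hv', if_pos ⟨hv', hv⟩]
    · rw [if_neg hv', if_neg fun e => hv' e.1]

lemma inner_ellRestrict_greenVec (h : ConvTree G hG o) (S : Set V) (n m : ℕ) :
    (inner ℂ (ellRestrict S (greenVec h n)) (ellRestrict S (greenVec h m)) : ℂ) =
      ((greenSum G S n m o).toReal : ℂ) ∧ greenSum G S n m o ≠ ∞ := by
  classical
  have h1 := lp.hasSum_inner (𝕜 := ℂ) (ellRestrict S (greenVec h n)) (ellRestrict S (greenVec h m))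
  have h2 : ∀ v, (inner ℂ (ellRestrict S (greenVec h n) v) (ellRestrict S (greenVec h m) v) : ℂ) =
      (((if v ∈ S then gE G n o v * gE G m o v else 0 : ℝ≥0∞).toReal : ℝ) : ℂ) := by
    intro v
    by_cases hv : v ∈ S
    · rw [ellRestrict_apply_of_mem hv, ellRestrict_apply_of_mem hv, if_pos hv,
        inner_greenVec_apply]
    · rw [ellRestrict_apply_of_notMem hv, ellRestrict_apply_of_notMem hv, if_neg hv]
      simp
  simp only [h2] at h1
  have h3 : ∀ v, (if v ∈ S then gE G n o v * gE G m o v else 0 : ℝ≥0∞) ≠ ∞ := by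
    intro v
    split_ifs
    · exact ENNReal.mul_ne_top (gE_ne_top _ _ _) (gE_ne_top _ _ _)
    · simp
  have h4 := Complex.summable_ofReal.1 h1.summable
  refine ⟨?_, ?_⟩
  · rw [← h1.tsum_eq, ← Complex.ofReal_tsum, greenSum, ENNReal.tsum_toReal_eq h3]
  · rw [greenSum, tsum_congr fun v => (ENNReal.ofReal_toReal (h3 v)).symm]
    exact h4.tsum_ofReal_ne_top

lemma ellRestrict_evenSet_basisVec :
    ellRestrict (evenSet G o) (basisVec o) = basisVec o ∧
      ellRestrict (evenSet G o)ᶜ (basisVec o) = 0 := by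
  classical
  have hb1 : ellRestrict (evenSet G o)ᶜ (basisVec o) = 0 := by
    ext v
    by_cases hv : v ∈ (evenSet G o)ᶜ
    · rw [ellRestrict_apply_of_mem hv, basisVec_apply, if_neg]
      · rfl
      · rintro rfl; exact hv (self_mem_evenSet _)
    · rw [ellRestrict_apply_of_notMem hv]; rfl
  refine ⟨?_, hb1⟩
  have := ellRestrict_add_compl (evenSet G o) (basisVec o)
  rwa [hb1, add_zero] at this

/-- Pairing the odd part of the equation at one scale with the even part at another gives a
resolvent identity in which the two parities carry separate weights. -/
lemma ConvTree.hE_eq (h : ConvTree G hG o) (n m : ℕ) :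
    hE G m o none = te n * greenSum G (evenSet G o) n m o +
      te m * greenSum G (evenSet G o)ᶜ n m o := by
  have h1 := (adjRel_greenVec h n).odd h.isTree o
  have h2 := (adjRel_greenVec h m).even h.isTree o
  rw [ellRestrict_add, ellRestrict_smul] at h1 h2
  rw [ellRestrict_evenSet_basisVec.1] at h1
  rw [ellRestrict_evenSet_basisVec.2, zero_add] at h2
  have h3 := h1.inner_adjRel h.ess h2
  obtain ⟨he, he'⟩ := inner_ellRestrict_greenVec h (evenSet G o) n m
  obtain ⟨hd, hd'⟩ := inner_ellRestrict_greenVec h (evenSet G o)ᶜ n m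
  rw [inner_add_left, inner_smul_left, inner_smul_right, he, hd, inner_basisVec_left,
    ellRestrict_apply_of_mem (self_mem_evenSet o), greenVec_self] at h3
  simp only [map_mul, Complex.conj_I, Complex.conj_ofReal] at h3
  have h4 : ((hE G m o none).toReal : ℂ) = tn n * (greenSum G (evenSet G o) n m o).toReal +
      tn m * (greenSum G (evenSet G o)ᶜ n m o).toReal := by
    apply mul_left_cancel₀ Complex.I_ne_zero
    linear_combination h3
  have h5 : (hE G m o none).toReal = tn n * (greenSum G (evenSet G o) n m o).toReal +
      tn m * (greenSum G (evenSet G o)ᶜ n m o).toReal := by exact_mod_cast h4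
  rw [← ENNReal.ofReal_toReal (hE_ne_top m o none), h5, ENNReal.ofReal_add
    (mul_nonneg (tn_pos n).le ENNReal.toReal_nonneg)
    (mul_nonneg (tn_pos m).le ENNReal.toReal_nonneg), ENNReal.ofReal_mul (tn_pos n).le,
    ENNReal.ofReal_mul (tn_pos m).le, ENNReal.ofReal_toReal he', ENNReal.ofReal_toReal hd']
  rfl

lemma greenSum_even_add_odd (n m : ℕ) :
    greenSum G (evenSet G o) n m o + greenSum G (evenSet G o)ᶜ n m o = greenSum G univ n m o := by
  rw [← greenSum_add_diff (subset_univ (evenSet G o)), compl_eq_univ_sdiff]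

lemma ConvTree.add_mul_greenSum (h : ConvTree G hG o) (n m : ℕ) :
    (te n + te m) * greenSum G univ n m o = hE G n o none + hE G m o none := by
  rw [h.hE_eq n m, h.hE_eq m n, ← greenSum_even_add_odd, greenSum_comm _ m n,
    greenSum_comm _ m n]
  ring

/-- With heights in ratio two, the even sums in the two identities from `ConvTree.hE_eq` cancel and
only the odd sum is left. This is the counterpart on the tree of `two_mul_poisson`. -/
lemma ConvTree.two_mul_hE (h : ConvTree G hG o) (n : ℕ) :
    2 * hE G n o none = hE G (n + 1) o none +
      3 * te (n + 1) * greenSum G (evenSet G o)ᶜ (n + 1) n o := by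
  rw [h.hE_eq (n + 1) n, h.hE_eq n (n + 1), te_eq n, greenSum_comm _ n (n + 1),
    greenSum_comm _ n (n + 1)]
  ring

lemma poisson_toReal (μ : Measure ℝ) [IsProbabilityMeasure μ] {t : ℝ} (ht : 0 < t) :
    poisson μ t = ENNReal.ofReal (∫ x : ℝ, 1 / ((x : ℂ) - Complex.I * t) ∂μ).im := by
  have hne : ∀ x : ℝ, ((x : ℂ) - Complex.I * t) ≠ 0 := by
    intro x hx
    have := congrArg Complex.im hx
    simp at this
    exact ht.ne' this
  have hcont : Continuous fun x : ℝ => 1 / ((x : ℂ) - Complex.I * t) :=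
    continuous_const.div (by fun_prop) hne
  have him : ∀ x : ℝ, (1 / ((x : ℂ) - Complex.I * t)).im = t / (x ^ 2 + t ^ 2) := by
    intro x
    rw [one_div, Complex.inv_im]
    simp [Complex.normSq_apply, pow_two]
  have hint : Integrable (fun x : ℝ => 1 / ((x : ℂ) - Complex.I * t)) μ := by
    refine Integrable.of_bound hcont.aestronglyMeasurable (1 / t) (Eventually.of_forall fun x => ?_)
    rw [norm_div, norm_one]
    refine one_div_le_one_div_of_le ht ?_
    refine le_trans ?_ (Complex.abs_im_le_norm _)
    simp [abs_of_pos ht]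
  have h1 : (∫ x : ℝ, 1 / ((x : ℂ) - Complex.I * t) ∂μ).im = ∫ x : ℝ, t / (x ^ 2 + t ^ 2) ∂μ := by
    have := integral_im (𝕜 := ℂ) hint
    simp only [RCLike.im_to_complex, him] at this
    exact this.symm
  have hint' : Integrable (fun x : ℝ => t / (x ^ 2 + t ^ 2)) μ := by
    have := hint.im
    simpa only [RCLike.im_to_complex, him] using this
  rw [h1, ofReal_integral_eq_lintegral_ofReal hint' (Eventually.of_forall fun x => by positivity)]
  rfl

lemma EssSelfAdj.isSpectralMeasure (hess : EssSelfAdj G hG) (o : V) :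
    IsSpectralMeasure G hG o (spectralMeasure G hG o) := by
  have h : EssSelfAdj G hG ∧ ∃ μ, IsSpectralMeasure G hG o μ :=
    ⟨hess, exists_isSpectralMeasure hess o⟩
  rw [spectralMeasure, dif_pos h]
  exact h.2.choose_spec

lemma ConvTree.poisson_spectralMeasure (h : ConvTree G hG o) (n : ℕ) :
    poisson (spectralMeasure G hG o) (tn n) = hE G n o none := by
  obtain ⟨h1, h2⟩ := h.ess.isSpectralMeasure o
  have ht := tn_pos n
  obtain ⟨ψ, h3, h4⟩ := h2 (Complex.I * tn n) (by simpa using ht.ne')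
  have h5 := (closRel_closure ψ).adjRel
  rw [sub_eq_iff_eq_add.1 h3] at h5
  have h6 := h.ess.resolvent_unique (by simpa using ht.ne') h5 (adjRel_greenVec h n)
  rw [poisson_toReal _ ht, ← h4, h6, inner_basisVec_left, greenVec_self]
  simp [ENNReal.ofReal_toReal (hE_ne_top n o none)]

lemma ConvTree.bInt_spectralMeasure (h : ConvTree G hG o) (n : ℕ) :
    bInt (spectralMeasure G hG o) n = greenSum G (evenSet G o)ᶜ (n + 1) n o := by
  have h1 := h.two_mul_hE n
  have := (h.ess.isSpectralMeasure o).1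
  rw [← h.poisson_spectralMeasure, ← h.poisson_spectralMeasure, two_mul_poisson] at h1
  have h2 : poisson (spectralMeasure G hG o) (tn (n + 1)) ≠ ∞ := by
    rw [h.poisson_spectralMeasure]; exact hE_ne_top _ _ _
  rw [ENNReal.add_right_inj h2] at h1
  exact (ENNReal.mul_right_inj (by simp [te_ne_zero])
    (by simp [ENNReal.mul_eq_top, te_ne_top])).1 h1

end Green

/-! ### Recursions for the quantities at zero -/

section Recursion

open Filter Topology

variable {V : Type*} {G : SimpleGraph V} {hG : ∀ v, (G.neighborSet v).Finite}

/-- An essentially self-adjoint tree on which all continued fractions converge. -/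
structure GoodTree (G : SimpleGraph V) (hG : ∀ v, (G.neighborSet v).Finite) : Prop where
  isTree : G.IsTree
  conv : ∀ n o, msgLo G (te n) o none = msgHi G (te n) o none

lemma GoodTree.ess (h : GoodTree G hG) : EssSelfAdj G hG :=
  essSelfAdj_of_msgLo_eq_msgHi h.isTree hG (tn_pos 0) fun o => h.conv 0 o

lemma GoodTree.root (h : GoodTree G hG) (o : V) : ConvTree G hG o := ⟨h.isTree, h.ess, (h.conv · o)⟩

lemma GoodTree.conv_some (h : GoodTree G hG) {x o : V} (hx : G.Adj o x) (n : ℕ) :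
    msgLo G (te n) x (some o) = msgHi G (te n) x (some o) :=
  msgLo_eq_msgHi_child hG (te_ne_zero n) (te_ne_top n) (h.conv n o) hx (by simp)

lemma GoodTree.branch (h : GoodTree G hG) {x o : V} (hx : G.Adj o x) :
    ConvTree (branch G x o) (branch_locFin G hG x o) ⟨x, mem_branchSet G hx⟩ where
  isTree := IsTree.branch h.isTree hx
  ess := h.ess.branch h.isTree (tn_pos 0) (h.conv 0 o) hx
  conv n := by
    rw [IsTree.msgLo_branch_none h.isTree hx, IsTree.msgHi_branch_none h.isTree hx, h.conv_some hx]

lemma hE_branch (h : GoodTree G hG) {x o : V} (hx : G.Adj o x) (n : ℕ) :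
    hE (branch G x o) n ⟨x, mem_branchSet G hx⟩ none = hE G n x (some o) :=
  IsTree.msgLo_branch_none h.isTree hx _

lemma gE_branch (h : GoodTree G hG) {x o : V} (hx : G.Adj o x) (n : ℕ) (v : branchSet G x o) :
    gE (branch G x o) n ⟨x, mem_branchSet G hx⟩ v =
      hE G n x (some o) * pathProd G (fun v u => hE G n v (some u)) x v := by
  rw [gE, hE_branch h hx, IsTree.pathProd_branch h.isTree hx]
  intro u v hu hd
  exact IsTree.msgLo_branch_some h.isTree hx _ hu hd

/-- `p` is empty or a neighbour of `x`. -/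
def IsDart (G : SimpleGraph V) (x : V) (p : Option V) : Prop := ∀ o, p = some o → G.Adj o x

lemma isDart_none (x : V) : IsDart G x none := fun _ h => by simp at h

lemma isDart_some {x o : V} (h : G.Adj o x) : IsDart G x (some o) := by
  rintro _ ⟨⟩
  exact h

lemma GoodTree.hE_rec (h : GoodTree G hG) (x : V) (p : Option V) (n : ℕ) :
    hE G n x p = (te n + nbrSum G x p fun y => hE G n y (some x))⁻¹ := by
  rw [hE, msgLo_eq hG]
  congr 2
  exact nbrSum_congr fun y hy _ => (h.conv_some hy n).symm

lemma GoodTree.hE_mul_comm (h : GoodTree G hG) {u v : V} (huv : G.Adj u v) (n : ℕ) :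
    hE G n u none * hE G n v (some u) = hE G n v none * hE G n u (some v) := by
  have h1 := msgHi_mul_msgLo (t := te n) hG huv
  have h2 := msgLo_mul_msgHi hG (te_ne_zero n) (te_ne_top n) huv.symm
  rw [← h.conv, ← h.conv_some huv.symm] at h1
  rw [← h.conv_some huv.symm] at h2
  simp only [hE]
  rw [h1, h2, mul_inv_inv_add_comm]
  · exact hE_ne_zero hG _ _ _
  · exact hE_ne_top _ _ _
  · exact hE_ne_zero hG _ _ _
  · exact hE_ne_top _ _ _

/-- The root factor can be moved across one edge at a time by `GoodTree.hE_mul_comm`. -/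
lemma GoodTree.gE_symm (h : GoodTree G hG) (n : ℕ) (o v : V) : gE G n o v = gE G n v o := by
  have hT := h.isTree
  refine dist_induction (p := fun w => gE G n v w = gE G n w v) hT.connected v rfl ?_ o |>.symm
  intro u w hu hd ih
  have h1 : gE G n v w = gE G n v u * hE G n w (some u) := by
    rw [gE, gE, IsTree.pathProd_succ hT _ hu hd, mul_assoc]
  have h2 : gE G n w v = gE G n u v * hE G n w (some u) := by
    have h3 : G.dist w v = G.dist w u + G.dist u v := by
      rw [SimpleGraph.dist_comm (u := w) (v := v), hd, SimpleGraph.dist_comm (u := v),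
        SimpleGraph.dist_eq_one_iff_adj.2 hu.symm, add_comm]
    rw [gE, gE, IsTree.pathProd_mul hT _ h3, IsTree.pathProd_adj hT _ hu.symm, ← mul_assoc,
      ← h.hE_mul_comm hu]
    ring
  rw [h1, h2, ih]

/-- The measurable version of `α`. -/
def aE (G : SimpleGraph V) (x : V) (p : Option V) : ℝ≥0∞ :=
  liminf (fun n => te n * hE G n x p) atTop

/-- The measurable version of `β`. -/
def bE (G : SimpleGraph V) (x : V) (p : Option V) : ℝ≥0∞ :=
  liminf (fun n => hE G n x p / te n) atTop

/-- The approximations of `β⋆`. -/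
def cE (G : SimpleGraph V) (n : ℕ) (x : V) (p : Option V) : ℝ≥0∞ :=
  (2 * hE G n x p - hE G (n + 1) x p) / (3 * te (n + 1))

variable {x : V} {p : Option V}

section Measure

variable {μ : Measure ℝ}

lemma tendsto_te_mul_hE [IsFiniteMeasure μ] (h : ∀ n, poisson μ (tn n) = hE G n x p) :
    Tendsto (fun n => te n * hE G n x p) atTop (𝓝 (alpha μ)) := by
  simpa only [h] using tendsto_mul_poisson μ

lemma alpha_eq_aE [IsFiniteMeasure μ] (h : ∀ n, poisson μ (tn n) = hE G n x p) :
    alpha μ = aE G x p := (tendsto_te_mul_hE h).liminf_eq.symm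

lemma beta_eq_bE (h : ∀ n, poisson μ (tn n) = hE G n x p) : beta μ = bE G x p := by
  have := (tendsto_poisson_div μ).1.liminf_eq
  simp only [h] at this
  exact this.symm

lemma bInt_eq_cE [IsFiniteMeasure μ] (h : ∀ n, poisson μ (tn n) = hE G n x p) (n : ℕ) :
    bInt μ n = cE G n x p := by
  rw [bInt_eq, h, h, cE]

end Measure

lemma GoodTree.poisson_root (h : GoodTree G hG) (o : V) (n : ℕ) :
    poisson (spectralMeasure G hG o) (tn n) = hE G n o none := (h.root o).poisson_spectralMeasure n

lemma GoodTree.poisson_branch (h : GoodTree G hG) {x o : V} (hx : G.Adj o x) (n : ℕ) :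
    poisson (spectralMeasure (AtomAtZero.branch G x o) (branch_locFin G hG x o)
      ⟨x, mem_branchSet G hx⟩) (tn n) = hE G n x (some o) := by
  rw [(h.branch hx).poisson_spectralMeasure, hE_branch h hx]

lemma GoodTree.exists_measure (h : GoodTree G hG) (hp : IsDart G x p) :
    ∃ μ : Measure ℝ, IsProbabilityMeasure μ ∧ ∀ n, poisson μ (tn n) = hE G n x p := by
  cases p with
  | none => exact ⟨_, (h.ess.isSpectralMeasure x).1, h.poisson_root x⟩
  | some o =>
    exact ⟨_, ((h.branch (hp o rfl)).ess.isSpectralMeasure _).1, h.poisson_branch (hp o rfl)⟩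

lemma GoodTree.tendsto_aE (h : GoodTree G hG) (hp : IsDart G x p) :
    Tendsto (fun n => te n * hE G n x p) atTop (𝓝 (aE G x p)) := by
  obtain ⟨μ, hμ, h1⟩ := h.exists_measure hp
  rw [← alpha_eq_aE h1]
  exact tendsto_te_mul_hE h1

lemma GoodTree.aE_le_one (h : GoodTree G hG) (hp : IsDart G x p) : aE G x p ≤ 1 := by
  obtain ⟨μ, hμ, h1⟩ := h.exists_measure hp
  rw [← alpha_eq_aE h1]
  exact prob_le_one

lemma GoodTree.tendsto_bE (h : GoodTree G hG) (hp : IsDart G x p) :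
    Tendsto (fun n => hE G n x p / te n) atTop (𝓝 (bE G x p)) := by
  obtain ⟨μ, hμ, h1⟩ := h.exists_measure hp
  rw [← beta_eq_bE h1]
  simpa only [h1] using (tendsto_poisson_div μ).1

lemma GoodTree.monotone_hE_div (h : GoodTree G hG) (hp : IsDart G x p) :
    Monotone fun n => hE G n x p / te n := by
  obtain ⟨μ, hμ, h1⟩ := h.exists_measure hp
  simpa only [h1] using (tendsto_poisson_div μ).2

lemma GoodTree.hE_le (h : GoodTree G hG) (hp : IsDart G x p) (n : ℕ) :
    hE G n x p ≤ te n * bE G x p := by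
  have h1 := (h.monotone_hE_div hp).ge_of_tendsto (h.tendsto_bE hp) n
  rwa [ENNReal.div_le_iff (te_ne_zero n) (te_ne_top n), mul_comm] at h1

lemma GoodTree.cE_le (h : GoodTree G hG) (hp : IsDart G x p) (n : ℕ) : cE G n x p ≤ bE G x p := by
  obtain ⟨μ, hμ, h1⟩ := h.exists_measure hp
  rw [← beta_eq_bE h1, ← bInt_eq_cE h1]
  exact ((tendsto_bInt μ).2.ge_of_tendsto (tendsto_bInt μ).1 n).trans (betaStar_le_beta μ)

lemma GoodTree.tendsto_cE (h : GoodTree G hG) (hp : IsDart G x p) (h0 : aE G x p = 0) :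
    Tendsto (fun n => cE G n x p) atTop (𝓝 (bE G x p)) := by
  obtain ⟨μ, hμ, h1⟩ := h.exists_measure hp
  rw [← alpha_eq_aE h1] at h0
  rw [← beta_eq_bE h1, ← betaStar_eq_beta μ h0]
  simpa only [bInt_eq_cE h1] using (tendsto_bInt μ).1

lemma GoodTree.aE_eq_zero (h : GoodTree G hG) (hp : IsDart G x p) (hb : bE G x p ≠ ∞) :
    aE G x p = 0 := by
  obtain ⟨μ, hμ, h1⟩ := h.exists_measure hp
  rw [← beta_eq_bE h1] at hb
  rw [← alpha_eq_aE h1]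
  exact alpha_eq_zero_of_beta_ne_top μ hb

/-- Multiplying the recursion by `t` leaves a sum of the ratios `h / t`, which converge to `β`.
Dividing it by `t` instead gives `GoodTree.bE_rec`. -/
lemma GoodTree.aE_rec (h : GoodTree G hG) (hp : IsDart G x p) :
    aE G x p = (1 + nbrSum G x p fun y => bE G y (some x))⁻¹ := by
  refine tendsto_nhds_unique (h.tendsto_aE hp) ?_
  have h1 : ∀ n, te n * hE G n x p = (1 + nbrSum G x p fun y => hE G n y (some x) / te n)⁻¹ := by
    intro n
    have h2 : te n + nbrSum G x p (fun y => hE G n y (some x)) =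
        te n * (1 + nbrSum G x p fun y => hE G n y (some x) / te n) := by
      rw [mul_add, mul_one, mul_nbrSum]
      congr 2
      funext y
      rw [ENNReal.mul_div_cancel (te_ne_zero n) (te_ne_top n)]
    rw [h.hE_rec, h2, ENNReal.mul_inv (Or.inl (te_ne_zero n)) (Or.inl (te_ne_top n)), ← mul_assoc,
      ENNReal.mul_inv_cancel (te_ne_zero n) (te_ne_top n), one_mul]
  simp only [h1]
  refine tendsto_inv_iff.2 (tendsto_const_nhds.add (tendsto_nbrSum hG fun y hy _ => ?_))
  exact h.tendsto_bE (isDart_some hy)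

lemma GoodTree.bE_rec (h : GoodTree G hG) (hp : IsDart G x p) :
    bE G x p = (nbrSum G x p fun y => aE G y (some x))⁻¹ := by
  refine tendsto_nhds_unique (h.tendsto_bE hp) ?_
  have h1 : ∀ n, hE G n x p / te n =
      (te n * te n + nbrSum G x p fun y => te n * hE G n y (some x))⁻¹ := by
    intro n
    rw [h.hE_rec, ENNReal.div_eq_inv_mul, ← ENNReal.mul_inv (Or.inl (te_ne_zero n))
      (Or.inl (te_ne_top n)), mul_add, mul_nbrSum]
  simp only [h1]
  refine tendsto_inv_iff.2 ?_
  have h2 : Tendsto (fun n => te n * te n) atTop (𝓝 0) := by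
    have := ENNReal.Tendsto.mul tendsto_te (Or.inr ENNReal.zero_ne_top) tendsto_te
      (Or.inr ENNReal.zero_ne_top)
    rwa [zero_mul] at this
  have h3 := h2.add (tendsto_nbrSum hG (x := x) (o := p)
    (F := fun n y => te n * hE G n y (some x)) fun y hy _ => h.tendsto_aE (isDart_some hy))
  rwa [zero_add] at h3

lemma GoodTree.bE_ne_zero (h : GoodTree G hG) (hp : IsDart G x p) : bE G x p ≠ 0 := by
  classical
  rw [h.bE_rec hp]
  refine ENNReal.inv_ne_zero.2 ?_
  rw [nbrSum_congr (F' := fun y => if G.Adj x y then aE G y (some x) else 0)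
    fun y hy _ => by rw [if_pos hy]]
  refine nbrSum_ne_top hG fun y => ?_
  split_ifs with hy
  · exact ne_top_of_le_ne_top ENNReal.one_ne_top (h.aE_le_one (isDart_some hy))
  · simp

lemma le_nbrSum {o : Option V} {y : V} (h : G.Adj x y) (ho : o ≠ some y) (F : V → ℝ≥0∞) :
    F y ≤ nbrSum G x o F := by
  classical
  refine le_trans ?_ (ENNReal.le_tsum y)
  rw [if_pos (And.intro h ho)]

lemma nbrSum_eq_zero {o : Option V} {F : V → ℝ≥0∞} :
    nbrSum G x o F = 0 ↔ ∀ y, G.Adj x y → o ≠ some y → F y = 0 := by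
  classical
  rw [nbrSum, ENNReal.tsum_eq_zero]
  refine forall_congr' fun y => ?_
  rw [ite_eq_right_iff, and_imp]

lemma nbrSum_some_le {y : V} (F : V → ℝ≥0∞) : nbrSum G x (some y) F ≤ nbrSum G x none F := by
  refine ENNReal.tsum_le_tsum fun z => ?_
  split_ifs <;> simp_all

/-! ### Vertices with two branches of positive mass. -/

variable {u o : V}

/-- Two neighbours have a branch with a positive mass at zero. -/
def Crowded (G : SimpleGraph V) (o : V) : Prop :=
  ∃ y z, G.Adj o y ∧ G.Adj o z ∧ y ≠ z ∧ aE G y (some o) ≠ 0 ∧ aE G z (some o) ≠ 0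

lemma GoodTree.bE_ne_top_of_aE_ne_zero (h : GoodTree G hG) (hu : aE G u none ≠ 0)
    (ho : G.Adj u o) : bE G o (some u) ≠ ∞ := by
  rw [h.aE_rec (isDart_none u), ENNReal.inv_ne_zero] at hu
  refine ne_top_of_le_ne_top hu (le_trans ?_ le_add_self)
  exact le_nbrSum ho (by simp) fun y => bE G y (some u)

lemma GoodTree.aE_some_ne_zero (h : GoodTree G hG) (hu : aE G u none ≠ 0) (ho : G.Adj o u) :
    aE G u (some o) ≠ 0 := by
  rw [h.aE_rec (isDart_none u), ENNReal.inv_ne_zero] at hu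
  rw [h.aE_rec (isDart_some ho), ENNReal.inv_ne_zero]
  refine ne_top_of_le_ne_top hu ?_
  gcongr
  exact nbrSum_some_le _

/-- Positive mass at `u` forces `β_{o → u}` to be finite, hence some branch at `o` other than that
of `u` has mass. The branch of `u` has mass as well, since removing a neighbour only increases `α`.
-/
lemma GoodTree.crowded_of_adj (h : GoodTree G hG) (hu : aE G u none ≠ 0) (ho : G.Adj u o) :
    Crowded G o := by
  have h1 := h.bE_ne_top_of_aE_ne_zero hu ho
  rw [h.bE_rec (isDart_some ho), ENNReal.inv_ne_top, Ne, nbrSum_eq_zero] at h1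
  push Not at h1
  obtain ⟨y, hy, hyu, hy0⟩ := h1
  exact ⟨u, y, ho.symm, hy, fun e => hyu (by rw [e]), h.aE_some_ne_zero hu ho.symm, hy0⟩

/-- Of two massive branches at least one remains when a neighbour is removed, so the denominator in
the recursion stays positive. -/
lemma GoodTree.bE_ne_top_of_crowded (h : GoodTree G hG) (ho : Crowded G o) (hp : IsDart G o p) :
    bE G o p ≠ ∞ := by
  obtain ⟨y, z, hy, hz, hyz, hy0, hz0⟩ := ho
  rw [h.bE_rec hp, ENNReal.inv_ne_top, Ne, nbrSum_eq_zero]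
  intro h1
  by_cases hp' : p = some y
  · exact hz0 (h1 z hz fun e => hyz (Option.some.inj (hp'.symm.trans e)))
  · exact hy0 (h1 y hy hp')

/-- Deleting `o` removes one term from the denominator of `α_x`, and that term is finite. Global and
branch conditions on the mass at `x` thus coincide. -/
lemma GoodTree.aE_eq_zero_iff_of_crowded (h : GoodTree G hG) (ho : Crowded G o) (hx : G.Adj o x) :
    aE G x none = 0 ↔ aE G x (some o) = 0 := by
  refine ⟨fun h1 => ?_, fun h1 => ?_⟩
  · rw [h.aE_rec (isDart_none x), ENNReal.inv_eq_zero, nbrSum_none_eq_add hx.symm, ← add_assoc,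
      ENNReal.add_eq_top] at h1
    rw [h.aE_rec (isDart_some hx), ENNReal.inv_eq_zero]
    exact h1.resolve_right (h.bE_ne_top_of_crowded ho (isDart_some hx.symm))
  · by_contra h0
    exact h.aE_some_ne_zero h0 hx h1

end Recursion

/-! ### Chains and the outgoing mass -/

section Chains

open Filter Topology

variable {V : Type*} {G : SimpleGraph V} {hG : ∀ v, (G.neighborSet v).Finite} {Q : V → Prop}
  {r u v p x : V}

/-- All the vertices between `r` and `v` satisfy `Q`. -/
def Chain (G : SimpleGraph V) (Q : V → Prop) (r v : V) : Prop :=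
  ∀ u, G.dist r v = G.dist r u + G.dist u v → Q u

lemma Chain.left (h : Chain G Q r v) : Q r := h r (by simp)

lemma Chain.right (h : Chain G Q r v) : Q v := h v (by simp)

lemma chain_self (hG : G.Connected) : Chain G Q r r ↔ Q r := by
  refine ⟨Chain.left, fun h u hu => ?_⟩
  rw [SimpleGraph.dist_self] at hu
  rwa [← hG.dist_eq_zero_iff.1 (show G.dist r u = 0 by omega)]

lemma chain_congr {Q' : V → Prop}
    (h : ∀ u, G.dist r v = G.dist r u + G.dist u v → (Q u ↔ Q' u)) :
    Chain G Q r v ↔ Chain G Q' r v :=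
  ⟨fun h1 u hu => (h u hu).1 (h1 u hu), fun h1 u hu => (h u hu).2 (h1 u hu)⟩

lemma Chain.symm (h : Chain G Q r v) : Chain G Q v r := fun u hu => h u (by
  rw [SimpleGraph.dist_comm, hu, SimpleGraph.dist_comm (u := r), SimpleGraph.dist_comm (u := v),
    add_comm])

lemma chain_comm : Chain G Q r v ↔ Chain G Q v r := ⟨Chain.symm, Chain.symm⟩

lemma IsTree.chain_succ (hT : G.IsTree) (hu : G.Adj u v) (hd : G.dist r v = G.dist r u + 1) :
    Chain G Q r v ↔ Chain G Q r u ∧ Q v := by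
  have hconn := hT.connected
  constructor
  · refine fun h => ⟨fun z hz => h z ?_, h.right⟩
    have h1 := dist_le_succ_of_adj hconn z hu
    have h2 := hconn.dist_triangle (u := r) (v := z) (w := v)
    omega
  · rintro ⟨h, hv⟩ z hz
    by_cases hzv : v = z
    · rwa [← hzv]
    · obtain ⟨w, hw, hw'⟩ := exists_parent hconn hzv
      have h1 := hconn.dist_triangle (u := r) (v := z) (w := w)
      have h2 := dist_le_succ_of_adj hconn r hw
      obtain rfl := IsTree.eq_of_dist_succ hT hw hu (by omega) hd
      exact h z (by omega)

/-- `x` is a neighbour of `p`, further away from `r`. -/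
def IsChild (G : SimpleGraph V) (r p x : V) : Prop := G.Adj p x ∧ G.dist r x = G.dist r p + 1

lemma IsTree.dist_eq_add_of_isChild (hT : G.IsTree) (h : IsChild G r p x)
    (hv : v ∈ branchSet G x p) : G.dist r v = G.dist r x + G.dist x v :=
  IsTree.dist_eq_of_mem_branchSet hT h.1 h.2 ((IsTree.mem_branchSet_iff hT h.1 v).1 hv)

lemma IsTree.mem_branchSet_child_iff (hT : G.IsTree) (h : IsChild G r p x) (hu : IsChild G r u v) :
    v ∈ branchSet G x p ↔ u ∈ branchSet G x p ∨ (p = u ∧ x = v) := by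
  constructor
  · intro hv
    by_cases hup : u = p
    · subst hup
      exact Or.inr ⟨rfl, (IsTree.eq_of_adj_of_mem_branchSet hT h.1 hv hu.1.symm).symm⟩
    · exact Or.inl (mem_branchSet_of_adj hv hu.1.symm hup)
  · rintro (h1 | ⟨rfl, rfl⟩)
    · refine mem_branchSet_of_adj h1 hu.1 ?_
      rintro rfl
      have h2 := IsTree.dist_eq_add_of_isChild hT h h1
      have h3 := h.2
      have h4 := hu.2
      omega
    · exact mem_branchSet G hu.1

open Classical in
/-- The indicator that the chain condition fails for the first time at `x`, on the path from `r` to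
`v`, where `p` is the parent of `x`. -/
def exitInd (G : SimpleGraph V) (Q : V → Prop) (r v p x : V) : ℝ≥0∞ :=
  if IsChild G r p x ∧ Chain G Q r p ∧ ¬ Q x ∧ v ∈ branchSet G x p then 1 else 0

open Classical in
-- A path either satisfies the condition throughout or has a unique first failure.
lemma IsTree.chain_add_exit (hT : G.IsTree) (hQ : Q r) (v : V) :
    (if Chain G Q r v then (1 : ℝ≥0∞) else 0) + ∑' p, ∑' x, exitInd G Q r v p x = 1 := by
  refine dist_induction (p := fun v => (if Chain G Q r v then (1 : ℝ≥0∞) else 0) +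
    ∑' p, ∑' x, exitInd G Q r v p x = 1) hT.connected r ?_ ?_ v
  · rw [if_pos ((chain_self hT.connected).2 hQ)]
    have : ∀ p x, exitInd G Q r r p x = 0 := by
      intro p x
      refine if_neg ?_
      rintro ⟨h1, -, -, h2⟩
      have := IsTree.dist_eq_add_of_isChild hT h1 h2
      have := h1.2
      rw [SimpleGraph.dist_self] at *
      omega
    simp [this]
  · intro u v hu hd ih
    have hc : IsChild G r u v := ⟨hu, hd⟩
    set K : ℝ≥0∞ := if Chain G Q r u ∧ ¬ Q v then 1 else 0 with hK
    -- Extending the path from `u` to `v` can create only one new exit, the edge from `u` to `v`,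
    -- and only if no earlier failure occurred.
    have h1 : ∀ p x, exitInd G Q r v p x =
        exitInd G Q r u p x + if p = u then (if x = v then K else 0) else 0 := by
      intro p x
      by_cases h2 : IsChild G r p x
      · by_cases h3 : p = u ∧ x = v
        · obtain ⟨rfl, rfl⟩ := h3
          have h4 := notMem_branchSet (G := G) x p
          have h5 := mem_branchSet G hu
          simp [exitInd, h2, h4, h5, hK]
        · have h4 : v ∈ branchSet G x p ↔ u ∈ branchSet G x p := by
            rw [IsTree.mem_branchSet_child_iff hT h2 hc]
            tauto
          have h5 : (if p = u then (if x = v then K else 0) else 0) = 0 := by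
            split_ifs <;> tauto
          simp only [exitInd, h4, h5, add_zero]
      · have h5 : (if p = u then (if x = v then K else 0) else 0) = 0 := by
          split_ifs with h6 h7
          · subst h6 h7
            exact absurd hc h2
          · rfl
          · rfl
        simp [exitInd, h2, h5]
    simp only [h1, ENNReal.tsum_add]
    rw [tsum_congr (f := fun p => ∑' x, if p = u then (if x = v then K else 0) else 0)
      (g := fun p => if p = u then K else 0), tsum_ite_eq]
    · refine Eq.trans ?_ ih
      rw [add_comm (∑' p, ∑' x, exitInd G Q r u p x), ← add_assoc]
      congr 1
      rw [hK, IsTree.chain_succ hT hu hd]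
      by_cases h2 : Chain G Q r u <;> by_cases h3 : Q v <;> simp [h2, h3]
    · intro p
      split_ifs with h2
      · exact tsum_ite_eq v _
      · simp

/-- The condition that defines the chains from `w`: the vertices at even distance carry mass. -/
def EvenMass (G : SimpleGraph V) (w u : V) : Prop := Even (G.dist w u) → aE G u none ≠ 0

/-- The product of the Green functions at two consecutive scales. -/
def gg (G : SimpleGraph V) (n : ℕ) (w v : V) : ℝ≥0∞ := gE G (n + 1) w v * gE G n w v

open Classical in
/-- The contribution of the dead branches around `o`. -/
def deadSum (G : SimpleGraph V) (n : ℕ) (o : V) : ℝ≥0∞ :=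
  1 + nbrSum G o none fun x => if aE G x none = 0 then cE G n x (some o) else 0

lemma ConvTree.odd_greenSum {o : V} (h : ConvTree G hG o) (n : ℕ) :
    greenSum G (evenSet G o)ᶜ (n + 1) n o = cE G n o none := by
  have := (h.ess.isSpectralMeasure o).1
  rw [← h.bInt_spectralMeasure, bInt_eq_cE h.poisson_spectralMeasure]

open Classical in
-- The Green function factors at the edge entering the branch. As `x` is even from `w`, the selected
-- vertices are those at odd distance from `x`, and they give the approximation of `β⋆` for the
-- branch.
lemma GoodTree.tsum_branch (h : GoodTree G hG) {w : V} (hx : IsChild G w p x)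
    (hp : ¬ Even (G.dist w p)) (n : ℕ) :
    ∑' v, (if ¬ Even (G.dist w v) ∧ v ∈ branchSet G x p then gg G n w v else 0) =
      gg G n w p * cE G n x (some p) := by
  have hT := h.isTree
  have h1 : cE G n x (some p) = cE (AtomAtZero.branch G x p) n ⟨x, mem_branchSet G hx.1⟩ none := by
    simp only [cE, hE_branch h hx.1]
  rw [h1, ← (h.branch hx.1).odd_greenSum, greenSum, ← ENNReal.tsum_mul_left,
    ← tsum_subtype_eq_of_support_subset (s := branchSet G x p)]
  · refine tsum_congr fun v => ?_
    have h2 := IsTree.dist_eq_add_of_isChild hT hx v.2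
    have h3 : v ∈ (evenSet (AtomAtZero.branch G x p) ⟨x, mem_branchSet G hx.1⟩)ᶜ ↔
        ¬ Even (G.dist w v) := by
      rw [mem_compl_iff, evenSet, Set.mem_ofPred_eq, IsTree.branch_dist hT hx.1, h2, hx.2]
      simp only [Nat.even_add, Nat.even_add_one]
      tauto
    by_cases h4 : Even (G.dist w v)
    · rw [if_neg (fun e => e.1 h4), if_neg (fun e => h3.1 e h4), mul_zero]
    · rw [if_pos ⟨h4, v.2⟩, if_pos (h3.2 h4), gE_branch h hx.1, gE_branch h hx.1, gg, gg]
      have h5 : ∀ m, gE G m w v = gE G m w p *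
          (hE G m x (some p) * pathProd G (fun v u => hE G m v (some u)) x v) := by
        intro m
        rw [gE, gE, IsTree.pathProd_mul hT _ h2, IsTree.pathProd_succ hT _ hx.1 hx.2]
        ring
      rw [h5, h5]
      ring
  · intro v hv
    by_contra hv'
    exact hv (if_neg fun e => hv' e.2)

open Classical in
/-- The mass which is sent from `w` to `o`. -/
def transport (G : SimpleGraph V) (n : ℕ) (w o : V) : ℝ≥0∞ :=
  if ¬ Even (G.dist w o) ∧ Chain G (EvenMass G w) w o then gg G n w o * deadSum G n o else 0

open Classical in
-- Nothing is lost in the distribution: each term of the odd sum is delivered exactly once, to its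
-- own vertex or to the predecessor of the first vertex failing the condition.
lemma GoodTree.tsum_transport (h : GoodTree G hG) {w : V} (hw : aE G w none ≠ 0) (n : ℕ) :
    ∑' o, transport G n w o = cE G n w none := by
  have hT := h.isTree
  have hQ : EvenMass G w w := fun _ => hw
  rw [← (h.root w).odd_greenSum, greenSum]
  symm
  trans ∑' v, ((if ¬ Even (G.dist w v) ∧ Chain G (EvenMass G w) w v then gg G n w v else 0) +
      ∑' p, ∑' x, exitInd G (EvenMass G w) w v p x *
        (if ¬ Even (G.dist w v) then gg G n w v else 0))
  · refine tsum_congr fun v => ?_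
    simp only [ENNReal.tsum_mul_right]
    have h2 := IsTree.chain_add_exit hT hQ v
    by_cases hv : Even (G.dist w v)
    · rw [if_neg fun e => e hv, if_neg fun e => e.1 hv, if_neg fun e => e hv]
      simp
    · rw [if_pos (show v ∈ (evenSet G w)ᶜ from hv), if_pos (show ¬ Even (G.dist w v) from hv)]
      calc gE G (n + 1) w v * gE G n w v = 1 * gg G n w v := (one_mul _).symm
        _ = _ := by
          rw [← h2, add_mul]
          congr 1
          by_cases h3 : Chain G (EvenMass G w) w v
          · rw [if_pos h3, if_pos ⟨hv, h3⟩, one_mul]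
          · rw [if_neg h3, if_neg fun e => h3 e.2, zero_mul]
  rw [ENNReal.tsum_add, ENNReal.tsum_comm, ← ENNReal.tsum_add]
  refine tsum_congr fun p => ?_
  rw [ENNReal.tsum_comm]
  have h2 : ∀ x, ∑' v, exitInd G (EvenMass G w) w v p x *
      (if ¬ Even (G.dist w v) then gg G n w v else 0) =
      if IsChild G w p x ∧ Chain G (EvenMass G w) w p ∧ ¬ EvenMass G w x then
        gg G n w p * cE G n x (some p) else 0 := by
    intro x
    split_ifs with h3
    · have hp : ¬ Even (G.dist w p) := by
        intro e
        apply h3.2.2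
        intro e'
        rw [h3.1.2, Nat.even_add_one] at e'
        exact absurd e e'
      rw [← h.tsum_branch h3.1 hp]
      refine tsum_congr fun v => ?_
      by_cases h4 : v ∈ branchSet G x p
      · simp [exitInd, h3, h4]
      · simp [exitInd, h4]
    · rw [ENNReal.tsum_eq_zero]
      intro v
      rw [exitInd, if_neg, zero_mul]
      tauto
  simp only [h2]
  by_cases hp : ¬ Even (G.dist w p) ∧ Chain G (EvenMass G w) w p
  · rw [transport, if_pos hp, if_pos hp, deadSum, mul_add, mul_one, nbrSum, ← ENNReal.tsum_mul_left]
    congr 1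
    refine tsum_congr fun x => ?_
    -- A massless neighbour of `p` automatically points away from `w`, since otherwise it would lie
    -- on the chain. This makes the redirected mass depend on `w` only through `gg`.
    have h3 : (IsChild G w p x ∧ Chain G (EvenMass G w) w p ∧ ¬ EvenMass G w x) ↔
        G.Adj p x ∧ aE G x none = 0 := by
      constructor
      · rintro ⟨h4, -, h5⟩
        refine ⟨h4.1, ?_⟩
        rw [EvenMass] at h5
        tauto
      · rintro ⟨h4, h5⟩
        have h6 : ¬ EvenMass G w x := by
          intro e
          refine e ?_ h5
          rcases hT.dist_eq_dist_add_one_of_adj w h4 with h7 | h7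
          · rw [h7, Nat.even_add_one] at hp
            exact not_not.1 hp.1
          · rw [h7, Nat.even_add_one]
            exact hp.1
        refine ⟨⟨h4, ?_⟩, hp.2, h6⟩
        rcases hT.dist_eq_dist_add_one_of_adj w h4 with h7 | h7
        · exact absurd (hp.2 x (by rw [h7, SimpleGraph.dist_eq_one_iff_adj.2 h4.symm])) h6
        · exact h7
    by_cases h4 : G.Adj p x
    · by_cases h5 : aE G x none = 0
      · rw [if_pos (h3.2 ⟨h4, h5⟩), if_pos ⟨h4, by simp⟩, if_pos h5]
      · rw [if_neg fun e => h5 (h3.1 e).2, if_pos ⟨h4, by simp⟩, if_neg h5, mul_zero]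
    · rw [if_neg fun e => h4 (h3.1 e).1, if_neg fun e => h4 e.1, mul_zero]
  · rw [transport, if_neg hp, if_neg hp, zero_add, ENNReal.tsum_eq_zero]
    intro x
    refine if_neg ?_
    rintro ⟨h3, h4, h5⟩
    refine hp ⟨fun e => h5 fun e' => ?_, h4⟩
    rw [h3.2, Nat.even_add_one] at e'
    exact absurd e e'

lemma transport_eq_zero {w : V} (hw : aE G w none = 0) (n : ℕ) (o : V) : transport G n w o = 0 := by
  classical
  rw [transport, if_neg]
  rintro ⟨-, h⟩
  exact h.left (by simp) hw

end Chains

/-! ### The incoming mass -/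

section Incoming

open Filter Topology

variable {V : Type*} {G : SimpleGraph V} {hG : ∀ v, (G.neighborSet v).Finite} {o w x : V}

lemma norm_ellRestrict_le (S : Set V) (ψ : ell2 V) : ‖ellRestrict S ψ‖ ≤ ‖ψ‖ := by
  have h1 := inner_ellRestrict_ellRestrict S ψ ψ
  have h2 := norm_inner_le_norm (𝕜 := ℂ) (ellRestrict S ψ) ψ
  rw [← h1, inner_self_eq_norm_sq_to_K, norm_pow, RCLike.norm_ofReal, abs_norm, pow_two] at h2
  by_cases h0 : ‖ellRestrict S ψ‖ = 0
  · rw [h0]; exact norm_nonneg _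
  · exact le_of_mul_le_mul_left h2 (lt_of_le_of_ne (norm_nonneg _) (Ne.symm h0))

lemma ellRestrict_sub_of_eq_zero {S : Set V} {φ : ell2 V} (h : ∀ v ∈ S, φ v = 0) (ψ : ell2 V) :
    ellRestrict S (ψ - φ) = ellRestrict S ψ := by
  ext v
  by_cases hv : v ∈ S
  · rw [ellRestrict_apply_of_mem hv, ellRestrict_apply_of_mem hv, ell2_sub_apply, h v hv, sub_zero]
  · rw [ellRestrict_apply_of_notMem hv, ellRestrict_apply_of_notMem hv]

lemma inner_greenVec (h : ConvTree G hG o) (n m : ℕ) :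
    (inner ℂ (greenVec h n) (greenVec h m) : ℂ) =
      ((((hE G n o none).toReal + (hE G m o none).toReal) / (tn n + tn m) : ℝ) : ℂ) := by
  have h1 := inner_ellRestrict_greenVec h univ n m
  have h2 : ∀ ψ : ell2 V, ellRestrict univ ψ = ψ := fun ψ => by
    ext v
    exact ellRestrict_apply_of_mem (mem_univ v) ψ
  rw [h2, h2] at h1
  rw [h1.1]
  congr 1
  have hn := tn_pos n
  have hm := tn_pos m
  rw [eq_div_iff (by positivity)]
  have h3 := congrArg ENNReal.toReal (h.add_mul_greenSum n m)
  rw [ENNReal.toReal_mul, ENNReal.toReal_add (te_ne_top n) (te_ne_top m), ENNReal.toReal_add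
    (hE_ne_top _ _ _) (hE_ne_top _ _ _), te, te, ENNReal.toReal_ofReal hn.le,
    ENNReal.toReal_ofReal hm.le] at h3
  rw [← h3, mul_comm]

lemma norm_sq_greenVec (h : ConvTree G hG o) (n : ℕ) : ‖greenVec h n‖ ^ 2 = (hE G n o none).toReal / tn n := by
  rw [← inner_self_eq_norm_sq (𝕜 := ℂ), inner_greenVec h n n, RCLike.re_to_complex,
    Complex.ofReal_re, ← two_mul, ← two_mul, mul_div_mul_left _ _ two_ne_zero]

/-- The Green vectors form a Cauchy sequence when `β` is finite. -/
lemma exists_tendsto_greenVec (h : ConvTree G hG o) {B : ℝ}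
    (hmono : Monotone fun n => (hE G n o none).toReal / tn n)
    (hlim : Tendsto (fun n => (hE G n o none).toReal / tn n) atTop (𝓝 B)) :
    ∃ ψ, Tendsto (greenVec h) atTop (𝓝 ψ) := by
  refine cauchySeq_tendsto_of_complete (cauchySeq_of_le_tendsto_0'
    (fun n => √(B - (hE G n o none).toReal / tn n)) ?_ ?_)
  · intro n m hnm
    rw [dist_eq_norm]
    refine Real.le_sqrt_of_sq_le ?_
    rw [@norm_sub_sq ℂ, norm_sq_greenVec, norm_sq_greenVec, inner_greenVec, RCLike.re_to_complex,
      Complex.ofReal_re]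
    have h1 := hmono hnm
    have h2 := hmono.ge_of_tendsto hlim m
    simp only at h1 h2
    have hn := tn_pos n
    have hm := tn_pos m
    -- The inner product is the mediant of the two squared norms, so it is at least the smaller one
    -- and the squared distance is at most their difference.
    have h3 : (hE G n o none).toReal / tn n ≤
        ((hE G n o none).toReal + (hE G m o none).toReal) / (tn n + tn m) := by
      rw [div_le_div_iff₀ hn hm] at h1
      rw [div_le_div_iff₀ hn (by positivity)]
      linarith
    linarith
  · have h1 := (hlim.const_sub B).sqrt
    rwa [sub_self, Real.sqrt_zero] at h1

/-- The `ℓ²` limit of the Green vectors vanishes on `S`, so the sum over `S` is bounded by the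
product of their distances to that limit. -/
lemma tendsto_greenSum_of_tendsto_zero (h : ConvTree G hG o) {B : ℝ} {S : Set V}
    (hmono : Monotone fun n => (hE G n o none).toReal / tn n)
    (hlim : Tendsto (fun n => (hE G n o none).toReal / tn n) atTop (𝓝 B))
    (hS : ∀ v ∈ S, Tendsto (fun n => gE G n o v) atTop (𝓝 0)) :
    Tendsto (fun n => greenSum G S (n + 1) n o) atTop (𝓝 0) := by
  obtain ⟨ψ, hψ⟩ := exists_tendsto_greenVec h hmono hlim
  have hψS : ∀ v ∈ S, ψ v = 0 := by
    intro v hv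
    have h1 := (tendsto_apply hψ v).norm
    simp only [norm_greenVec_apply] at h1
    have h2 := (ENNReal.tendsto_toReal ENNReal.zero_ne_top).comp (hS v hv)
    exact norm_eq_zero.1 (tendsto_nhds_unique h1 h2)
  have h1 : Tendsto (fun n => ‖greenVec h n - ψ‖) atTop (𝓝 0) := tendsto_iff_norm_sub_tendsto_zero.1 hψ
  have h2 : Tendsto (fun n => ‖greenVec h (n + 1) - ψ‖ * ‖greenVec h n - ψ‖) atTop (𝓝 0) := by
    simpa using (h1.comp (tendsto_add_atTop_nat 1)).mul h1
  have h3 : Tendsto (fun n => (greenSum G S (n + 1) n o).toReal) atTop (𝓝 0) := by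
    refine squeeze_zero (fun n => ENNReal.toReal_nonneg) (fun n => ?_) h2
    have h4 := (inner_ellRestrict_greenVec h S (n + 1) n).1
    have h5 := norm_inner_le_norm (𝕜 := ℂ) (ellRestrict S (greenVec h (n + 1)))
      (ellRestrict S (greenVec h n))
    rw [h4, Complex.norm_real, Real.norm_of_nonneg ENNReal.toReal_nonneg] at h5
    refine h5.trans ?_
    rw [← ellRestrict_sub_of_eq_zero hψS (greenVec h (n + 1)),
      ← ellRestrict_sub_of_eq_zero hψS (greenVec h n)]
    exact mul_le_mul (norm_ellRestrict_le _ _) (norm_ellRestrict_le _ _) (norm_nonneg _)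
      (norm_nonneg _)
  have h6 := ENNReal.tendsto_ofReal h3
  rw [ENNReal.ofReal_zero] at h6
  refine h6.congr fun n => ENNReal.ofReal_toReal (inner_ellRestrict_greenVec h S (n + 1) n).2

lemma ConvTree.gE_mul_self_le (h : ConvTree G hG o) (n : ℕ) (v : V) :
    gE G n o v * gE G n o v ≤ hE G n o none / te n := by
  classical
  have h1 := h.add_mul_greenSum n n
  rw [← two_mul, ← two_mul, mul_assoc, ENNReal.mul_right_inj (by simp) (by simp)] at h1
  rw [← h1, mul_div_assoc, ENNReal.mul_div_cancel (te_ne_zero n) (te_ne_top n)]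
  refine le_trans ?_ (ENNReal.le_tsum v)
  rw [if_pos (mem_univ v)]

/-- The condition that defines the chains towards `o`: the vertices at odd distance carry mass. -/
def OddMass (G : SimpleGraph V) (o u : V) : Prop := ¬ Even (G.dist o u) → aE G u none ≠ 0

/-- The endpoints have opposite parities, so even distance from `w` means odd distance from `o`
along the path. -/
lemma chain_evenMass_iff (hw : ¬ Even (G.dist w o)) :
    Chain G (EvenMass G w) w o ↔ Chain G (OddMass G o) o w := by
  rw [chain_comm (r := o)]
  refine chain_congr fun u hu => ?_
  have h1 : Even (G.dist w u) ↔ ¬ Even (G.dist o u) := by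
    rw [hu, Nat.even_add, SimpleGraph.dist_comm (u := u)] at hw
    tauto
  rw [EvenMass, OddMass, h1]

lemma GoodTree.crowded_of_chain (h : GoodTree G hG) (hw : ¬ Even (G.dist o w))
    (hc : Chain G (OddMass G o) o w) : Crowded G o := by
  have hwo : w ≠ o := by rintro rfl; simp at hw
  obtain ⟨u, hu, hu'⟩ := exists_parent h.isTree.connected hwo.symm
  refine h.crowded_of_adj (u := u) (hc u ?_ ?_) hu
  · rw [SimpleGraph.dist_comm (u := o) (v := u), SimpleGraph.dist_comm (u := o), hu',
      SimpleGraph.dist_eq_one_iff_adj.2 hu, SimpleGraph.dist_comm, add_comm]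
  · rw [SimpleGraph.dist_comm, SimpleGraph.dist_eq_one_iff_adj.2 hu]
    decide

lemma hE_le_inv (n : ℕ) (x : V) (p : Option V) : hE G n x p ≤ (te n)⁻¹ :=
  iSup_le fun _ => msg_le_inv _ _ _

/-- Along two edges, the factor into the massive odd vertex costs at most `t⁻¹`, and the factor out
of it gains `t` times a finite `β`. The order `t` of the Green function at `o` is thus preserved
along the chain. -/
lemma GoodTree.gE_le_of_even_chain (h : GoodTree G hG) (ho : Crowded G o) (p : V)
    (hp : Even (G.dist o p)) (hc : Chain G (OddMass G o) o p) :
    Crowded G p ∧ ∃ C : ℝ≥0∞, C ≠ ∞ ∧ ∀ n, gE G n o p ≤ C * te n := by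
  have hT := h.isTree
  induction hk : G.dist o p using Nat.strong_induction_on generalizing p with
  | _ k ih =>
    by_cases hpo : p = o
    · subst hpo
      refine ⟨ho, bE G p none, h.bE_ne_top_of_crowded ho (isDart_none p), fun n => ?_⟩
      rw [gE_self, mul_comm]
      exact h.hE_le (isDart_none p) n
    · obtain ⟨q, hq, hq'⟩ := exists_parent hT.connected hpo
      have hcq := (IsTree.chain_succ hT hq hq').1 hc
      have hqe : ¬ Even (G.dist o q) := by
        rw [hq', Nat.even_add_one] at hp
        exact hp
      have hqo : q ≠ o := by rintro rfl; simp at hqe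
      obtain ⟨q', hqq, hqq'⟩ := exists_parent hT.connected hqo
      have hcq' := (IsTree.chain_succ hT hqq hqq').1 hcq.1
      have hqD : aE G q none ≠ 0 := hcq.1.right hqe
      obtain ⟨-, C, hC, hC'⟩ := ih (G.dist o q') (by omega) q' (by
        rw [hqq', Nat.even_add_one] at hqe; exact not_not.1 hqe) hcq'.1 rfl
      refine ⟨h.crowded_of_adj hqD hq, C * bE G p (some q),
        ENNReal.mul_ne_top hC (h.bE_ne_top_of_aE_ne_zero hqD hq), fun n => ?_⟩
      have h1 : gE G n o p = gE G n o q' * hE G n q (some q') * hE G n p (some q) := by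
        rw [gE, gE, IsTree.pathProd_succ hT _ hq hq', IsTree.pathProd_succ hT _ hqq hqq']
        ring
      calc gE G n o p ≤ C * te n * (te n)⁻¹ * (te n * bE G p (some q)) := by
            rw [h1]
            exact mul_le_mul' (mul_le_mul' (hC' n) (hE_le_inv _ _ _)) (h.hE_le (isDart_some hq) n)
        _ = C * bE G p (some q) * te n := by
            rw [mul_assoc C, ENNReal.mul_inv_cancel (te_ne_zero n) (te_ne_top n), mul_one]
            ring

/-- Let the condition first fail at `x`, with predecessor `p`. Up to `p` the Green function has
order `t`, and beyond it its square is at most `h(x → p) / t`. The square of the product is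
therefore bounded by a multiple of `t h(x → p)`, which tends to `α_{x → p} = 0`. -/
lemma GoodTree.tendsto_gE_zero (h : GoodTree G hG) (ho : Crowded G o)
    (hc : ¬ Chain G (OddMass G o) o w) : Tendsto (fun n => gE G n o w) atTop (𝓝 0) := by
  classical
  have hT := h.isTree
  have hQ : OddMass G o o := fun e => absurd (by simp) e
  have h1 := IsTree.chain_add_exit hT hQ w
  rw [if_neg hc, zero_add] at h1
  have h2 : ∃ p x, exitInd G (OddMass G o) o w p x ≠ 0 := by
    by_contra! h2
    simp [h2] at h1
  obtain ⟨p, x, hpx⟩ := h2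
  rw [exitInd, ite_ne_right_iff] at hpx
  obtain ⟨⟨hx, hcp, hQx, hwx⟩, -⟩ := hpx
  rw [OddMass] at hQx
  push Not at hQx
  obtain ⟨hxo, hx0⟩ := hQx
  have hpe : Even (G.dist o p) := by
    rw [hx.2, Nat.even_add_one] at hxo
    exact not_not.1 hxo
  obtain ⟨hS, C, hC, hC'⟩ := h.gE_le_of_even_chain ho p hpe hcp
  have ha : aE G x (some p) = 0 := (h.aE_eq_zero_iff_of_crowded hS hx.1).1 hx0
  have h3 : ∀ n, gE G n o w * gE G n o w ≤ C * C * (te n * hE G n x (some p)) := by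
    intro n
    have h4 := (h.branch hx.1).gE_mul_self_le n ⟨w, hwx⟩
    rw [hE_branch h hx.1] at h4
    have h5 : gE G n o w = gE G n o p *
        gE (AtomAtZero.branch G x p) n ⟨x, mem_branchSet G hx.1⟩ ⟨w, hwx⟩ := by
      rw [gE_branch h hx.1, gE, gE, IsTree.pathProd_mul hT _ (IsTree.dist_eq_add_of_isChild hT hx hwx),
        IsTree.pathProd_succ hT _ hx.1 hx.2]
      ring
    rw [h5, mul_mul_mul_comm]
    calc _ ≤ (C * te n) * (C * te n) * (hE G n x (some p) / te n) :=
          mul_le_mul' (mul_le_mul' (hC' n) (hC' n)) h4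
      _ = C * C * (te n * (te n * (hE G n x (some p) / te n))) := by ring
      _ = _ := by rw [ENNReal.mul_div_cancel (te_ne_zero n) (te_ne_top n)]
  have h6 := ENNReal.Tendsto.const_mul (a := C * C) (h.tendsto_aE (isDart_some hx.1))
    (Or.inr (ENNReal.mul_ne_top hC hC))
  rw [ha, mul_zero] at h6
  have h7 := tendsto_of_tendsto_of_tendsto_of_le_of_le tendsto_const_nhds h6 (fun n => zero_le) h3
  have h8 := h7.ennrpow_const (1 / 2)
  rw [ENNReal.zero_rpow_of_pos (by norm_num)] at h8
  refine h8.congr fun n => ?_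
  rw [← pow_two, ← ENNReal.rpow_natCast, ← ENNReal.rpow_mul]
  norm_num

lemma GoodTree.real_hE_div (h : GoodTree G hG) (ho : bE G o none ≠ ∞) :
    (Monotone fun n => (hE G n o none).toReal / tn n) ∧
      Tendsto (fun n => (hE G n o none).toReal / tn n) atTop (𝓝 (bE G o none).toReal) := by
  have h1 : ∀ n, (hE G n o none).toReal / tn n = (hE G n o none / te n).toReal := by
    intro n
    rw [ENNReal.toReal_div, te, ENNReal.toReal_ofReal (tn_pos n).le]
  simp only [h1]
  refine ⟨fun n m hnm => ENNReal.toReal_mono ?_ (h.monotone_hE_div (isDart_none o) hnm),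
    (ENNReal.tendsto_toReal ho).comp (h.tendsto_bE (isDart_none o))⟩
  exact ENNReal.div_ne_top (hE_ne_top _ _ _) (te_ne_zero m)

/-- The vertices that can send mass to `o`. -/
def sources (G : SimpleGraph V) (o : V) : Set V :=
  {w | ¬ Even (G.dist o w) ∧ Chain G (OddMass G o) o w}

lemma GoodTree.tsum_transport_eq (h : GoodTree G hG) (n : ℕ) :
    ∑' w, transport G n w o = greenSum G (sources G o) (n + 1) n o * deadSum G n o := by
  classical
  rw [greenSum, ← ENNReal.tsum_mul_right]
  refine tsum_congr fun w => ?_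
  by_cases hw : ¬ Even (G.dist w o)
  · by_cases hc : Chain G (EvenMass G w) w o
    · rw [transport, if_pos ⟨hw, hc⟩, if_pos (show w ∈ sources G o from
        ⟨by rwa [SimpleGraph.dist_comm], (chain_evenMass_iff hw).1 hc⟩), gg, h.gE_symm _ w,
        h.gE_symm _ w]
    · rw [transport, if_neg fun e => hc e.2, if_neg (show w ∉ sources G o from
        fun e => hc ((chain_evenMass_iff hw).2 e.2)), zero_mul]
  · rw [transport, if_neg fun e => hw e.1, if_neg (show w ∉ sources G o from
        fun e => hw (by rw [SimpleGraph.dist_comm]; exact e.1)), zero_mul]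

lemma GoodTree.greenSum_sources_le (h : GoodTree G hG) (n : ℕ) :
    greenSum G (sources G o) (n + 1) n o ≤ bE G o none := by
  refine (greenSum_mono (S' := (evenSet G o)ᶜ) (fun w hw => hw.1) _ _).trans ?_
  rw [(h.root o).odd_greenSum]
  exact h.cE_le (isDart_none o) n

lemma GoodTree.greenSum_sources_eq_zero (h : GoodTree G hG) (ho : ¬ Crowded G o) (n : ℕ) :
    greenSum G (sources G o) (n + 1) n o = 0 := by
  have : sources G o = ∅ := eq_empty_of_forall_notMem fun w hw =>
    ho (h.crowded_of_chain hw.1 hw.2)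
  simp [greenSum, this]

/-- The full odd sum tends to `β_o`, because finiteness of `β_o` excludes an atom, while the part
outside the sources tends to zero. -/
lemma GoodTree.tendsto_greenSum_sources (h : GoodTree G hG) (ho : Crowded G o) :
    Tendsto (fun n => greenSum G (sources G o) (n + 1) n o) atTop (𝓝 (bE G o none)) := by
  have hb := h.bE_ne_top_of_crowded ho (isDart_none o)
  obtain ⟨h1, h2⟩ := h.real_hE_div hb
  have hsub : sources G o ⊆ (evenSet G o)ᶜ := fun w hw => hw.1
  have h3 := tendsto_greenSum_of_tendsto_zero (h.root o) (S := (evenSet G o)ᶜ \ sources G o) h1 h2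
    fun w hw => h.tendsto_gE_zero ho fun e => hw.2 ⟨hw.1, e⟩
  have h4 : ∀ n, greenSum G (sources G o) (n + 1) n o =
      cE G n o none - greenSum G ((evenSet G o)ᶜ \ sources G o) (n + 1) n o := by
    intro n
    rw [← (h.root o).odd_greenSum, ← greenSum_add_diff hsub, ENNReal.add_sub_cancel_right]
    exact (inner_ellRestrict_greenVec (h.root o) _ _ _).2
  simp only [h4]
  have h5 := ENNReal.Tendsto.sub (h.tendsto_cE (isDart_none o) (h.aE_eq_zero (isDart_none o) hb)) h3
    (Or.inl hb)
  rwa [tsub_zero] at h5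

open Classical in
/-- The limit of `deadSum`. -/
def deadLim (G : SimpleGraph V) (o : V) : ℝ≥0∞ :=
  1 + nbrSum G o none fun x => if aE G x (some o) = 0 then bE G x (some o) else 0

open Classical in
lemma GoodTree.deadSum_eq (h : GoodTree G hG) (ho : Crowded G o) (n : ℕ) :
    deadSum G n o =
      1 + nbrSum G o none fun x => if aE G x (some o) = 0 then cE G n x (some o) else 0 := by
  rw [deadSum]
  congr 1
  refine nbrSum_congr fun x hx _ => ?_
  by_cases h0 : aE G x none = 0
  · rw [if_pos h0, if_pos ((h.aE_eq_zero_iff_of_crowded ho hx).1 h0)]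
  · rw [if_neg h0, if_neg fun e => h0 ((h.aE_eq_zero_iff_of_crowded ho hx).2 e)]

open Classical in
/-- The limit of the mass received by `o`. -/
def received (G : SimpleGraph V) (o : V) : ℝ≥0∞ :=
  if Crowded G o then bE G o none * deadLim G o else 0

/-- The limit dominates every scale, so no uniform integrability is needed to interchange the limit
and the expectation. -/
lemma GoodTree.tsum_transport_le (h : GoodTree G hG) (n : ℕ) :
    ∑' w, transport G n w o ≤ received G o := by
  classical
  rw [h.tsum_transport_eq, received]
  split_ifs with ho
  · refine mul_le_mul' (h.greenSum_sources_le n) ?_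
    rw [h.deadSum_eq ho, deadLim]
    gcongr
    refine nbrSum_mono fun x hx => ?_
    split_ifs
    · exact h.cE_le (isDart_some hx) n
    · exact le_rfl
  · rw [h.greenSum_sources_eq_zero ho, zero_mul]

lemma GoodTree.tendsto_tsum_transport (h : GoodTree G hG) (o : V) :
    Tendsto (fun n => ∑' w, transport G n w o) atTop (𝓝 (received G o)) := by
  classical
  simp only [h.tsum_transport_eq]
  rw [received]
  split_ifs with ho
  · simp only [h.deadSum_eq ho]
    refine ENNReal.Tendsto.mul (h.tendsto_greenSum_sources ho)
      (Or.inl (h.bE_ne_zero (isDart_none o))) ?_ (Or.inr (h.bE_ne_top_of_crowded ho (isDart_none o)))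
    refine tendsto_const_nhds.add (tendsto_nbrSum hG fun x hx _ => ?_)
    split_ifs with h0
    · exact h.tendsto_cE (isDart_some hx) h0
    · exact tendsto_const_nhds
  · simp only [h.greenSum_sources_eq_zero ho, zero_mul]
    exact tendsto_const_nhds

end Incoming

/-! ### Measurability of the mass transport -/

section MeasurableTransport

open Filter Topology

variable {k : ℕ}

lemma MeasPred.ite_decidable {p : RootedGraph k → Prop} {_ : ∀ G, Decidable (p G)}
    (hp : MeasPred p) {A B : RootedGraph k → ℝ≥0∞} (hA : MeasFn A) (hB : MeasFn B) :
    MeasFn fun G => if p G then A G else B G :=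
  (hp.ite hA hB).congr fun _ => ite_eq_ite_of_iff Iff.rfl

lemma measFn_hE_some (n : ℕ) :
    MeasFn fun G : RootedGraph 2 => hE G.graph n (G.root 0) (some (G.root 1)) :=
  measFn_msgLo_some _

lemma measFn_hE_none (n : ℕ) : MeasFn fun G : RootedGraph 1 => hE G.graph n (G.root 0) none :=
  measFn_msgLo_none _

lemma measFn_aE_some : MeasFn fun G : RootedGraph 2 => aE G.graph (G.root 0) (some (G.root 1)) :=
  MeasFn.liminf fun n => (MeasFn.const (te n)).mul (measFn_hE_some n)

lemma measFn_aE_none : MeasFn fun G : RootedGraph 1 => aE G.graph (G.root 0) none :=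
  MeasFn.liminf fun n => (MeasFn.const (te n)).mul (measFn_hE_none n)

lemma measFn_bE_none : MeasFn fun G : RootedGraph 1 => bE G.graph (G.root 0) none :=
  MeasFn.liminf fun n => (measFn_hE_none n).comp (g := fun x => x / te n) (by fun_prop)

lemma measFn_cE_some (n : ℕ) :
    MeasFn fun G : RootedGraph 2 => cE G.graph n (G.root 0) (some (G.root 1)) :=
  (measFn_hE_some n).comp₂ (measFn_hE_some (n + 1))
    (g := fun p => (2 * p.1 - p.2) / (3 * te (n + 1))) (by fun_prop)

lemma measFn_deadSum (n : ℕ) : MeasFn fun G : RootedGraph 1 => deadSum G.graph n (G.root 0) := by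
  classical
  exact (MeasFn.const 1).add (measFn_nbrSum_none ((MeasPred.eq_zero
    (measFn_aE_none.reroot (k := 2) ![0])).ite_decidable (measFn_cE_some n) (MeasFn.const 0)))

lemma measFn_nbrSum_snd {F : RootedGraph 3 → ℝ≥0∞} (hF : MeasFn F) :
    MeasFn fun G : RootedGraph 2 => nbrSum G.graph (G.root 1) none fun y =>
      F (G.withRoots ![y, G.root 0, G.root 1]) := by
  classical
  have h := ((MeasPred.adj 2 0).ite hF (MeasFn.const 0)).sum
  refine h.congr fun G => ?_
  refine tsum_congr fun y => ?_
  have h1 : (Matrix.vecCons y G.root : Fin 3 → G.V) = ![y, G.root 0, G.root 1] := by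
    funext i; fin_cases i <;> rfl
  rw [h1]
  refine ite_eq_ite_of_iff ?_
  simp [RootedGraph.withRoots]

open Classical in
/-- A quantity which vanishes exactly when the distance between `w` and `v` exceeds `N`. -/
def walkCount {V : Type*} (G : SimpleGraph V) : ℕ → V → V → ℝ≥0∞
  | 0, w, v => if w = v then 1 else 0
  | N + 1, w, v => walkCount G N w v + nbrSum G v none fun u => walkCount G N w u

lemma walkCount_eq_zero {V : Type*} {G : SimpleGraph V} (hG : G.Connected) (N : ℕ) (w v : V) :
    walkCount G N w v = 0 ↔ N < G.dist w v := by
  classical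
  induction N generalizing v with
  | zero =>
    rw [walkCount, ite_eq_right_iff, Nat.pos_iff_ne_zero, Ne, hG.dist_eq_zero_iff]
    simp
  | succ N ih =>
    rw [walkCount, add_eq_zero, ih, nbrSum_eq_zero]
    simp only [ih]
    constructor
    · rintro ⟨h1, h2⟩
      have hv : v ≠ w := by rintro rfl; simp at h1
      obtain ⟨u, hu, hd⟩ := exists_parent hG hv
      have := h2 u hu.symm (by simp)
      omega
    · intro h
      refine ⟨by omega, fun u hu _ => ?_⟩
      have := dist_le_succ_of_adj hG w hu.symm
      omega

lemma measFn_walkCount (N : ℕ) :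
    MeasFn fun G : RootedGraph 2 => walkCount G.graph N (G.root 0) (G.root 1) := by
  induction N with
  | zero => exact MeasFn.eq 0 1
  | succ N ih => exact ih.add (measFn_nbrSum_snd (ih.reroot (k := 3) ![1, 0]))

open Classical in
/-- The weight of the chains of length `N` from `w` to `v`. -/
def chainWeight {V : Type*} (G : SimpleGraph V) (n : ℕ) : ℕ → V → V → ℝ≥0∞
  | 0, w, v => if w = v then
      (if aE G v none = 0 then 0 else hE G (n + 1) v none * hE G n v none) else 0
  | N + 1, w, v => if walkCount G N w v = 0 then
      (nbrSum G v none fun u => chainWeight G n N w u *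
        (hE G (n + 1) v (some u) * hE G n v (some u))) *
        (if Even (N + 1) then (if aE G v none = 0 then 0 else 1) else 1) else 0

lemma measFn_chainWeight (n N : ℕ) :
    MeasFn fun G : RootedGraph 2 => chainWeight G.graph n N (G.root 0) (G.root 1) := by
  classical
  have hA := MeasPred.eq_zero (measFn_aE_none.reroot (k := 2) ![1])
  induction N with
  | zero =>
    exact (MeasPred.eq 0 1).ite_decidable (hA.ite_decidable (MeasFn.const 0)
      (((measFn_hE_none (n + 1)).reroot (k := 2) ![1]).mul
        ((measFn_hE_none n).reroot (k := 2) ![1]))) (MeasFn.const 0)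
  | succ N ih =>
    have h1 := measFn_nbrSum_snd ((ih.reroot (k := 3) ![1, 0]).mul
      (((measFn_hE_some (n + 1)).reroot (k := 3) ![2, 0]).mul
        ((measFn_hE_some n).reroot (k := 3) ![2, 0])))
    have h2 : MeasFn fun G : RootedGraph 2 =>
        (if Even (N + 1) then (if aE G.graph (G.root 1) none = 0 then (0 : ℝ≥0∞) else 1) else 1) := by
      split_ifs
      · exact hA.ite_decidable (MeasFn.const 0) (MeasFn.const 1)
      · exact MeasFn.const 1
    exact (MeasPred.eq_zero (measFn_walkCount N)).ite_decidable (h1.mul h2) (MeasFn.const 0)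

open Classical in
-- The test on `walkCount` keeps vertices at distance larger than `N` from `w`. By the induction
-- hypothesis only neighbours at distance exactly `N` contribute, so the sum reduces to the unique
-- parent.
lemma IsTree.chainWeight_eq {V : Type*} {G : SimpleGraph V} (hT : G.IsTree) (n N : ℕ) (w v : V) :
    chainWeight G n N w v =
      if G.dist w v = N ∧ Chain G (EvenMass G w) w v then gg G n w v else 0 := by
  have hconn := hT.connected
  induction N generalizing v with
  | zero =>
    rw [chainWeight]
    simp only [hconn.dist_eq_zero_iff]
    by_cases hv : w = v
    · subst hv
      rw [if_pos rfl, chain_self hconn]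
      by_cases ha : aE G w none = 0
      · rw [if_pos ha, if_neg]
        rintro ⟨-, h⟩
        exact h (by simp) ha
      · rw [if_neg ha, if_pos ⟨rfl, fun _ => ha⟩, gg, gE_self, gE_self]
    · rw [if_neg hv, if_neg fun e => hv e.1]
  | succ N ih =>
    rw [chainWeight]
    simp only [walkCount_eq_zero hconn]
    by_cases hd : G.dist w v = N + 1
    · have hv : v ≠ w := by rintro rfl; simp at hd
      obtain ⟨u, hu, hu'⟩ := exists_parent hconn hv
      have hN : G.dist w u = N := by omega
      have h1 : (nbrSum G v none fun u => chainWeight G n N w u *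
          (hE G (n + 1) v (some u) * hE G n v (some u))) =
          if Chain G (EvenMass G w) w u then gg G n w v else 0 := by
        rw [nbrSum, tsum_eq_single u]
        · rw [if_pos ⟨hu.symm, by simp⟩, ih]
          by_cases hc : Chain G (EvenMass G w) w u
          · rw [if_pos ⟨hN, hc⟩, if_pos hc, gg, gg, gE, gE, gE, gE,
              IsTree.pathProd_succ hT _ hu hu', IsTree.pathProd_succ hT _ hu hu']
            ring
          · rw [if_neg fun e => hc e.2, if_neg hc, zero_mul]
        · intro z hz
          rw [ite_eq_right_iff]
          rintro ⟨hz', -⟩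
          rw [ih, if_neg, zero_mul]
          rintro ⟨hz2, -⟩
          exact hz (IsTree.eq_of_dist_succ hT hz'.symm hu (by omega) hu')
      rw [h1, if_pos (by omega)]
      have h2 := IsTree.chain_succ hT (Q := EvenMass G w) hu hu'
      by_cases hc : Chain G (EvenMass G w) w u
      · by_cases he : Even (N + 1)
        · by_cases ha : aE G v none = 0
          · rw [if_pos he, if_pos ha, mul_zero, if_neg]
            rintro ⟨-, h3⟩
            exact h3.right (by rwa [hd]) ha
          · rw [if_pos hc, if_pos he, if_neg ha, mul_one, if_pos ⟨hd, h2.2 ⟨hc, fun _ => ha⟩⟩]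
        · rw [if_pos hc, if_neg he, mul_one, if_pos ⟨hd, h2.2 ⟨hc, fun e => absurd (hd ▸ e) he⟩⟩]
      · rw [if_neg hc, zero_mul, if_neg]
        rintro ⟨-, h3⟩
        exact hc (h2.1 h3).1
    · rw [if_neg (fun e : _ ∧ _ => hd e.1), ite_eq_right_iff]
      intro hlt
      rw [nbrSum_eq_zero.2, zero_mul]
      intro u hu _
      rw [ih, if_neg, zero_mul]
      rintro ⟨h3, -⟩
      have := dist_le_succ_of_adj hconn w hu.symm
      omega

/-- The measurable version of the mass transport. -/
def transportFn (n : ℕ) (G : RootedGraph 2) : ℝ≥0∞ :=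
  (⨆ N, chainWeight G.graph n (2 * N + 1) (G.root 0) (G.root 1)) * deadSum G.graph n (G.root 1)

lemma measFn_transportFn (n : ℕ) : MeasFn (transportFn n) :=
  (MeasFn.iSup fun N => measFn_chainWeight n (2 * N + 1)).mul
    ((measFn_deadSum n).reroot (k := 2) ![1])

lemma transportFn_eq (n : ℕ) {G : RootedGraph 2} (hT : G.graph.IsTree) :
    transportFn n G = transport G.graph n (G.root 0) (G.root 1) := by
  classical
  rw [transportFn, transport]
  simp only [IsTree.chainWeight_eq hT]
  split_ifs with h
  · congr 1
    obtain ⟨N, hN⟩ := Nat.not_even_iff_odd.1 h.1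
    refine le_antisymm (iSup_le fun M => ?_) (le_iSup_of_le N ?_)
    · split_ifs
      · exact le_rfl
      · exact zero_le
    · rw [if_pos ⟨hN, h.2⟩]
  · rw [ENNReal.iSup_eq_zero.2, zero_mul]
    intro N
    refine if_neg fun e => h ⟨?_, e.2⟩
    rw [e.1]
    simp

/-- The existence of two distinct massive branches is written as nonvanishing of an iterated sum
over neighbours, to which the measurability lemmas apply. -/
lemma crowded_iff {V : Type*} {G : SimpleGraph V} {o : V} : Crowded G o ↔
    ¬ nbrSum G o none (fun y => aE G y (some o) *
      nbrSum G o (some y) fun z => aE G z (some o)) = 0 := by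
  rw [nbrSum_eq_zero]
  push Not
  constructor
  · rintro ⟨y, z, hy, hz, hyz, hy0, hz0⟩
    refine ⟨y, hy, by simp, mul_ne_zero hy0 fun e => hz0 (nbrSum_eq_zero.1 e z hz ?_)⟩
    simpa using hyz
  · rintro ⟨y, hy, -, h⟩
    have h2 := right_ne_zero_of_mul h
    rw [Ne, nbrSum_eq_zero] at h2
    push Not at h2
    obtain ⟨z, hz, hyz, hz0⟩ := h2
    exact ⟨y, z, hy, hz, by simpa using hyz, left_ne_zero_of_mul h, hz0⟩

lemma measPred_crowded : MeasPred fun G : RootedGraph 1 => Crowded G.graph (G.root 0) := by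
  refine MeasPred.congr (MeasPred.eq_zero (measFn_nbrSum_none (measFn_aE_some.mul
    ((measFn_nbrSum_some (measFn_aE_some.reroot (k := 3) ![0, 1])).reroot (k := 2) ![1, 0])))).not
    fun G => crowded_iff.symm

end MeasurableTransport

/-! ### The identity -/

section Identity

open Filter Topology

variable {Ω : Type*} [MeasurableSpace Ω] {P : Measure Ω} {T : Ω → RootedGraph 1}

/-- The tree is essentially self-adjoint and all continued fractions converge. -/
abbrev RootedGraph.Good (T : RootedGraph 1) : Prop := GoodTree T.graph T.locFin

lemma IsUnimodular.ae_good [IsProbabilityMeasure P] (hUni : IsUnimodular P T)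
    (hT : Measurable fun ω => (T ω).toClass) (hTree : ∀ᵐ ω ∂P, (T ω).graph.IsTree) :
    ∀ᵐ ω ∂P, (T ω).Good := by
  have h1 := ae_all_iff.2 fun n => hUni.msgLo_eq_msgHi hT (te_ne_zero n) (te_ne_top n)
  filter_upwards [hTree, h1] with ω h2 h3
  exact ⟨h2, h3⟩

variable {G : RootedGraph 1}

lemma RootedGraph.Good.specRoot_prob (h : G.Good) : IsProbabilityMeasure G.specRoot :=
  (h.ess.isSpectralMeasure _).1

lemma RootedGraph.Good.specBranch_prob (h : G.Good) (x : G.nbrs) :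
    IsProbabilityMeasure (G.specBranch x) :=
  ((h.branch x.2).ess.isSpectralMeasure _).1

lemma RootedGraph.Good.alpha_specRoot (h : G.Good) : alpha G.specRoot = aE G.graph G.o none := by
  have := h.specRoot_prob
  exact alpha_eq_aE (h.poisson_root G.o)

lemma RootedGraph.Good.beta_specRoot (h : G.Good) : beta G.specRoot = bE G.graph G.o none :=
  beta_eq_bE (h.poisson_root G.o)

lemma RootedGraph.Good.alpha_specBranch (h : G.Good) (x : G.nbrs) :
    alpha (G.specBranch x) = aE G.graph x (some G.o) := by
  have := h.specBranch_prob x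
  exact alpha_eq_aE (h.poisson_branch x.2)

lemma RootedGraph.Good.beta_specBranch (h : G.Good) (x : G.nbrs) :
    beta (G.specBranch x) = bE G.graph x (some G.o) := beta_eq_bE (h.poisson_branch x.2)

lemma RootedGraph.Good.two_le_Nplus_iff (h : G.Good) : 2 ≤ G.Nplus ↔ Crowded G.graph G.o := by
  have hfin : Finite G.nbrs := (G.locFin G.o).to_subtype
  rw [Nplus, Nat.succ_le_iff, Set.one_lt_ncard (Set.toFinite _)]
  simp only [Set.mem_ofPred_eq, h.alpha_specBranch, pos_iff_ne_zero]
  constructor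
  · rintro ⟨y, hy, z, hz, hyz⟩
    exact ⟨y, z, y.2, z.2, fun e => hyz (Subtype.ext e), hy, hz⟩
  · rintro ⟨y, z, hy, hz, hyz, hy0, hz0⟩
    exact ⟨⟨y, hy⟩, hy0, ⟨z, hz⟩, hz0, fun e => hyz (congrArg Subtype.val e)⟩

lemma tsum_nbrs (F : G.V → ℝ≥0∞) : ∑' x : G.nbrs, F x = nbrSum G.graph G.o none F := by
  classical
  rw [tsum_subtype, nbrSum]
  refine tsum_congr fun x => ?_
  by_cases hx : G.graph.Adj G.o x
  · rw [if_pos ⟨hx, by simp⟩, indicator_of_mem (by exact hx)]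
  · rw [if_neg fun e => hx e.1, indicator_of_notMem (by exact hx)]

open Classical in
-- As `β_o` is the inverse of `∑ α_{x → o}`, its product with the dead sum is the required quotient.
lemma RootedGraph.Good.received_eq (h : G.Good) : received G.graph G.o =
    (if 2 ≤ G.Nplus then beta G.specRoot else 0) +
      (if 2 ≤ G.Nplus then
        (∑' x : G.nbrs, if alpha (G.specBranch x) = 0 then beta (G.specBranch x) else 0) /
        (∑' x : G.nbrs, if 0 < alpha (G.specBranch x) then alpha (G.specBranch x) else 0)
      else 0) := by
  rw [received]
  by_cases hc : Crowded G.graph G.o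
  · have hN := h.two_le_Nplus_iff.2 hc
    rw [if_pos hc, if_pos hN, if_pos hN, h.beta_specRoot]
    simp only [h.alpha_specBranch, h.beta_specBranch]
    rw [tsum_nbrs fun x => if aE G.graph x (some G.o) = 0 then bE G.graph x (some G.o) else 0,
      tsum_nbrs fun x => if 0 < aE G.graph x (some G.o) then aE G.graph x (some G.o) else 0]
    have h1 : (nbrSum G.graph G.o none fun x =>
        if 0 < aE G.graph x (some G.o) then aE G.graph x (some G.o) else 0) =
        nbrSum G.graph G.o none fun x => aE G.graph x (some G.o) := by
      refine nbrSum_congr fun x _ _ => ?_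
      split_ifs with h0
      · rfl
      · exact (nonpos_iff_eq_zero.1 (not_lt.1 h0)).symm
    rw [h1, ENNReal.div_eq_inv_mul, ← h.bE_rec (isDart_none G.o), deadLim, mul_add, mul_one]
  · have hN : ¬ 2 ≤ G.Nplus := fun e => hc (h.two_le_Nplus_iff.1 e)
    rw [if_neg hc, if_neg hN, if_neg hN, add_zero]

lemma RootedGraph.Good.withRoots_isTree {k : ℕ} (h : G.Good) (root : Fin k → G.V) :
    (G.withRoots root).graph.IsTree := h.isTree

lemma RootedGraph.Good.tsum_transportFn_out (h : G.Good) (n : ℕ) :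
    ∑' x, transportFn n (G.withRoots ![G.o, x]) = ∑' x, transport G.graph n G.o x :=
  tsum_congr fun _ => transportFn_eq n (h.withRoots_isTree _)

lemma RootedGraph.Good.tsum_transportFn_in (h : G.Good) (n : ℕ) :
    ∑' x, transportFn n (G.withRoots ![x, G.o]) = ∑' x, transport G.graph n x G.o :=
  tsum_congr fun _ => transportFn_eq n (h.withRoots_isTree _)

open Classical in
/-- The mass sent by the root increases to `1_{α > 0} β⋆`. -/
lemma RootedGraph.Good.tendsto_out (h : G.Good) :
    Tendsto (fun n => ∑' x, transport G.graph n G.o x) atTop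
      (𝓝 (if alpha G.specRoot = 0 then 0 else betaStar G.specRoot)) ∧
    Monotone fun n => ∑' x, transport G.graph n G.o x := by
  have := h.specRoot_prob
  rw [h.alpha_specRoot]
  by_cases ha : aE G.graph G.o none = 0
  · simp only [transport_eq_zero ha, tsum_zero, if_pos ha]
    exact ⟨tendsto_const_nhds, monotone_const⟩
  · have h1 : ∀ n, ∑' x, transport G.graph n G.o x = bInt G.specRoot n := fun n => by
      rw [h.tsum_transport ha, bInt_eq_cE (μ := G.specRoot) (h.poisson_root G.o)]
    simp only [h1, if_neg ha]
    exact tendsto_bInt _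

lemma measFn_sum_out {F : RootedGraph 2 → ℝ≥0∞} (hF : MeasFn F) :
    MeasFn fun G : RootedGraph 1 => ∑' x, F (G.withRoots ![G.o, x]) := by
  refine (hF.reroot (k := 2) ![1, 0]).sum.congr fun G => tsum_congr fun x => ?_
  show F (G.withRoots _) = _
  congr 2
  funext i
  fin_cases i <;> rfl

lemma measFn_sum_in {F : RootedGraph 2 → ℝ≥0∞} (hF : MeasFn F) :
    MeasFn fun G : RootedGraph 1 => ∑' x, F (G.withRoots ![x, G.o]) := by
  refine hF.sum.congr fun G => tsum_congr fun x => ?_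
  congr 2
  funext i
  fin_cases i <;> rfl

open Classical in
-- The sent mass converges monotonically. The received mass is at most its limit at every scale,
-- which gives one inequality, and Fatou's lemma gives the other.
lemma IsUnimodular.lintegral_betaStar_eq_received (hUni : IsUnimodular P T)
    (hT : Measurable fun ω => (T ω).toClass) (hgood : ∀ᵐ ω ∂P, (T ω).Good) :
    ∫⁻ ω, (if alpha (T ω).specRoot = 0 then 0 else betaStar (T ω).specRoot) ∂P =
      ∫⁻ ω, received (T ω).graph (T ω).o ∂P := by
  have m1 := fun n => (measFn_sum_out (measFn_transportFn n)).measurable hT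
  have m2 := fun n => (measFn_sum_in (measFn_transportFn n)).measurable hT
  have l1 : Tendsto (fun n => ∫⁻ ω, ∑' x, transportFn n ((T ω).withRoots ![(T ω).o, x]) ∂P) atTop
      (𝓝 (∫⁻ ω, (if alpha (T ω).specRoot = 0 then 0 else betaStar (T ω).specRoot) ∂P)) := by
    refine lintegral_tendsto_of_tendsto_of_monotone (fun n => (m1 n).aemeasurable) ?_ ?_
    · filter_upwards [hgood] with ω h
      simp only [h.tsum_transportFn_out]
      exact h.tendsto_out.2
    · filter_upwards [hgood] with ω h
      simp only [h.tsum_transportFn_out]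
      exact h.tendsto_out.1
  simp only [hUni.massTransport (measFn_transportFn _)] at l1
  have h2 : ∀ n, ∫⁻ ω, ∑' x, transportFn n ((T ω).withRoots ![x, (T ω).o]) ∂P ≤
      ∫⁻ ω, received (T ω).graph (T ω).o ∂P := by
    intro n
    refine lintegral_mono_ae ?_
    filter_upwards [hgood] with ω h
    rw [h.tsum_transportFn_in]
    exact h.tsum_transport_le n
  refine le_antisymm (le_of_tendsto' l1 h2) ?_
  rw [← l1.liminf_eq]
  refine le_trans (le_of_eq (lintegral_congr_ae ?_)) (lintegral_liminf_le m2)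
  filter_upwards [hgood] with ω h
  simp only [h.tsum_transportFn_in]
  exact (h.tendsto_tsum_transport (T ω).o).liminf_eq.symm

end Identity

end AtomAtZero

end

open AtomAtZero in
open scoped Classical in
theorem mainTheorem4 {Ω : Type*} [MeasurableSpace Ω] (P : MeasureTheory.Measure Ω)
    [MeasureTheory.IsProbabilityMeasure P] (T : Ω → RootedGraph 1)
    (hT : Measurable fun ω => (T ω).toClass)
    (hTree : ∀ᵐ ω ∂P, (T ω).graph.IsTree)
    (hUni : IsUnimodular P T) :
    (∀ᵐ ω ∂P, EssSelfAdj (T ω).graph (T ω).locFin ∧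
      ∀ x : (T ω).nbrs, EssSelfAdj (branch (T ω).graph x (T ω).o)
        (branch_locFin (T ω).graph (T ω).locFin x (T ω).o)) ∧
    ∫⁻ ω, betaStar (T ω).specRoot ∂P =
      (∫⁻ ω, (if alpha (T ω).specRoot = 0 then beta (T ω).specRoot else 0) ∂P) +
      (∫⁻ ω, (if 2 ≤ (T ω).Nplus then beta (T ω).specRoot else 0) ∂P) +
      (∫⁻ ω, (if 2 ≤ (T ω).Nplus then
          (∑' x : (T ω).nbrs,
            if alpha ((T ω).specBranch x) = 0 then beta ((T ω).specBranch x) else 0) /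
          (∑' x : (T ω).nbrs,
            if 0 < alpha ((T ω).specBranch x) then alpha ((T ω).specBranch x) else 0)
        else 0) ∂P) := by
  have hgood := hUni.ae_good hT hTree
  refine ⟨?_, ?_⟩
  · filter_upwards [hgood] with ω h
    exact ⟨h.ess, fun x => (h.branch x.2).ess⟩
  -- The spectral quantities are not known to be measurable off the good event, so they are replaced
  -- by the Borel functions `aE` and `bE`, with which they agree almost surely.
  have h1 : AEMeasurable (fun ω => if alpha (T ω).specRoot = 0 then beta (T ω).specRoot else 0)
      P := by
    refine ⟨_, ((MeasPred.eq_zero measFn_aE_none).ite measFn_bE_none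
      (MeasFn.const 0)).measurable hT, ?_⟩
    filter_upwards [hgood] with ω h
    rw [h.alpha_specRoot, h.beta_specRoot]
    exact ite_eq_ite_of_iff Iff.rfl
  have h2 : AEMeasurable (fun ω => if 2 ≤ (T ω).Nplus then beta (T ω).specRoot else 0) P := by
    refine ⟨_, (measPred_crowded.ite measFn_bE_none (MeasFn.const 0)).measurable hT, ?_⟩
    filter_upwards [hgood] with ω h
    rw [h.beta_specRoot]
    exact ite_eq_ite_of_iff h.two_le_Nplus_iff
  have h3 : ∫⁻ ω, received (T ω).graph (T ω).o ∂P = _ :=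
    lintegral_congr_ae (hgood.mono fun ω h => h.received_eq)
  rw [add_assoc, ← MeasureTheory.lintegral_add_left' h2, ← h3,
    ← hUni.lintegral_betaStar_eq_received hT hgood, ← MeasureTheory.lintegral_add_left' h1]
  refine MeasureTheory.lintegral_congr fun ω => ?_
  -- If there is no atom, the excluded point does not matter and `β⋆ = β`. Otherwise the value is
  -- the one already accounted for by the transport.
  by_cases h : alpha (T ω).specRoot = 0
  · rw [if_pos h, if_pos h, add_zero, betaStar_eq_beta _ h]
  · rw [if_neg h, if_neg h, zero_add]
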